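/- Let $n\ge 0$ and let $X\subseteq\mathbb P^{2n}=\mathbb P^{2n}_{\mathbb C}$ be a closed irreducible subvariety of dimension $n$. For $x\in X$ let $t_xX\subseteq\mathbb P^{2n}$ be the projective (Zariski) tangent space, and let $\operatorname{Tan}X$ be the Zariski closure of the union of the $t_xX$ over all smooth points $x$ of $X$. For $P\in\mathbb P^{2n}$ let $\pi_P:X\setminus\{P\}\to\mathbb P^{2n-1}$ be the linear projection from $P$, and let $R(\pi_P)$ be its ramification locus, i.e. the set of those $x\in X\setminus\{P\}$ at which the differential of $\pi_P$ on the Zariski tangent space $T_xX$ is not injective. (Note that $X\setminus\{P\}=X$ if $P\notin X$.) Theorem 2.2. Suppose that $\operatorname{Tan}X=\mathbb P^{2n}$. Then: (1) A generic point $P\in\mathbb P^{2n}$ is uniquely determined by $R(\pi_P)$: there is a nonempty Zariski open subset $U\subseteq\mathbb P^{2n}$ such that for all $P\in U$ and all $Q\in\mathbb P^{2n}$, $R(\pi_Q)=R(\pi_P)$ implies $Q=P$. (2) For generic $(x,y)\in X\times X$ the points $x,y$ are smooth points of $X$ and the intersection $t_xX\cap t_yX$ consists of exactly one point $P(x,y)$,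 and $(x,y)\mapsto P(x,y)$ is a dominant rational map $X\times X\dashrightarrow\mathbb P^{2n}$. That is, there are a Zariski open dense subset $V\subseteq X\times X$ consisting of pairs of smooth points and a regular map $V\to\mathbb P^{2n}$, $(x,y)\mapsto P(x,y)$, with Zariski dense image, such that $t_xX\cap t_yX=\{P(x,y)\}$ for all $(x,y)\in V$. -/

import Mathlib

open scoped LinearAlgebra.Projectivization Topology

noncomputable section

namespace GenericProjection

/-- The vector space `ℂ^{N+1}`. -/
abbrev Vec (N : ℕ) : Type := Fin (N + 1) → ℂ

/-- Complex projective `N`-space, the set of lines through the origin in `ℂ^{N+1}`. -/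
abbrev PSpace (N : ℕ) : Type := ℙ ℂ (Vec N)

/-- The Zariski topology on `ℙ^N`: the basic open sets are the sets `{F ≠ 0}` with `F` a
homogeneous polynomial.  (For homogeneous `F` the condition `F(x) ≠ 0` does not depend on the
representative of `x`.) -/
@[reducible] def zariski (N : ℕ) : TopologicalSpace (PSpace N) :=
  TopologicalSpace.generateFrom
    {D | ∃ (d : ℕ) (F : MvPolynomial (Fin (N + 1)) ℂ), F.IsHomogeneous d ∧
      D = {x | MvPolynomial.eval x.rep F ≠ 0}}

/-- Polynomials in two groups of `N+1` variables that are homogeneous of degree `d` in the first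
group and homogeneous of degree `e` in the second group. -/
def IsBihomogeneous {N : ℕ} (G : MvPolynomial (Fin (N + 1) ⊕ Fin (N + 1)) ℂ) (d e : ℕ) : Prop :=
  MvPolynomial.IsWeightedHomogeneous
    (Sum.elim (fun _ => ((1, 0) : ℕ × ℕ)) (fun _ => ((0, 1) : ℕ × ℕ))) G (d, e)

/-- The value of a polynomial in two groups of variables at representatives of a pair of points. -/
def evalPair {N : ℕ} (p : PSpace N × PSpace N)
    (G : MvPolynomial (Fin (N + 1) ⊕ Fin (N + 1)) ℂ) : ℂ :=
  MvPolynomial.eval (Sum.elim p.1.rep p.2.rep) G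

/-- The Zariski topology on the product variety `ℙ^N × ℙ^N` (not the product of the Zariski
topologies): the basic open sets are the sets `{G ≠ 0}` with `G` a bihomogeneous polynomial. -/
@[reducible] def zariskiProd (N : ℕ) : TopologicalSpace (PSpace N × PSpace N) :=
  TopologicalSpace.generateFrom
    {D | ∃ (d e : ℕ) (G : MvPolynomial (Fin (N + 1) ⊕ Fin (N + 1)) ℂ), IsBihomogeneous G d e ∧
      D = {p | evalPair p G ≠ 0}}

/-- A (closed, irreducible, in particular nonempty) subvariety of `ℙ^N`. -/
structure IsSubvariety {N : ℕ} (X : Set (PSpace N)) : Prop where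
  isClosed : IsClosed[zariski N] X
  isIrreducible : @IsIrreducible _ (zariski N) X

/-- The affine cone over a subset of `ℙ^N`. -/
def affineCone {N : ℕ} (X : Set (PSpace N)) : Set (Vec N) :=
  {v | ∃ x ∈ X, v ∈ x.submodule}

/-- The ideal of all polynomials that vanish on the affine cone over `X`, i.e. the homogeneous
ideal of `X`. -/
def homogIdeal {N : ℕ} (X : Set (PSpace N)) : Ideal (MvPolynomial (Fin (N + 1)) ℂ) :=
  MvPolynomial.vanishingIdeal ℂ (affineCone X)

/-- The homogeneous coordinate ring of `X`. -/
abbrev HomogCoordRing {N : ℕ} (X : Set (PSpace N)) : Type :=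
  MvPolynomial (Fin (N + 1)) ℂ ⧸ homogIdeal X

/-- `X` has dimension `n`: its homogeneous coordinate ring, which is the coordinate ring of the
affine cone over `X`, has Krull dimension `n + 1`. -/
def HasDimension {N : ℕ} (X : Set (PSpace N)) (n : ℕ) : Prop :=
  ringKrullDim (HomogCoordRing X) = (n : WithBot ℕ∞) + 1

/-- The Zariski tangent space to the affine cone over `X` at a representative `v` of `x`: all `w`
with `∑ i, (∂F/∂xᵢ)(v) wᵢ = 0` for all `F` in the homogeneous ideal of `X`. -/
def coneTangentSpace {N : ℕ} (X : Set (PSpace N)) (x : PSpace N) : Submodule ℂ (Vec N) where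
  carrier := {w | ∀ F ∈ homogIdeal X,
    ∑ i, MvPolynomial.eval x.rep (MvPolynomial.pderiv i F) * w i = 0}
  zero_mem' := by intro F _; simp
  add_mem' := by
    intro a b ha hb F hF
    simp [mul_add, Finset.sum_add_distrib, ha F hF, hb F hF]
  smul_mem' := by
    intro c a ha F hF
    have h := ha F hF
    simp only [Pi.smul_apply, smul_eq_mul, mul_left_comm _ c, ← Finset.mul_sum, h, mul_zero]

/-- The projective tangent space `t_x X ⊆ ℙ^N`. -/
def projTangentSpace {N : ℕ} (X : Set (PSpace N)) (x : PSpace N) : Set (PSpace N) :=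
  {Q | Q.submodule ≤ coneTangentSpace X x}

/-- The smooth points of `X`: those where the dimension of the Zariski tangent space equals the
dimension of the variety (both sides are taken on the affine cone). -/
def smoothLocus {N : ℕ} (X : Set (PSpace N)) : Set (PSpace N) :=
  {x | x ∈ X ∧
    ((Module.finrank ℂ (coneTangentSpace X x) : ℕ) : WithBot ℕ∞) = ringKrullDim (HomogCoordRing X)}

/-- The tangent variety `Tan X`: the Zariski closure of the union of the projective tangent spaces
at the smooth points of `X`. -/
def tangentVariety {N : ℕ} (X : Set (PSpace N)) : Set (PSpace N) :=
  closure[zariski N] (⋃ x ∈ smoothLocus X, projTangentSpace X x)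

/-- The (intrinsic) Zariski tangent space `T_x X` as a subspace of `T_x ℙ^N`, where a
representative `v` of `x` identifies `T_x ℙ^N` with `ℂ^{N+1} / ⟨v⟩`. -/
def tangentSpace {N : ℕ} (X : Set (PSpace N)) (x : PSpace N) :
    Submodule ℂ (Vec N ⧸ x.submodule) :=
  (coneTangentSpace X x).map x.submodule.mkQ

/-- The differential at `x` of the linear projection
`π_P : ℙ(ℂ^{N+1}) ∖ {P} → ℙ(ℂ^{N+1} / P) ≅ ℙ^{N-1}`, `[v] ↦ [v mod P]`.
A representative `v` of `x ≠ P` identifies the tangent space of the source at `x` with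
`ℂ^{N+1} / ⟨v⟩`, and that of the target at `π_P(x)` with `(ℂ^{N+1} / P) / ⟨v mod P⟩`; the
differential is the map induced by `ℂ^{N+1} → ℂ^{N+1} / P`. -/
def projectionDifferential {N : ℕ} (P x : PSpace N) :
    (Vec N ⧸ x.submodule) →ₗ[ℂ]
      ((Vec N ⧸ P.submodule) ⧸ x.submodule.map P.submodule.mkQ) :=
  Submodule.mapQ x.submodule (x.submodule.map P.submodule.mkQ) P.submodule.mkQ
    (Submodule.le_comap_map _ _)

/-- The ramification locus `R(π_P)` of the linear projection `π_P : X ∖ {P} → ℙ^{N-1}` with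
center `P`: the points of `X ∖ {P}` at which the differential `T_x X → T_{π_P(x)} ℙ^{N-1}` is not
injective.  (If `P ∉ X`, then `X ∖ {P} = X`.) -/
def ramificationLocus {N : ℕ} (X : Set (PSpace N)) (P : PSpace N) : Set (PSpace N) :=
  {x | x ∈ X ∧ x ≠ P ∧
    ¬ Function.Injective ((projectionDifferential P x).domRestrict (tangentSpace X x))}

/-- `φ` is a regular map on `U ⊆ ℙ^N × ℙ^N` with values in `ℙ^N`: near every point of `U` it is
given by `N+1` bihomogeneous polynomials of the same bidegree without common zero. -/
def IsRegularOn {N : ℕ} (U : Set (PSpace N × PSpace N)) (φ : PSpace N × PSpace N → PSpace N) :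
    Prop :=
  ∀ a ∈ U, ∃ (d e : ℕ) (G : Fin (N + 1) → MvPolynomial (Fin (N + 1) ⊕ Fin (N + 1)) ℂ),
    (∀ k, IsBihomogeneous (G k) d e) ∧ (fun k => evalPair a (G k)) ≠ 0 ∧
    ∀ b ∈ U, ∀ h : (fun k => evalPair b (G k)) ≠ 0,
      φ b = Projectivization.mk ℂ (fun k => evalPair b (G k)) h

/-- `φ`, restricted to `U`, represents a rational map `Y ⇢ ℙ^N` on `Y ⊆ ℙ^N × ℙ^N`: `U` is
Zariski open and dense in `Y`, and `φ` is regular on `U`. -/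
structure IsRationalMapOn {N : ℕ} (Y U : Set (PSpace N × PSpace N))
    (φ : PSpace N × PSpace N → PSpace N) : Prop where
  isOpen : ∃ O : Set (PSpace N × PSpace N), IsOpen[zariskiProd N] O ∧ U = O ∩ Y
  dense : Y ⊆ closure[zariskiProd N] U
  regular : IsRegularOn U φ

/-- `φ`, restricted to `U`, is dominant: the image is Zariski dense in `ℙ^N`. -/
def IsDominantOn {N : ℕ} (U : Set (PSpace N × PSpace N))
    (φ : PSpace N × PSpace N → PSpace N) : Prop :=
  closure[zariski N] (φ '' U) = Set.univ

/-- A property holds for a generic point of `ℙ^N`: it holds on a nonempty (hence dense) Zariski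
open subset. -/
def ForGenericPoint {N : ℕ} (p : PSpace N → Prop) : Prop :=
  ∃ U : Set (PSpace N), IsOpen[zariski N] U ∧ U.Nonempty ∧ ∀ P ∈ U, p P

end GenericProjection

end

/-!
Write `T_v` for the tangent space of the affine cone `X̂` at `v`; it has dimension `n + 1` at the
smooth points.  The idea is that a general point `P` lies on the tangent spaces of two general
points `x, y` of `X`, and that `P ∈ t_x X` is the same as `x ∈ R(π_P)` for `x ≠ P`
(`mem_ramificationLocus_iff`).  So if `R(π_Q) = R(π_P)`, then `Q ∈ t_x X ∩ t_y X = {P}`.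

*Coordinates.*  Near a smooth point `n` equations of `X` with independent differentials split the
coordinates into `n + 1` left ones and `n` right ones, and `T_v` is the graph
`{(m(v) s, M(v) s) | s ∈ ℂ^{n+1}}` with polynomial `m` and `M` (`TangentChart`).  Vectors in
`T_x ∩ T_y` correspond to the kernel of the `n × (n+1)` matrix `m(x) M(y) - m(y) M(x)`.  If it has
full rank, the kernel is spanned by its vector of maximal minors `cross x y`, and the intersection
is the single point `P(x, y)`, which is given by bihomogeneous polynomials (`TangentChart.meet`).

*The second fundamental form.*  Differentiating the graph gives a symmetric bilinear form
`Q_v(u, s)` on `ℂ^{n+1}` with values in `ℂ^n`, and `Q_v(u, v) = 0`.  Since `Tan X = ℙ^{2n}`, the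
map `(v, s) ↦ (m(v) s, M(v) s)` is dominant.  In characteristic zero derivations extend along the
corresponding field extension, so its differential is onto, which says that `Q_v(·, s)` is onto for
general `(v, s)` (`TangentChart.exists_crossProd_QMatrix_ne_zero`).  Its kernel is then the line
spanned by `v`; here vectors in `T_v` are identified with their left coordinates.

*General pairs.*  Let `y` move on a formal curve in `X̂` that starts at `x` with the direction given
by such an `s`.  To first order the matrix `m(x) M(y) - m(y) M(x)` is a multiple of `Q_x(·, s)`, so
after rescaling `cross x y` tends to a multiple of `x`, and a second order computation shows that
its derivative is a nonzero multiple of `s` modulo `x`.  As `Q_x(·, x) = 0`, the form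
`Q_x(·, cross x y)` has full rank along the curve (`TangentChart.crossProd_ne_zero_along_arc`).
Since `X × X` is irreducible, a general pair `(x, y)` has `cross x y ≠ 0`, and both
`Q_x(·, cross x y)` and `Q_y(·, cross x y)` of full rank.

*Dominance.*  Suppose that a form `F` vanishes at all `P(x, y)`.  When `y` moves, `P(x, y)` moves
in `T_x`, and because `Q_y(·, cross x y)` is onto it moves in all directions of `T_x`.  So `dF`
vanishes on `T_x` at `P(x, y)`, by symmetry also on `T_y`, and hence on `T_x + T_y = ℂ^{2n+1}`.
All partial derivatives of `F` vanish at all `P(x, y)`, and induction on the degree gives `F = 0`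
(`TangentChart.eq_zero_of_eval_lift_cross_eq_zero`).  This is dominance of `(x, y) ↦ P(x, y)`, and
with Chevalley's theorem it shows that a nonempty open set consists of points `P(x, y)` with
`(x, y)` general.  For `n ≥ 1` such a `P` differs from `x` and `y`, again since `Q_x(·, x) = 0`.
-/

noncomputable section

open MvPolynomial Matrix Topology
open scoped LinearAlgebra.Projectivization

/-! ### Chevalley's theorem for closed points -/

/-- Chevalley's theorem for closed points: if the restriction of a polynomial map `Φ` to the open
subset `{g ≠ 0}` of a closed set `Z` is dominant, then its image contains a nonempty basic open
set. -/
theorem exists_ne_zero_forall_mem_image {σ τ : Type*} [Finite σ] [Finite τ] {k : Type*} [Field k]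
    [IsAlgClosed k] (Z : Set (σ → k)) (hZ : zeroLocus k (vanishingIdeal k Z) ⊆ Z)
    (Φ : τ → MvPolynomial σ k) (g : MvPolynomial σ k)
    (hdom : ∀ F : MvPolynomial τ k,
      (∀ x ∈ Z, eval x g * eval (fun i => eval x (Φ i)) F = 0) → F = 0) :
    ∃ h : MvPolynomial τ k, h ≠ 0 ∧ ∀ p : τ → k, eval p h ≠ 0 →
      ∃ x ∈ Z, eval x g ≠ 0 ∧ (fun i => eval x (Φ i)) = p := by
  classical
  -- The image of the constructible set `Z ∩ {g ≠ 0}` in the prime spectrum is constructible, and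
  -- contains the generic point by dominance.  So it contains a nonempty basic open set `{h ≠ 0}`.
  let f : MvPolynomial τ k →ₐ[k] MvPolynomial σ k := aeval Φ
  have heval : ∀ x F, eval x (f F) = eval (fun i => eval x (Φ i)) F := fun x F => by
    induction F using MvPolynomial.induction_on <;> simp_all [f]
  have hfp : f.toRingHom.FinitePresentation := by
    refine RingHom.FinitePresentation.of_finiteType.mp ?_
    refine RingHom.FiniteType.of_comp_finiteType (f := (C : k →+* MvPolynomial τ k)) ?_
    have : f.toRingHom.comp C = algebraMap k (MvPolynomial σ k) := by
      ext; simp [f]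
    rw [this, RingHom.finiteType_algebraMap]
    infer_instance
  let J := vanishingIdeal k Z
  let S : Set (PrimeSpectrum (MvPolynomial σ k)) :=
    PrimeSpectrum.zeroLocus J ∩ PrimeSpectrum.basicOpen g
  have hS : IsConstructible S := by
    refine IsConstructible.inter ?_ PrimeSpectrum.isConstructible_basicOpen
    rw [← compl_compl (PrimeSpectrum.zeroLocus _)]
    exact (IsRetrocompact.isConstructible (PrimeSpectrum.isClosed_zeroLocus _).isOpen_compl
      (PrimeSpectrum.isRetrocompact_zeroLocus_compl_of_fg (IsNoetherian.noetherian J))).compl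
  obtain ⟨T, hT⟩ := PrimeSpectrum.exists_constructibleSetData_iff.mpr
    (PrimeSpectrum.isConstructible_comap_image hfp hS)
  have hbot : (⊥ : PrimeSpectrum (MvPolynomial τ k)) ∈ PrimeSpectrum.comap f.toRingHom '' S := by
    obtain ⟨p, hp, hJp, hdisj⟩ := Ideal.exists_le_prime_disjoint J
      (Submonoid.powers g ⊔ (nonZeroDivisors (MvPolynomial τ k)).map f.toRingHom) (by
        rw [Set.disjoint_left]
        rintro _ hJ hmem
        obtain ⟨_, ⟨j, rfl⟩, _, ⟨F, hF, rfl⟩, rfl⟩ := Submonoid.mem_sup.mp hmem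
        refine nonZeroDivisors.ne_zero hF (hdom F fun x hx => ?_)
        have h := hJ x hx
        simp only [map_mul, map_pow, aeval_eq_eval] at h
        have h' : eval x g ^ j * eval (fun i => eval x (Φ i)) F = 0 := by
          rw [← heval]; exact h
        rcases mul_eq_zero.mp h' with h | h
        · rw [eq_zero_of_pow_eq_zero h, zero_mul]
        · rw [h, mul_zero])
    rw [Set.disjoint_left] at hdisj
    refine ⟨⟨p, hp⟩, ⟨hJp, fun hg => hdisj hg
      (Submonoid.mem_sup_left (Submonoid.mem_powers g))⟩, ?_⟩
    ext F
    refine ⟨fun hF => ?_, fun hF => ?_⟩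
    · by_contra hF0
      exact hdisj hF (Submonoid.mem_sup_right
        ⟨F, mem_nonZeroDivisors_of_ne_zero (fun h => hF0 h), rfl⟩)
    · have : F = 0 := hF
      rw [this]; exact Ideal.zero_mem _
  rw [← hT] at hbot
  simp only [PrimeSpectrum.ConstructibleSetData.toSet, Set.mem_iUnion] at hbot
  obtain ⟨D, hDT, hD, hDf⟩ := hbot
  have hDg : ∀ i, D.g i = 0 := fun i => hD ⟨i, rfl⟩
  have hf0 : D.f ≠ 0 := fun h => hDf (by
    rw [h]; simp)
  refine ⟨D.f, hf0, fun p hp => ?_⟩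
  have hpT : pointToPoint (k := k) p ∈ T.toSet := by
    simp only [PrimeSpectrum.ConstructibleSetData.toSet, Set.mem_iUnion]
    refine ⟨D, hDT, ?_, fun h => hp ?_⟩
    · rintro _ ⟨i, rfl⟩
      rw [hDg i]; exact Ideal.zero_mem _
    · have := (mem_vanishingIdeal_singleton_iff p D.f).mp (h rfl)
      simpa using this
  rw [hT] at hpT
  obtain ⟨q, ⟨hqJ, hqg⟩, hqp⟩ := hpT
  have hqg' : g ∉ vanishingIdeal k (zeroLocus k q.asIdeal) := by
    rw [MvPolynomial.IsPrime.vanishingIdeal_zeroLocus]; exact hqg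
  rw [mem_vanishingIdeal_iff] at hqg'
  push Not at hqg'
  obtain ⟨x, hx, hxg⟩ := hqg'
  refine ⟨x, hZ (zeroLocus_anti_mono hqJ hx), by simpa using hxg, funext fun i => ?_⟩
  have h1 : X i - C (p i) ∈ (PrimeSpectrum.comap f.toRingHom q).asIdeal := by
    rw [hqp]
    exact (mem_vanishingIdeal_singleton_iff p _).mpr (by simp)
  have h2 : aeval x (f (X i - C (p i))) = 0 := hx _ h1
  simp only [f, map_sub, aeval_X, algHom_C, aeval_eq_eval] at h2
  simpa [sub_eq_zero] using h2

/-! ### The cross product of the rows of a matrix -/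

namespace Matrix
variable {R : Type*} [CommRing R] {n : ℕ}

/-- The generalised cross product of the rows of an `n × (n+1)` matrix: the vector of its signed
maximal minors. -/
def crossProd (N : Matrix (Fin n) (Fin (n + 1)) R) : Fin (n + 1) → R :=
  fun k => (-1) ^ (k : ℕ) * (N.submatrix id k.succAbove).det

/-- The matrix `N` with the additional first row `r`. -/
def rowCons {m : ℕ} (r : Fin m → R) (N : Matrix (Fin n) (Fin m) R) :
    Matrix (Fin (n + 1)) (Fin m) R :=
  fun i => Fin.cases r N i

theorem det_rowCons (r : Fin (n + 1) → R) (N : Matrix (Fin n) (Fin (n + 1)) R) :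
    (rowCons r N).det = r ⬝ᵥ N.crossProd := by
  rw [det_succ_row_zero, dotProduct]
  refine Finset.sum_congr rfl fun j _ => ?_
  have : (rowCons r N).submatrix Fin.succ j.succAbove = N.submatrix id j.succAbove := rfl
  rw [this, crossProd]
  change (-1) ^ (j : ℕ) * r j * _ = _
  ring

theorem mulVec_crossProd (N : Matrix (Fin n) (Fin (n + 1)) R) : N *ᵥ N.crossProd = 0 := by
  ext j
  rw [mulVec, ← det_rowCons]
  exact det_zero_of_row_eq (i := 0) (j := j.succ) (Fin.succ_ne_zero j).symm rfl

theorem crossProd_map {S : Type*} [CommRing S] (f : R →+* S) (N : Matrix (Fin n) (Fin (n + 1)) R) :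
    (N.map f).crossProd = f ∘ N.crossProd := by
  ext k
  simp only [crossProd, Function.comp, map_mul, map_pow, map_neg, map_one, RingHom.map_det]
  rfl

theorem crossProd_smul (c : R) (N : Matrix (Fin n) (Fin (n + 1)) R) :
    (c • N).crossProd = c ^ n • N.crossProd := by
  ext k
  simp only [crossProd, submatrix_smul, Pi.smul_apply, det_smul, Fintype.card_fin, smul_eq_mul]
  ring

variable {K : Type*} [Field K]

theorem rowCons_mulVec_eq_iff (r w : Fin (n + 1) → K) (N : Matrix (Fin n) (Fin (n + 1)) K)
    (a : K) (q : Fin n → K) :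
    rowCons r N *ᵥ w = Fin.cons a q ↔ r ⬝ᵥ w = a ∧ N *ᵥ w = q := by
  have h : rowCons r N *ᵥ w = (Fin.cons (r ⬝ᵥ w) (N *ᵥ w) : Fin (n + 1) → K) := by
    ext i
    refine Fin.cases rfl (fun i => rfl) i
  rw [h, Fin.cons_inj]

theorem isUnit_rowCons_of_crossProd_ne_zero {N : Matrix (Fin n) (Fin (n + 1)) K} {k : Fin (n + 1)}
    (h : N.crossProd k ≠ 0) : IsUnit (rowCons (Pi.single k 1) N) := by
  rw [isUnit_iff_isUnit_det, det_rowCons, single_one_dotProduct]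
  exact isUnit_iff_ne_zero.mpr h

/-- A matrix with a nonzero maximal minor has full rank.  The proof completes it to an invertible
square matrix by a unit vector. -/
theorem surjective_of_crossProd_ne_zero {N : Matrix (Fin n) (Fin (n + 1)) K}
    (h : N.crossProd ≠ 0) : Function.Surjective N.mulVec := by
  obtain ⟨k, hk⟩ := Function.ne_iff.mp h
  intro q
  obtain ⟨w, hw⟩ := (mulVec_surjective_iff_isUnit.mpr (isUnit_rowCons_of_crossProd_ne_zero hk))
    (Fin.cons 0 q)
  exact ⟨w, ((rowCons_mulVec_eq_iff _ _ _ _ _).mp hw).2⟩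

/-- If it is nonzero, the cross product spans the kernel. -/
theorem exists_eq_smul_crossProd {N : Matrix (Fin n) (Fin (n + 1)) K}
    (h : N.crossProd ≠ 0) {w : Fin (n + 1) → K} (hw : N *ᵥ w = 0) :
    ∃ c : K, w = c • N.crossProd := by
  obtain ⟨k, hk⟩ := Function.ne_iff.mp h
  have hinj := mulVec_injective_iff_isUnit.mpr (isUnit_rowCons_of_crossProd_ne_zero hk)
  have hk' : N.crossProd k ≠ 0 := hk
  refine ⟨w k / N.crossProd k, hinj ?_⟩
  change rowCons _ N *ᵥ w = rowCons _ N *ᵥ _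
  rw [(rowCons_mulVec_eq_iff _ _ N (w k) 0).mpr ⟨single_one_dotProduct _ _, hw⟩, eq_comm,
    rowCons_mulVec_eq_iff, mulVec_smul, mulVec_crossProd, smul_zero, single_one_dotProduct]
  exact ⟨div_mul_cancel₀ _ hk', rfl⟩

theorem crossProd_ne_zero_of_surjective {N : Matrix (Fin n) (Fin (n + 1)) K}
    (h : Function.Surjective N.mulVec) : N.crossProd ≠ 0 := by
  intro h0
  have hker : Module.finrank K (LinearMap.ker N.mulVecLin) = 1 := by
    have := N.mulVecLin.finrank_range_add_finrank_ker
    rw [LinearMap.range_eq_top.mpr h, finrank_top, Module.finrank_fin_fun,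
      Module.finrank_fin_fun] at this
    omega
  obtain ⟨v, hv, hspan⟩ := finrank_eq_one_iff'.mp hker
  obtain ⟨k, hk⟩ := Function.ne_iff.mp (fun h => hv (Subtype.ext h) : (v : Fin (n + 1) → K) ≠ 0)
  have hdet : (rowCons (Pi.single k 1) N).det = 0 := by
    rw [det_rowCons, h0, dotProduct_zero]
  obtain ⟨w, hw0, hw⟩ := exists_mulVec_eq_zero_iff.mpr hdet
  obtain ⟨h1, h2⟩ := (rowCons_mulVec_eq_iff _ w N 0 0).mp (by
    rw [hw]; ext i; exact Fin.cases rfl (fun _ => rfl) i)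
  rw [single_one_dotProduct] at h1
  obtain ⟨c, hc⟩ := hspan ⟨w, h2⟩
  have hc' : c • (v : Fin (n + 1) → K) = w := congrArg Subtype.val hc
  have : c * (v : Fin (n + 1) → K) k = 0 := by rw [← h1, ← hc']; rfl
  rcases mul_eq_zero.mp this with h | h
  · exact hw0 (by rw [← hc', h, zero_smul])
  · exact hk h
end Matrix

/-! ### Derivations of function fields and Krull dimension -/

open scoped IntermediateField.algebraAdjoinAdjoin in
/-- In characteristic zero the values of a derivation on algebraically independent elements can be
prescribed: the extension `k(f) ⊆ K` is formally smooth, so that a derivation with values in `K`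
extends from the polynomial ring `k[f]` to `K`. -/
theorem exists_derivation_of_algebraicIndependent {k K ι : Type*} [Field k] [CharZero k] [Field K]
    [Algebra k K] [Algebra.EssFiniteType k K] {f : ι → K} (hf : AlgebraicIndependent k f)
    (c : ι → K) : ∃ D : Derivation k K K, ∀ i, D (f i) = c i := by
  let P := MvPolynomial ι k
  let S := Algebra.adjoin k (Set.range f)
  let L := IntermediateField.adjoin k (Set.range f)
  let _ : Algebra P S := hf.aevalEquiv.toRingEquiv.toRingHom.toAlgebra
  let _ : Algebra P L := ((algebraMap S L).comp (algebraMap P S)).toAlgebra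
  let _ : Algebra P K := (aeval f).toRingHom.toAlgebra
  have hPK : ∀ x : P, algebraMap P K x = aeval f x := fun x => rfl
  have : IsScalarTower k P K := IsScalarTower.of_algebraMap_eq (fun x => by
    rw [hPK, MvPolynomial.algebraMap_eq, aeval_C])
  have : IsScalarTower P S L := IsScalarTower.of_algebraMap_eq (fun x => rfl)
  have : IsScalarTower P L K := IsScalarTower.of_algebraMap_eq (fun x => rfl)
  have : Algebra.FormallySmooth P L := by
    have : Algebra.FormallySmooth P S :=
      .of_equiv (AlgEquiv.ofBijective (Algebra.ofId P S) hf.aevalEquiv.bijective)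
    have : Algebra.FormallySmooth S L := .of_isLocalization (nonZeroDivisors _)
    exact .comp _ S _
  have : Algebra.EssFiniteType L K := .of_comp k L K
  have : Algebra.FormallySmooth L K := .of_perfectField
  have : Algebra.FormallySmooth P K := .comp P L K
  have hinj : Function.Injective (KaehlerDifferential.mapBaseChange k P K) := by
    rw [injective_iff_map_eq_zero]
    intro x hx
    obtain ⟨y, rfl⟩ := (Algebra.H1Cotangent.exact_δ_mapBaseChange k P K x).mp hx
    rw [Subsingleton.elim y 0, map_zero]
  obtain ⟨r, hr⟩ := LinearMap.exists_leftInverse_of_injective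
    (KaehlerDifferential.mapBaseChange k P K) (LinearMap.ker_eq_bot.mpr hinj)
  let d : Derivation k P K := mkDerivation k c
  let l := LinearMap.liftBaseChange K d.liftKaehlerDifferential
  refine ⟨(l ∘ₗ r).compDer (KaehlerDifferential.D k K), fun i => ?_⟩
  have h1 : f i = algebraMap P K (X i) := by rw [hPK, aeval_X]
  have h2 : KaehlerDifferential.D k K (f i) =
      KaehlerDifferential.mapBaseChange k P K (1 ⊗ₜ KaehlerDifferential.D k P (X i)) := by
    rw [h1, KaehlerDifferential.mapBaseChange_tmul, KaehlerDifferential.map_D, one_smul]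
  have h3 := LinearMap.congr_fun hr (1 ⊗ₜ KaehlerDifferential.D k P (X i))
  simp only [LinearMap.coe_comp, Function.comp_apply, LinearMap.id_apply] at h3
  change l (r (KaehlerDifferential.D k K (f i))) = c i
  rw [h2, h3, LinearMap.liftBaseChange_tmul, one_smul, Derivation.liftKaehlerDifferential_comp_D]
  exact mkDerivation_X k c i

/-- A finitely generated algebra of Krull dimension `d` over a field contains `d` algebraically
independent elements. -/
theorem exists_algebraicIndependent_of_ringKrullDim {k A : Type*} [Field k] [CommRing A]
    [Nontrivial A] [Algebra k A] [Algebra.FiniteType k A] {d : ℕ} (hd : ringKrullDim A = d) :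
    ∃ t : Fin d → A, AlgebraicIndependent k t := by
  obtain ⟨s, g, hg, hfin⟩ := exists_integral_inj_algHom_of_fg k A
  let _ := g.toRingHom.toAlgebra
  have : Algebra.IsIntegral (MvPolynomial (Fin s) k) A := ⟨hfin⟩
  have h1 : ringKrullDim A ≤ ringKrullDim (MvPolynomial (Fin s) k) :=
    Order.krullDim_le_of_strictMono (PrimeSpectrum.comap (algebraMap _ A)) fun p q hpq => by
      obtain ⟨hle, x, hxq, hxp⟩ :=
        SetLike.lt_iff_le_and_exists.mp (show p.asIdeal < q.asIdeal from hpq)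
      exact Ideal.comap_lt_comap_of_integral_mem_sdiff hle ⟨hxq, hxp⟩
        (Algebra.IsIntegral.isIntegral (R := MvPolynomial (Fin s) k) x)
  rw [MvPolynomial.ringKrullDim_of_isNoetherianRing, hd, ringKrullDim_eq_zero_of_field,
    zero_add, Nat.card_fin] at h1
  have h2 : d ≤ s := by exact_mod_cast h1
  refine ⟨fun i => g (X (Fin.castLE h2 i)), ?_⟩
  have : AlgebraicIndependent k (fun i => g (X i)) := by
    have : aeval (fun i => g (X i)) = g := by ext; simp
    rw [AlgebraicIndependent, this]
    exact hg
  exact this.comp _ (Fin.castLE_injective h2)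

namespace GenericProjection

/-! ### Homogeneous polynomials and affine cones -/

section

variable {N : ℕ}

/-- A character `χ` of the monoid of weights acts on the variables, and a weighted homogeneous
polynomial is an eigenvector. -/
theorem eval_weight_mul_of_isWeightedHomogeneous {σ M R : Type*} [CommRing R] [AddCommMonoid M]
    {w : σ → M} {n : M} {F : MvPolynomial σ R} (hF : IsWeightedHomogeneous w F n)
    (χ : Multiplicative M →* R) (v : σ → R) :
    eval (fun i => χ (.ofAdd (w i)) * v i) F = χ (.ofAdd n) * eval v F := by
  rw [eval_eq, eval_eq, Finset.mul_sum]
  refine Finset.sum_congr rfl fun d hd => ?_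
  have h := hF (mem_support_iff.mp hd)
  have h2 : χ (.ofAdd n) = ∏ i ∈ d.support, χ (.ofAdd (w i)) ^ d i := by
    rw [← h, Finsupp.weight_apply, Finsupp.sum, ofAdd_sum, map_prod]
    exact Finset.prod_congr rfl fun i _ => by rw [ofAdd_nsmul, map_pow]
  rw [h2, mul_left_comm, ← Finset.prod_mul_distrib]
  simp only [mul_pow]

theorem eval_smul_of_isHomogeneous {σ R : Type*} [CommRing R] {n : ℕ}
    {F : MvPolynomial σ R} (hF : F.IsHomogeneous n) (c : R) (v : σ → R) :
    eval (c • v) F = c ^ n * eval v F := by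
  have := eval_weight_mul_of_isWeightedHomogeneous hF (powersHom R c) v
  simpa [Pi.smul_def] using this

theorem eval_smul_of_isBihomogeneous {G : MvPolynomial (Fin (N + 1) ⊕ Fin (N + 1)) ℂ} {d e : ℕ}
    (hG : IsBihomogeneous G d e) (a b : ℂ) (u v : Vec N) :
    eval (Sum.elim (a • u) (b • v)) G = a ^ d * b ^ e * eval (Sum.elim u v) G := by
  let χ : Multiplicative (ℕ × ℕ) →* ℂ :=
    { toFun := fun p => a ^ p.toAdd.1 * b ^ p.toAdd.2
      map_one' := by simp
      map_mul' := fun p q => by simp [pow_add]; ring }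
  have h : Sum.elim (a • u) (b • v) = fun i => χ (.ofAdd (Sum.elim (fun _ => ((1, 0) : ℕ × ℕ))
      (fun _ => ((0, 1) : ℕ × ℕ)) i)) * Sum.elim u v i := by
    ext i
    cases i <;> simp [χ]
  rw [h]
  exact eval_weight_mul_of_isWeightedHomogeneous hG χ (Sum.elim u v)

theorem eval_smul_eq_sum {σ R : Type*} [CommRing R] (F : MvPolynomial σ R) (c : R) (v : σ → R) :
    eval (c • v) F =
      ∑ d ∈ Finset.range (F.totalDegree + 1), c ^ d * eval v (homogeneousComponent d F) := by
  conv_lhs => rw [← sum_homogeneousComponent F, map_sum]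
  exact Finset.sum_congr rfl fun d _ =>
    eval_smul_of_isHomogeneous (homogeneousComponent_isHomogeneous d F) c v

/-- A polynomial that vanishes on a punctured line through the origin does so in each degree. -/
theorem eval_homogeneousComponent_eq_zero {σ k : Type*} [Field k] [Infinite k]
    {F : MvPolynomial σ k} {v : σ → k} (h : ∀ c : k, c ≠ 0 → eval (c • v) F = 0) (d : ℕ) :
    eval v (homogeneousComponent d F) = 0 := by
  let p : Polynomial k := ∑ d ∈ Finset.range (F.totalDegree + 1),
    Polynomial.monomial d (eval v (homogeneousComponent d F))
  have hp : p = 0 := by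
    refine Polynomial.eq_zero_of_infinite_isRoot p
      (((Set.finite_singleton (0 : k)).infinite_compl).mono fun c hc => ?_)
    have := h c hc
    rw [eval_smul_eq_sum] at this
    simpa [p, Polynomial.eval_finsetSum, mul_comm] using this
  have := congrArg (fun q => Polynomial.coeff q d) hp
  simp only [p, Polynomial.finsetSum_coeff, Polynomial.coeff_monomial, Finset.sum_ite_eq',
    Polynomial.coeff_zero, Finset.mem_range] at this
  by_cases hd : d < F.totalDegree + 1
  · simpa [hd] using this
  · rw [homogeneousComponent_eq_zero _ _ (by omega), map_zero]

theorem isTopologicalBasis_zariski (N : ℕ) :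
    @TopologicalSpace.IsTopologicalBasis _ (zariski N)
      {D | ∃ (d : ℕ) (F : MvPolynomial (Fin (N + 1)) ℂ), F.IsHomogeneous d ∧
        D = {x | eval x.rep F ≠ 0}} := by
  let _ := zariski N
  refine ⟨?_, ?_, rfl⟩
  · rintro _ ⟨d, F, hF, rfl⟩ _ ⟨e, G, hG, rfl⟩ x ⟨hxF, hxG⟩
    refine ⟨_, ⟨d + e, F * G, hF.mul hG, rfl⟩, ?_, fun y hy => ?_⟩
    · simpa using ⟨hxF, hxG⟩
    · simpa [not_or] using hy
  · exact Set.sUnion_eq_univ_iff.mpr fun x =>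
      ⟨_, ⟨0, 1, isHomogeneous_one _ _, rfl⟩, by simp⟩

theorem isTopologicalBasis_zariskiProd (N : ℕ) :
    @TopologicalSpace.IsTopologicalBasis _ (zariskiProd N)
      {D | ∃ (d e : ℕ) (G : MvPolynomial (Fin (N + 1) ⊕ Fin (N + 1)) ℂ), IsBihomogeneous G d e ∧
        D = {p | evalPair p G ≠ 0}} := by
  let _ := zariskiProd N
  refine ⟨?_, ?_, rfl⟩
  · rintro _ ⟨d, e, F, hF, rfl⟩ _ ⟨d', e', G, hG, rfl⟩ x ⟨hxF, hxG⟩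
    refine ⟨_, ⟨d + d', e + e', F * G, hF.mul hG, rfl⟩, ?_, fun y hy => ?_⟩
    · simpa [evalPair] using ⟨hxF, hxG⟩
    · simpa [evalPair, not_or] using hy
  · exact Set.sUnion_eq_univ_iff.mpr fun x =>
      ⟨_, ⟨0, 0, 1, isWeightedHomogeneous_one _ _, rfl⟩, by simp [evalPair]⟩

variable {X : Set (PSpace N)}

theorem exists_smul_rep {v : Vec N} (hv : v ≠ 0) :
    ∃ c : ℂ, c ≠ 0 ∧ v = c • (Projectivization.mk ℂ v hv).rep := by
  obtain ⟨a, ha⟩ := Projectivization.exists_smul_eq_mk_rep ℂ v hv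
  refine ⟨(a⁻¹ : ℂˣ), Units.ne_zero _, ?_⟩
  rw [← ha]
  exact (inv_smul_smul a v).symm

theorem mem_affineCone_iff {v : Vec N} : v ∈ affineCone X ↔ ∃ x ∈ X, ∃ c : ℂ, v = c • x.rep := by
  simp only [affineCone, Set.mem_ofPred_eq, Projectivization.submodule_eq,
    Submodule.mem_span_singleton, eq_comm]

theorem rep_mem_affineCone {x : PSpace N} (hx : x ∈ X) : x.rep ∈ affineCone X :=
  mem_affineCone_iff.mpr ⟨x, hx, 1, (one_smul _ _).symm⟩

theorem smul_mem_affineCone {v : Vec N} (hv : v ∈ affineCone X) (c : ℂ) : c • v ∈ affineCone X := by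
  obtain ⟨x, hx, a, rfl⟩ := mem_affineCone_iff.mp hv
  exact mem_affineCone_iff.mpr ⟨x, hx, c * a, smul_smul _ _ _⟩

theorem mk_mem_of_mem_affineCone {v : Vec N} (hv : v ∈ affineCone X) (h0 : v ≠ 0) :
    Projectivization.mk ℂ v h0 ∈ X := by
  obtain ⟨x, hx, a, rfl⟩ := mem_affineCone_iff.mp hv
  have : Projectivization.mk ℂ (a • x.rep) h0 = Projectivization.mk ℂ x.rep x.rep_nonzero :=
    (Projectivization.mk_eq_mk_iff' _ _ _ _ _).mpr ⟨a, rfl⟩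
  rwa [this, x.mk_rep]

theorem mem_homogIdeal_iff {F : MvPolynomial (Fin (N + 1)) ℂ} :
    F ∈ homogIdeal X ↔ ∀ v ∈ affineCone X, eval v F = 0 := by
  simp [homogIdeal, mem_vanishingIdeal_iff]

theorem homogeneousComponent_mem_homogIdeal {F : MvPolynomial (Fin (N + 1)) ℂ}
    (hF : F ∈ homogIdeal X) (d : ℕ) : homogeneousComponent d F ∈ homogIdeal X :=
  mem_homogIdeal_iff.mpr fun _ hv => eval_homogeneousComponent_eq_zero
    (fun c _ => mem_homogIdeal_iff.mp hF _ (smul_mem_affineCone hv c)) d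

theorem exists_eval_homogeneousComponent_ne_zero {F : MvPolynomial (Fin (N + 1)) ℂ}
    {v : Vec N} (hF : eval v F ≠ 0) : ∃ d, eval v (homogeneousComponent d F) ≠ 0 := by
  by_contra! h
  refine hF ?_
  rw [← one_smul ℂ v, eval_smul_eq_sum]
  simp [h]

/-- For homogeneous `F`, nonvanishing on the cone is witnessed at a point of `X`. -/
theorem exists_rep_ne_zero {F : MvPolynomial (Fin (N + 1)) ℂ} {d : ℕ} (hF : F.IsHomogeneous d)
    {v : Vec N} (hv : v ∈ affineCone X) (h : eval v F ≠ 0) : ∃ x ∈ X, eval x.rep F ≠ 0 := by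
  obtain ⟨x, hx, a, rfl⟩ := mem_affineCone_iff.mp hv
  rw [eval_smul_of_isHomogeneous hF] at h
  exact ⟨x, hx, right_ne_zero_of_mul h⟩

/-- The affine cone over `X` is irreducible.  The polynomials need not be homogeneous: a point `z`
of `X` at which homogeneous components of `F` and of `G` do not vanish exists since `X` is
irreducible, and on the line of `z` both polynomials vanish only at finitely many points. -/
theorem IsSubvariety.exists_eval_ne_zero (hX : IsSubvariety X)
    {F G : MvPolynomial (Fin (N + 1)) ℂ} {u v : Vec N} (hu : u ∈ affineCone X)
    (hv : v ∈ affineCone X) (hF : eval u F ≠ 0) (hG : eval v G ≠ 0) :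
    ∃ w ∈ affineCone X, eval w F ≠ 0 ∧ eval w G ≠ 0 := by
  let _ := zariski N
  obtain ⟨d, hd⟩ := exists_eval_homogeneousComponent_ne_zero hF
  obtain ⟨e, he⟩ := exists_eval_homogeneousComponent_ne_zero hG
  obtain ⟨x, hxX, hx⟩ := exists_rep_ne_zero (homogeneousComponent_isHomogeneous _ _) hu hd
  obtain ⟨y, hyX, hy⟩ := exists_rep_ne_zero (homogeneousComponent_isHomogeneous _ _) hv he
  obtain ⟨z, hzX, hzF, hzG⟩ := hX.isIrreducible.2 _ _
    ((isTopologicalBasis_zariski N).isOpen ⟨d, _, homogeneousComponent_isHomogeneous _ _, rfl⟩)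
    ((isTopologicalBasis_zariski N).isOpen ⟨e, _, homogeneousComponent_isHomogeneous _ _, rfl⟩)
    ⟨x, hxX, hx⟩ ⟨y, hyX, hy⟩
  by_contra! h
  let p : MvPolynomial (Fin (N + 1)) ℂ → Polynomial ℂ := fun F =>
    ∑ d ∈ Finset.range (F.totalDegree + 1),
      Polynomial.monomial d (eval z.rep (homogeneousComponent d F))
  have hp : ∀ F c, (p F).eval c = eval (c • z.rep) F := fun F c => by
    rw [eval_smul_eq_sum]
    simp [p, Polynomial.eval_finsetSum, mul_comm]
  have hp0 : ∀ F d, eval z.rep (homogeneousComponent d F) ≠ 0 → p F ≠ 0 := fun F d hd h0 =>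
    hd (eval_homogeneousComponent_eq_zero (fun c _ => by rw [← hp, h0]; simp) d)
  have : p F * p G = 0 := Polynomial.funext fun c => by
    rw [Polynomial.eval_mul, hp, hp, Polynomial.eval_zero]
    by_cases hc : eval (c • z.rep) F = 0
    · rw [hc, zero_mul]
    · rw [h _ (smul_mem_affineCone (rep_mem_affineCone hzX) c) hc, mul_zero]
  rcases mul_eq_zero.mp this with h | h
  · exact hp0 _ _ hzF h
  · exact hp0 _ _ hzG h

theorem IsSubvariety.isPrime_homogIdeal (hX : IsSubvariety X) : (homogIdeal X).IsPrime := by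
  refine Ideal.isPrime_iff.mpr ⟨fun h => ?_, fun {F G} h => ?_⟩
  · obtain ⟨x, hx⟩ := hX.isIrreducible.1
    have := mem_homogIdeal_iff.mp ((Ideal.eq_top_iff_one _).mp h) _ (rep_mem_affineCone hx)
    simp at this
  · by_contra! hFG
    simp only [mem_homogIdeal_iff, not_forall] at hFG
    obtain ⟨⟨u, hu, hF⟩, v, hv, hG⟩ := hFG
    obtain ⟨w, hw, h1, h2⟩ := hX.exists_eval_ne_zero hu hv hF hG
    have := mem_homogIdeal_iff.mp h w hw
    rw [map_mul] at this
    exact mul_ne_zero h1 h2 this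

theorem IsSubvariety.mem_of_eval_eq_zero (hX : IsSubvariety X) {x : PSpace N}
    (h : ∀ F ∈ homogIdeal X, eval x.rep F = 0) : x ∈ X := by
  let _ := zariski N
  by_contra hx
  obtain ⟨_, ⟨d, F, hF, rfl⟩, hxF, hFX⟩ := (isTopologicalBasis_zariski N).isOpen_iff.mp
    hX.isClosed.isOpen_compl x hx
  refine hxF (h F (mem_homogIdeal_iff.mpr fun v hv => ?_))
  by_contra hv0
  obtain ⟨y, hy, hyF⟩ := exists_rep_ne_zero hF hv hv0
  exact hFX hyF hy

/-- The affine cone over `X` is Zariski closed. -/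
theorem IsSubvariety.zeroLocus_subset (hX : IsSubvariety X) :
    zeroLocus ℂ (homogIdeal X) ⊆ affineCone X := by
  intro v hv
  obtain rfl | h0 := eq_or_ne v 0
  · obtain ⟨x, hx⟩ := hX.isIrreducible.1
    exact mem_affineCone_iff.mpr ⟨x, hx, 0, (zero_smul _ _).symm⟩
  obtain ⟨c, hc, h⟩ := exists_smul_rep h0
  refine mem_affineCone_iff.mpr ⟨_, hX.mem_of_eval_eq_zero fun F hF => ?_, c, h⟩
  rw [← sum_homogeneousComponent F, map_sum]
  refine Finset.sum_eq_zero fun d _ => ?_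
  have h1 := hv _ (homogeneousComponent_mem_homogIdeal hF d)
  rw [aeval_eq_eval, h] at h1
  change eval _ _ = 0 at h1
  rw [eval_smul_of_isHomogeneous (homogeneousComponent_isHomogeneous d F)] at h1
  exact (mul_eq_zero.mp h1).resolve_left (pow_ne_zero _ hc)

end

/-! ### Tangent spaces -/

section

variable {N : ℕ}

/-- The differential of the polynomial `F` at a point `v` with coordinates in a `ℂ`-algebra `R`, as
a linear form on `σ → R`.  Besides `R = ℂ`, function fields and polynomial rings occur, where `v` is
a family of points. -/
def differential {σ R : Type*} [Fintype σ] [CommRing R] [Algebra ℂ R] (F : MvPolynomial σ ℂ)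
    (v : σ → R) : (σ → R) →ₗ[R] R :=
  ∑ i, aeval v (pderiv i F) • LinearMap.proj i

theorem differential_apply {σ R : Type*} [Fintype σ] [CommRing R] [Algebra ℂ R]
    (F : MvPolynomial σ ℂ) (v w : σ → R) :
    differential F v w = ∑ i, aeval v (pderiv i F) * w i := by
  simp [differential]

theorem derivation_sum_apply {R ι : Type*} [CommRing R] [Algebra ℂ R] (s : Finset ι)
    (D : ι → Derivation ℂ R R) (x : R) : (∑ j ∈ s, D j) x = ∑ j ∈ s, D j x := by
  classical
  induction s using Finset.induction_on with
  | empty => simp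
  | insert j s hj h => rw [Finset.sum_insert hj, Finset.sum_insert hj, Derivation.add_apply, h]

theorem derivation_aeval {σ R : Type*} [Fintype σ] [CommRing R] [Algebra ℂ R]
    (D : Derivation ℂ R R) (F : MvPolynomial σ ℂ) (v : σ → R) :
    D (aeval v F) = differential F v (fun i => D (v i)) := by
  classical
  rw [differential_apply]
  induction F using MvPolynomial.induction_on with
  | C a => simp
  | add p q hp hq => simp only [map_add, hp, hq, add_mul, Finset.sum_add_distrib]
  | mul_X p i hp =>
    simp only [map_mul, aeval_X, Derivation.leibniz, hp, smul_eq_mul, map_add, pderiv_X, add_mul,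
      Finset.sum_add_distrib, Finset.mul_sum]
    congr 1
    · rw [Finset.sum_eq_single i]
      · simp
      · intro j _ hj; simp [Pi.single_eq_of_ne' hj]
      · simp
    · exact Finset.sum_congr rfl fun j _ => by ring

theorem map_differential {σ R S : Type*} [Fintype σ] [CommRing R] [Algebra ℂ R] [CommRing S]
    [Algebra ℂ S] (f : R →ₐ[ℂ] S) (F : MvPolynomial σ ℂ) (v w : σ → R) :
    f (differential F v w) = differential F (fun i => f (v i)) (fun i => f (w i)) := by
  simp only [differential_apply, map_sum, map_mul]
  refine Finset.sum_congr rfl fun i _ => ?_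
  congr 1
  exact (comp_aeval_apply _ f _)

theorem differential_self {σ : Type*} [Fintype σ] {F : MvPolynomial σ ℂ} {d : ℕ}
    (hF : F.IsHomogeneous d) (v : σ → ℂ) : differential F v v = d * eval v F := by
  have := congrArg (eval v) hF.sum_X_mul_pderiv
  simp only [map_sum, map_mul, eval_X, nsmul_eq_mul, map_natCast] at this
  rw [differential_apply, ← this]
  exact Finset.sum_congr rfl fun i _ => mul_comm _ _

theorem differential_smul_point {σ : Type*} [Fintype σ] {F : MvPolynomial σ ℂ} {d : ℕ}
    (hF : F.IsHomogeneous d) (c : ℂ) (v w : σ → ℂ) :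
    differential F (c • v) w = c ^ (d - 1) * differential F v w := by
  rw [differential_apply, differential_apply, Finset.mul_sum]
  refine Finset.sum_congr rfl fun i _ => ?_
  rw [← mul_assoc]
  exact congrArg (· * w i) (eval_smul_of_isHomogeneous hF.pderiv c v)

/-- The Zariski tangent space of the affine cone over `X` at `v`.  It is defined for all vectors
`v`, so that it can be used without choosing representatives of points of `ℙ^N`. -/
def tangentAt (X : Set (PSpace N)) (v : Vec N) : Submodule ℂ (Vec N) :=
  ⨅ F : homogIdeal X, LinearMap.ker (differential F.1 v)

variable {X : Set (PSpace N)}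

theorem mem_tangentAt {v w : Vec N} :
    w ∈ tangentAt X v ↔ ∀ F ∈ homogIdeal X, differential F v w = 0 := by
  simp [tangentAt]

theorem coneTangentSpace_eq (x : PSpace N) : coneTangentSpace X x = tangentAt X x.rep := by
  ext w
  rw [mem_tangentAt]
  exact forall₂_congr fun F _ => by rw [differential_apply]; rfl

theorem mem_tangentAt_iff_homogeneous {v w : Vec N} :
    w ∈ tangentAt X v ↔
      ∀ F ∈ homogIdeal X, ∀ d, F.IsHomogeneous d → differential F v w = 0 := by
  rw [mem_tangentAt]
  refine ⟨fun h F hF _ _ => h F hF, fun h F hF => ?_⟩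
  have : differential F v w = ∑ d ∈ Finset.range (F.totalDegree + 1),
      differential (homogeneousComponent d F) v w := by
    conv_lhs => rw [← sum_homogeneousComponent F]
    simp only [differential_apply, map_sum, Finset.sum_mul]
    rw [Finset.sum_comm]
  rw [this]
  exact Finset.sum_eq_zero fun d _ => h _ (homogeneousComponent_mem_homogIdeal hF d) d
    (homogeneousComponent_isHomogeneous d F)

theorem tangentAt_smul {c : ℂ} (hc : c ≠ 0) (v : Vec N) : tangentAt X (c • v) = tangentAt X v := by
  ext w
  simp only [mem_tangentAt_iff_homogeneous]
  refine forall₄_congr fun F _ d hF => ?_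
  rw [differential_smul_point hF, mul_eq_zero, or_iff_right (pow_ne_zero _ hc)]

theorem self_mem_tangentAt {v : Vec N} (hv : v ∈ affineCone X) : v ∈ tangentAt X v := by
  rw [mem_tangentAt_iff_homogeneous]
  intro F hF d hd
  rw [differential_self hd, mem_homogIdeal_iff.mp hF v hv, mul_zero]

/-- Every set of linear forms contains finitely many forms with the same common kernel and with a
dual family of vectors. -/
theorem exists_dual_family_of_set {K V : Type*} [Field K] [AddCommGroup V] [Module K V]
    [FiniteDimensional K V] (s : Set (Module.Dual K V)) :
    ∃ (r : ℕ) (f : Fin r → Module.Dual K V), (∀ i, f i ∈ s) ∧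
      (∀ w, (∀ i, f i w = 0) → ∀ φ ∈ s, φ w = 0) ∧
      Function.Surjective (LinearMap.pi f) := by
  obtain ⟨f, hfs, hspan, hlin⟩ := Submodule.exists_fun_fin_finrank_span_eq K s
  refine ⟨_, f, hfs, fun w hw φ hφ => ?_, ?_⟩
  · have h1 : φ ∈ Submodule.span K (Set.range f) := hspan.symm ▸ Submodule.subset_span hφ
    have h2 : Submodule.span K (Set.range f) ≤ LinearMap.ker (LinearMap.applyₗ w) := by
      rw [Submodule.span_le]
      rintro _ ⟨i, rfl⟩
      exact hw i
    exact h2 h1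
  · have h1 : LinearIndependent K (fun i => (f i : V → K)) :=
      hlin.map' (LinearMap.ltoFun K V K K) (LinearMap.ker_eq_bot.mpr DFunLike.coe_injective)
    have h2 := span_flip_eq_top_iff_linearIndependent.mpr h1
    rw [← LinearMap.range_eq_top, eq_top_iff, ← h2, Submodule.span_le]
    rintro _ ⟨w, rfl⟩
    exact ⟨w, rfl⟩

/-- The tangent space at `v` is cut out by the independent differentials of finitely many
homogeneous equations of `X`. -/
theorem exists_equations (X : Set (PSpace N)) (v : Vec N) :
    ∃ (r : ℕ) (F : Fin r → MvPolynomial (Fin (N + 1)) ℂ) (d : Fin r → ℕ),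
      (∀ i, F i ∈ homogIdeal X) ∧ (∀ i, (F i).IsHomogeneous (d i)) ∧
      LinearMap.ker (LinearMap.pi fun i => differential (F i) v) = tangentAt X v ∧
      Function.Surjective (LinearMap.pi fun i => differential (F i) v) ∧
      r + Module.finrank ℂ (tangentAt X v) = N + 1 := by
  obtain ⟨r, f, hf, hker, hsurj⟩ := exists_dual_family_of_set
    {φ : Module.Dual ℂ (Vec N) | ∃ F ∈ homogIdeal X, ∃ d, F.IsHomogeneous d ∧ differential F v = φ}
  choose F hFI d hd hFf using hf
  have hfF : f = fun i => differential (F i) v := funext fun i => (hFf i).symm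
  subst hfF
  have hk : LinearMap.ker (LinearMap.pi fun i => differential (F i) v) = tangentAt X v := by
    ext w
    rw [mem_tangentAt_iff_homogeneous, LinearMap.mem_ker]
    refine ⟨fun h G hG e he => hker w (fun i => congrFun h i) _ ⟨G, hG, e, he, rfl⟩, fun h => ?_⟩
    ext i
    exact h _ (hFI i) _ (hd i)
  refine ⟨r, F, d, hFI, hd, hk, hsurj, ?_⟩
  have := (LinearMap.pi fun i => differential (F i) v).finrank_range_add_finrank_ker
  rwa [hk, LinearMap.range_eq_top.mpr hsurj, finrank_top, Module.finrank_fin_fun,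
    Module.finrank_fin_fun] at this

/-- The tangent spaces of a variety of dimension `n` have dimension at least `n + 1` on the cone.
If `r` equations have independent differentials at `v`, then so they have at the generic point,
where the `n + 1` derivations of the function field that are dual to algebraically independent
elements are independent solutions of the linear system. -/
theorem IsSubvariety.le_finrank_tangentAt (hX : IsSubvariety X) {n : ℕ} (hn : HasDimension X n)
    {v : Vec N} (hv : v ∈ affineCone X) : n + 1 ≤ Module.finrank ℂ (tangentAt X v) := by
  classical
  obtain ⟨r, F, d, hFI, -, -, hsurj, hr⟩ := exists_equations X v
  choose c hc using fun j : Fin r => hsurj (Pi.single j 1)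
  have := hX.isPrime_homogIdeal
  let A := HomogCoordRing X
  let K := FractionRing A
  have : Algebra.EssFiniteType A K := .of_isLocalization _ (nonZeroDivisors A)
  have : Algebra.EssFiniteType ℂ K := .comp ℂ A K
  obtain ⟨t, ht⟩ := exists_algebraicIndependent_of_ringKrullDim (k := ℂ) (A := A) (d := n + 1)
    (by rw [hn]; simp)
  have htK : AlgebraicIndependent ℂ (fun i => algebraMap A K (t i)) :=
    ht.map' (f := IsScalarTower.toAlgHom ℂ A K) (IsFractionRing.injective A K)
  let ρ : MvPolynomial (Fin (N + 1)) ℂ →ₐ[ℂ] K :=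
    (IsScalarTower.toAlgHom ℂ A K).comp (Ideal.Quotient.mkₐ ℂ (homogIdeal X))
  have hρ : ∀ G, ρ G = 0 ↔ G ∈ homogIdeal X := fun G => by
    change algebraMap A K (Ideal.Quotient.mk _ G) = 0 ↔ _
    rw [FaithfulSMul.algebraMap_eq_zero_iff, Ideal.Quotient.eq_zero_iff_mem]
  let ξ : Fin (N + 1) → K := fun i => ρ (MvPolynomial.X i)
  have hξ : ∀ G, aeval ξ G = ρ G := fun G => by
    rw [show aeval ξ = ρ from by ext i; simp [ξ]]
  choose D hD using fun j : Fin (n + 1) =>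
    exists_derivation_of_algebraicIndependent htK (Pi.single j 1)
  -- the Jacobian stays surjective at the generic point
  let J : Matrix (Fin r) (Fin r) (MvPolynomial (Fin (N + 1)) ℂ) :=
    .of fun i j => differential (F i) MvPolynomial.X (fun l => C (c j l))
  have hJ : ∀ {S : Type} [CommRing S] [Algebra ℂ S]
      (f : MvPolynomial (Fin (N + 1)) ℂ →ₐ[ℂ] S) i j,
      f (J i j) = differential (F i) (fun l => f (MvPolynomial.X l))
        (fun l => algebraMap ℂ S (c j l)) := by
    intro S _ _ f i j
    change f (differential _ _ _) = _
    rw [map_differential]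
    simp only [algHom_C]
  have hJv : eval v J.det ≠ 0 := by
    have : J.map (eval v) = 1 := by
      ext i j
      have h1 := hJ (aeval v) i j
      simp only [aeval_X, aeval_eq_eval] at h1
      rw [Matrix.map_apply, Matrix.one_apply]
      refine h1.trans ((congrFun (hc j) i).trans ?_)
      rw [Pi.single_apply]
    rw [RingHom.map_det, RingHom.mapMatrix_apply, this, Matrix.det_one]
    exact one_ne_zero
  have hJK : (J.map ρ).det ≠ 0 := by
    have : (J.map ρ).det = ρ J.det := (AlgHom.map_det ρ J).symm
    rw [this, Ne, hρ, mem_homogIdeal_iff]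
    exact fun h => hJv (h v hv)
  have hsurjK : Function.Surjective (LinearMap.pi fun i => differential (F i) ξ) := by
    intro q
    obtain ⟨a, ha⟩ := Matrix.mulVec_surjective_iff_isUnit.mpr
      ((Matrix.isUnit_iff_isUnit_det _).mpr (isUnit_iff_ne_zero.mpr hJK)) q
    refine ⟨∑ j, a j • fun l => algebraMap ℂ K (c j l), ?_⟩
    rw [← ha]
    ext i
    simp only [LinearMap.pi_apply, map_sum, map_smul, smul_eq_mul, Matrix.mulVec, dotProduct,
      Matrix.map_apply, hJ]
    exact Finset.sum_congr rfl fun j _ => mul_comm _ _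
  have hker : ∀ j, (fun l => D j (ξ l)) ∈
      LinearMap.ker (LinearMap.pi fun i => differential (F i) ξ) := by
    intro j
    ext i
    change differential (F i) ξ (fun l => D j (ξ l)) = 0
    rw [← derivation_aeval, hξ, (hρ _).mpr (hFI i), map_zero]
  have hlin : LinearIndependent K (fun j => (⟨_, hker j⟩ :
      LinearMap.ker (LinearMap.pi fun i => differential (F i) ξ))) := by
    rw [Fintype.linearIndependent_iff]
    intro a ha k
    have h1 : ∀ l, (∑ j, a j • D j) (ξ l) = 0 := fun l => by
      have := congrFun (congrArg Subtype.val ha) l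
      simpa [derivation_sum_apply, Finset.sum_apply] using this
    obtain ⟨G, hG⟩ := Ideal.Quotient.mk_surjective (t k)
    have h2 : (∑ j, a j • D j) (algebraMap A K (t k)) = 0 := by
      have : algebraMap A K (t k) = aeval ξ G := by rw [hξ, ← hG]; rfl
      rw [this, derivation_aeval]
      simp only [h1]
      exact map_zero _
    simpa [derivation_sum_apply, hD, Pi.single_apply] using h2
  have h1 := hlin.fintype_card_le_finrank
  have h2 := (LinearMap.pi fun i => differential (F i) ξ).finrank_range_add_finrank_ker
  rw [LinearMap.range_eq_top.mpr hsurjK, finrank_top, Module.finrank_fin_fun,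
    Module.finrank_fin_fun] at h2
  rw [Fintype.card_fin] at h1
  omega

end

/-! ### Local parametrisation of the tangent spaces -/

section

theorem isWeightedHomogeneous_det {σ M R κ : Type*} [CommRing R] [AddCommMonoid M] [Fintype κ]
    [DecidableEq κ] {w : σ → M} {A : Matrix κ κ (MvPolynomial σ R)} {r : κ → M}
    (h : ∀ i j, IsWeightedHomogeneous w (A i j) (r i)) :
    IsWeightedHomogeneous w A.det (∑ i, r i) := by
  rw [Matrix.det_apply]
  refine IsWeightedHomogeneous.sum _ _ _ fun τ _ => ?_
  have h1 : IsWeightedHomogeneous w (∏ i, A (τ i) i) (∑ i, r i) := by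
    rw [← Equiv.sum_comp τ r]
    exact IsWeightedHomogeneous.prod _ _ _ fun i _ => h _ _
  rcases Int.units_eq_one_or (Equiv.Perm.sign τ) with hs | hs
  · rw [hs, one_smul]; exact h1
  · rw [hs, Units.neg_smul, one_smul]; exact h1.neg

variable {n : ℕ} {X : Set (PSpace (2 * n))}

/-- Data for a local parametrisation of the tangent spaces of the cone over a variety of dimension
`n` in `ℙ^{2n}`: `n` homogeneous equations, and a splitting of the coordinates into `n + 1` left and
`n` right ones.  It is useful at the points where the minor `TangentChart.m` of the Jacobian matrix
that belongs to the right coordinates does not vanish. -/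
structure TangentChart (X : Set (PSpace (2 * n))) where
  /-- The splitting of the coordinates into left and right ones. -/
  e : Fin (n + 1) ⊕ Fin n ≃ Fin (2 * n + 1)
  /-- The equations. -/
  F : Fin n → MvPolynomial (Fin (2 * n + 1)) ℂ
  /-- The degrees of the equations. -/
  d : Fin n → ℕ
  mem : ∀ k, F k ∈ homogIdeal X
  isHomogeneous : ∀ k, (F k).IsHomogeneous (d k)

theorem exists_columns {K : Type*} [Field K] {N : ℕ} {J : Matrix (Fin n) (Fin N) K}
    (hN : N = 2 * n + 1) (hJ : Function.Surjective J.mulVec) :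
    ∃ e : Fin (n + 1) ⊕ Fin n ≃ Fin N, (J.submatrix id (e ∘ Sum.inr)).det ≠ 0 := by
  classical
  have hspan : Submodule.span K (Set.range J.col) = ⊤ := by
    rw [← Matrix.range_mulVecLin]
    exact LinearMap.range_eq_top.mpr hJ
  obtain ⟨f, hf, -, hlin⟩ := Submodule.exists_fun_fin_finrank_span_eq K (Set.range J.col)
  have hr : Module.finrank K (Submodule.span K (Set.range J.col)) = n := by
    rw [hspan, finrank_top, Module.finrank_fin_fun]
  let g : Fin n → Fin n → K := fun i => f (Fin.cast hr.symm i)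
  have hg : LinearIndependent K g := hlin.comp _ (Fin.cast_injective _)
  choose c hc using fun i => hf (Fin.cast hr.symm i)
  have hcg : ∀ i, J.col (c i) = g i := hc
  have hcinj : Function.Injective c := fun i j hij => hg.injective (by rw [← hcg, ← hcg, hij])
  have hcard : Fintype.card (Fin (n + 1)) = Fintype.card ((Set.range c)ᶜ : Set (Fin N)) := by
    rw [Fintype.card_compl_set, Set.card_range_of_injective hcinj, Fintype.card_fin,
      Fintype.card_fin, Fintype.card_fin]
    omega
  let e : Fin (n + 1) ⊕ Fin n ≃ Fin N := (Equiv.sumComm _ _).trans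
    ((Equiv.sumCongr (Equiv.ofInjective c hcinj) (Fintype.equivOfCardEq hcard)).trans
      (Equiv.Set.sumCompl _))
  refine ⟨e, ?_⟩
  have : (J.submatrix id (e ∘ Sum.inr)).col = g := by
    ext i j
    exact congrFun (hcg i) j
  rw [← isUnit_iff_ne_zero, ← Matrix.isUnit_iff_isUnit_det,
    ← Matrix.linearIndependent_cols_iff_isUnit, this]
  exact hg

namespace TangentChart
variable (c : TangentChart X)

/-- The Jacobian matrix with respect to the left coordinates. -/
def Jl : Matrix (Fin n) (Fin (n + 1)) (MvPolynomial (Fin (2 * n + 1)) ℂ) :=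
  .of fun k i => pderiv (c.e (.inl i)) (c.F k)

/-- The Jacobian matrix with respect to the right coordinates. -/
def Jr : Matrix (Fin n) (Fin n) (MvPolynomial (Fin (2 * n + 1)) ℂ) :=
  .of fun k j => pderiv (c.e (.inr j)) (c.F k)

/-- The minor of the Jacobian matrix that belongs to the right coordinates. -/
def m : MvPolynomial (Fin (2 * n + 1)) ℂ := c.Jr.det

/-- The solution `-adj(Jr) Jl` of the linear system: where `m ≠ 0`, the right coordinates `r` of a
tangent vector are determined by the left coordinates `l` through `m r = M l`.  The adjugate instead
of the inverse keeps the entries polynomial. -/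
def M : Matrix (Fin n) (Fin (n + 1)) (MvPolynomial (Fin (2 * n + 1)) ℂ) :=
  -(c.Jr.adjugate * c.Jl)

/-- The common degree of `m` and of the entries of `M`. -/
def deg : ℕ := ∑ k, (c.d k - 1)

theorem m_isHomogeneous : c.m.IsHomogeneous c.deg :=
  isWeightedHomogeneous_det fun k _ => (c.isHomogeneous k).pderiv

theorem M_isHomogeneous (j : Fin n) (i : Fin (n + 1)) : (c.M j i).IsHomogeneous c.deg := by
  refine IsWeightedHomogeneous.neg (IsWeightedHomogeneous.sum _ _ _ fun k _ => ?_)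
  have h1 : IsWeightedHomogeneous 1 (c.Jr.adjugate j k)
      (∑ k', Function.update (fun k' => c.d k' - 1) k 0 k') := by
    rw [Matrix.adjugate_apply]
    refine isWeightedHomogeneous_det fun k' i' => ?_
    rw [Matrix.updateRow_apply, Function.update_apply]
    split_ifs
    · rw [Pi.single_apply]
      split_ifs
      · exact isWeightedHomogeneous_one _ _
      · exact isWeightedHomogeneous_zero _ _ _
    · exact (c.isHomogeneous k').pderiv
  have h2 := h1.mul (show IsWeightedHomogeneous 1 (c.Jl k i) (c.d k - 1) from
    (c.isHomogeneous k).pderiv)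
  convert h2 using 1
  rw [Finset.sum_update_of_mem (Finset.mem_univ _), deg, zero_add, ← Finset.erase_eq,
    Finset.sum_erase_add _ _ (Finset.mem_univ k)]

variable {R : Type*} [CommRing R] [Algebra ℂ R]

/-- Cramer's rule for solutions of the linear system with entries in any `ℂ`-algebra. -/
theorem m_smul_eq_of_differential_eq_zero {ξ w : Fin (2 * n + 1) → R}
    (h : ∀ k, differential (c.F k) ξ w = 0) (j : Fin n) :
    aeval ξ c.m * w (c.e (.inr j)) = ∑ i, aeval ξ (c.M j i) * w (c.e (.inl i)) := by
  let f : MvPolynomial (Fin (2 * n + 1)) ℂ →ₐ[ℂ] R := aeval ξ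
  have h1 : (c.Jl.map f) *ᵥ (w ∘ c.e ∘ .inl) + (c.Jr.map f) *ᵥ (w ∘ c.e ∘ .inr) = 0 := by
    ext k
    rw [Pi.zero_apply, ← h k, differential_apply, ← c.e.sum_comp, Fintype.sum_sum_type]
    rfl
  have hM : c.M.map f = -((c.Jr.map f).adjugate * c.Jl.map f) := by
    have h2 : (c.Jr.map f).adjugate = c.Jr.adjugate.map f :=
      (RingHom.map_adjugate f.toRingHom c.Jr).symm
    rw [h2]
    ext i k
    simp only [M, Matrix.map_apply, Matrix.neg_apply, Matrix.mul_apply, map_neg, map_sum, map_mul]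
  have hm : f c.m = (c.Jr.map f).det := AlgHom.map_det f c.Jr
  have h3 := congrArg ((c.Jr.map f).adjugate.mulVec) h1
  rw [Matrix.mulVec_add, Matrix.mulVec_mulVec, Matrix.mulVec_mulVec, Matrix.adjugate_mul,
    Matrix.smul_mulVec, Matrix.one_mulVec, Matrix.mulVec_zero, add_comm, add_eq_zero_iff_eq_neg,
    ← Matrix.neg_mulVec, ← hM, ← hm] at h3
  exact congrFun h3 j

theorem mem_tangentAt_iff (hX : IsSubvariety X) (hn : HasDimension X n) {v : Vec (2 * n)}
    (hv : v ∈ affineCone X) (hm : eval v c.m ≠ 0) (w : Vec (2 * n)) :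
    w ∈ tangentAt X v ↔
      ∀ j, eval v c.m * w (c.e (.inr j)) = ∑ i, eval v (c.M j i) * w (c.e (.inl i)) := by
  let f : Vec (2 * n) →ₗ[ℂ] (Fin n → ℂ) := LinearMap.pi fun j =>
    eval v c.m • LinearMap.proj (c.e (.inr j)) -
      ∑ i, eval v (c.M j i) • LinearMap.proj (c.e (.inl i))
  have hf : ∀ w, w ∈ LinearMap.ker f ↔ ∀ j,
      eval v c.m * w (c.e (.inr j)) = ∑ i, eval v (c.M j i) * w (c.e (.inl i)) := fun w => by
    rw [LinearMap.mem_ker, funext_iff]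
    simp [f, sub_eq_zero]
  have hle : tangentAt X v ≤ LinearMap.ker f := fun w hw => (hf w).mpr fun j =>
    c.m_smul_eq_of_differential_eq_zero (fun k => mem_tangentAt.mp hw _ (c.mem k)) j
  have hdim : Module.finrank ℂ (LinearMap.ker f) ≤ n + 1 := by
    let g : LinearMap.ker f →ₗ[ℂ] (Fin (n + 1) → ℂ) :=
      (LinearMap.pi fun i => LinearMap.proj (c.e (.inl i))).comp (LinearMap.ker f).subtype
    have hg : Function.Injective g := by
      rw [injective_iff_map_eq_zero]
      rintro ⟨w, hw⟩ h0
      have hl : ∀ i, w (c.e (.inl i)) = 0 := fun i => congrFun h0 i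
      have hr : ∀ j, w (c.e (.inr j)) = 0 := fun j => by
        have := (hf w).mp hw j
        simpa [hl, hm] using this
      refine Subtype.ext (funext fun l => ?_)
      obtain ⟨i, rfl⟩ := c.e.surjective l
      cases i
      · exact hl _
      · exact hr _
    simpa using LinearMap.finrank_le_finrank_of_injective hg
  rw [Submodule.eq_of_le_of_finrank_le hle (hdim.trans (hX.le_finrank_tangentAt hn hv)), hf]

end TangentChart

theorem exists_tangentChart (hn : HasDimension X n) {x : PSpace (2 * n)} (hx : x ∈ smoothLocus X) :
    ∃ c : TangentChart X, eval x.rep c.m ≠ 0 := by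
  obtain ⟨r, F, d, hFI, hd, -, hsurj, hr⟩ := exists_equations X x.rep
  have h1 : Module.finrank ℂ (tangentAt X x.rep) = n + 1 := by
    have := hx.2
    rw [hn, coneTangentSpace_eq] at this
    exact_mod_cast this
  obtain rfl : r = n := by omega
  let J : Matrix (Fin r) (Fin (2 * r + 1)) ℂ := .of fun k l => eval x.rep (pderiv l (F k))
  obtain ⟨e, he⟩ := exists_columns (J := J) rfl (fun q => by
    obtain ⟨w, hw⟩ := hsurj q
    refine ⟨w, hw ▸ ?_⟩
    ext k
    rw [LinearMap.pi_apply, differential_apply]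
    rfl)
  refine ⟨⟨e, F, d, hFI, hd⟩, ?_⟩
  rw [TangentChart.m, RingHom.map_det]
  exact he

theorem exists_tangentChart_notMem (hn : HasDimension X n)
    (hTan : tangentVariety X = Set.univ) : ∃ c : TangentChart X, c.m ∉ homogIdeal X := by
  let _ := zariski (2 * n)
  obtain ⟨P⟩ : Nonempty (PSpace (2 * n)) := inferInstance
  have h1 : P ∈ tangentVariety X := hTan ▸ Set.mem_univ P
  obtain ⟨Q, -, hQ⟩ := mem_closure_iff.mp h1 Set.univ isOpen_univ (Set.mem_univ _)
  obtain ⟨x, hx, -⟩ := Set.mem_iUnion₂.mp hQ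
  obtain ⟨c, hc⟩ := exists_tangentChart hn hx
  exact ⟨c, fun h => hc (mem_homogIdeal_iff.mp h _ (rep_mem_affineCone hx.1))⟩

end

/-! ### Tangential derivations and the second fundamental form -/

section

variable {n : ℕ} {X : Set (PSpace (2 * n))}

namespace TangentChart
variable (c : TangentChart X)

/-- Tangent vector fields: the `i`-th one has left coordinates `m` times the `i`-th unit vector. -/
def E (i : Fin (n + 1)) : Fin (2 * n + 1) → MvPolynomial (Fin (2 * n + 1)) ℂ :=
  Sum.elim (Pi.single i c.m) (fun j => c.M j i) ∘ c.e.symm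

/-- The derivative along the tangent vector field `c.E i`. -/
def D (i : Fin (n + 1)) :
    Derivation ℂ (MvPolynomial (Fin (2 * n + 1)) ℂ) (MvPolynomial (Fin (2 * n + 1)) ℂ) :=
  mkDerivation ℂ (c.E i)

/-- The second fundamental form: `c.Q i j k` is the `j`-th coordinate of `Q(eᵢ, eₖ)`.  It is
`m²` times the derivative of `M / m` along `c.E i`. -/
def Q (i : Fin (n + 1)) : Matrix (Fin n) (Fin (n + 1)) (MvPolynomial (Fin (2 * n + 1)) ℂ) :=
  .of fun j k => c.m * c.D i (c.M j k) - c.M j k * c.D i c.m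

theorem D_X_inl (i k : Fin (n + 1)) :
    c.D i (MvPolynomial.X (c.e (.inl k))) = Pi.single (M := fun _ => _) i c.m k := by
  simp [D, E]

theorem D_X_inr (i : Fin (n + 1)) (j : Fin n) :
    c.D i (MvPolynomial.X (c.e (.inr j))) = c.M j i := by
  simp [D, E]

theorem aeval_D {R : Type*} [CommRing R] [Algebra ℂ R] (i : Fin (n + 1))
    (F : MvPolynomial (Fin (2 * n + 1)) ℂ) (ξ : Fin (2 * n + 1) → R) :
    aeval ξ (c.D i F) = differential F ξ (fun l => aeval ξ (c.E i l)) := by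
  have h := derivation_aeval (c.D i) F MvPolynomial.X
  rw [aeval_X_left, AlgHom.id_apply] at h
  have h2 := map_differential (aeval ξ : _ →ₐ[ℂ] R) F MvPolynomial.X
    (fun l => c.D i (MvPolynomial.X l))
  rw [h]
  simp only [D, mkDerivation_X, aeval_X] at h2 ⊢
  exact h2

theorem eval_D (i : Fin (n + 1)) (F : MvPolynomial (Fin (2 * n + 1)) ℂ) (v : Vec (2 * n)) :
    eval v (c.D i F) = differential F v (fun l => eval v (c.E i l)) :=
  c.aeval_D i F v

variable {c}

/-- The derivations `c.D i` are tangent to `X` and act on its coordinate ring. -/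
theorem D_mem_homogIdeal (hX : IsSubvariety X) (hn : HasDimension X n) (hm : c.m ∉ homogIdeal X)
    (i : Fin (n + 1)) {F : MvPolynomial (Fin (2 * n + 1)) ℂ} (hF : F ∈ homogIdeal X) :
    c.D i F ∈ homogIdeal X := by
  refine (hX.isPrime_homogIdeal.mem_or_mem (x := c.m) (mem_homogIdeal_iff.mpr fun v hv => ?_)
    ).resolve_left hm
  rw [map_mul]
  by_cases h0 : eval v c.m = 0
  · rw [h0, zero_mul]
  · rw [eval_D, mem_tangentAt.mp ((c.mem_tangentAt_iff hX hn hv h0 _).mpr fun j => ?_) F hF,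
      mul_zero]
    simp [E, Pi.single_apply, apply_ite (eval v), mul_comm]

/-- The point `v` of the cone is tangent to the cone at `v`. -/
theorem eval_euler {v : Vec (2 * n)} (hv : v ∈ affineCone X) (j : Fin n) :
    eval v c.m * v (c.e (.inr j)) = ∑ i, eval v (c.M j i) * v (c.e (.inl i)) :=
  c.m_smul_eq_of_differential_eq_zero
    (fun k => mem_tangentAt.mp (self_mem_tangentAt hv) _ (c.mem k)) j

/-- The radical of the second fundamental form at `v` contains `v`: differentiate `eval_euler`. -/
theorem eval_Q_mul_self (hX : IsSubvariety X) (hn : HasDimension X n) (hm : c.m ∉ homogIdeal X)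
    {v : Vec (2 * n)} (hv : v ∈ affineCone X) (i : Fin (n + 1)) (j : Fin n) :
    ∑ k, eval v (c.Q i j k) * v (c.e (.inl k)) = 0 := by
  have h1 : c.m * MvPolynomial.X (c.e (.inr j)) -
      ∑ k, c.M j k * MvPolynomial.X (c.e (.inl k)) ∈ homogIdeal X :=
    mem_homogIdeal_iff.mpr fun v hv => by
      simpa [sub_eq_zero] using eval_euler hv j
  have h2 := mem_homogIdeal_iff.mp (D_mem_homogIdeal hX hn hm i h1) v hv
  have h3 := eval_euler (c := c) hv j
  simp only [map_sub, map_sum, Derivation.leibniz, smul_eq_mul, D_X_inl, D_X_inr, map_add, map_mul,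
    eval_X, Finset.sum_add_distrib, Pi.single_apply, mul_ite,
    mul_zero, Finset.sum_ite_eq', Finset.mem_univ, if_true] at h2
  simp only [Q, Matrix.of_apply, map_sub, map_mul, sub_mul, Finset.sum_sub_distrib]
  have h4 : ∑ k, eval v c.m * eval v (c.D i (c.M j k)) * v (c.e (.inl k)) =
      eval v c.m * ∑ k, v (c.e (.inl k)) * eval v (c.D i (c.M j k)) := by
    rw [Finset.mul_sum]; exact Finset.sum_congr rfl fun k _ => by ring
  have h5 : ∑ k, eval v (c.M j k) * eval v (c.D i c.m) * v (c.e (.inl k)) =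
      eval v (c.D i c.m) * ∑ k, eval v (c.M j k) * v (c.e (.inl k)) := by
    rw [Finset.mul_sum]; exact Finset.sum_congr rfl fun k _ => by ring
  rw [h4, h5, ← h3]
  linear_combination (-eval v c.m) * h2

/-- The second fundamental form is symmetric, since the commutator of the derivations `c.D i` and
`c.D k` is again tangent to `X`. -/
theorem eval_Q_symm (hX : IsSubvariety X) (hn : HasDimension X n) (hm : c.m ∉ homogIdeal X)
    {v : Vec (2 * n)} (hv : v ∈ affineCone X) (i k : Fin (n + 1)) (j : Fin n) :
    eval v (c.Q i j k) = eval v (c.Q k j i) := by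
  have h1 : ∀ F, eval v (⁅c.D i, c.D k⁆ F) =
      differential F v (fun l => eval v (⁅c.D i, c.D k⁆ (MvPolynomial.X l))) := fun F => by
    have h := derivation_aeval ⁅c.D i, c.D k⁆ F MvPolynomial.X
    rw [aeval_X_left, AlgHom.id_apply] at h
    have h2 := map_differential (aeval v : _ →ₐ[ℂ] ℂ) F MvPolynomial.X
      (fun l => ⁅c.D i, c.D k⁆ (MvPolynomial.X l))
    rw [← h] at h2
    simp only [aeval_X] at h2
    exact h2
  have h2 := c.m_smul_eq_of_differential_eq_zero (ξ := v)
    (w := fun l => eval v (⁅c.D i, c.D k⁆ (MvPolynomial.X l))) (fun k' => by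
      rw [← h1, Derivation.commutator_apply, map_sub,
        mem_homogIdeal_iff.mp (D_mem_homogIdeal hX hn hm i
          (D_mem_homogIdeal hX hn hm k (c.mem k'))) v hv,
        mem_homogIdeal_iff.mp (D_mem_homogIdeal hX hn hm k
          (D_mem_homogIdeal hX hn hm i (c.mem k'))) v hv, sub_zero]) j
  have h3 : ∀ (a b k' : Fin (n + 1)), eval v (c.D a (Pi.single (M := fun _ => _) b c.m k')) =
      if k' = b then eval v (c.D a c.m) else 0 := fun a b k' => by
    rw [Pi.single_apply]; split_ifs <;> simp
  simp only [Derivation.commutator_apply, D_X_inl, D_X_inr, map_sub, h3, mul_sub, mul_ite,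
    mul_zero, Finset.sum_sub_distrib, Finset.sum_ite_eq', Finset.mem_univ, if_true,
    aeval_eq_eval] at h2
  change eval v c.m * _ - eval v c.m * _ = eval v (c.M j k) * _ - eval v (c.M j i) * _ at h2
  simp only [Q, Matrix.of_apply, map_sub, map_mul]
  linear_combination h2

end TangentChart

end

/-! ### Tangent vectors over a chart -/

section

variable {n : ℕ} {X : Set (PSpace (2 * n))}

namespace TangentChart
variable (c : TangentChart X)

/-- The tangent vector `(m(ξ) s, M(ξ) s)` at the point `ξ`. -/
def lift {R : Type*} [CommRing R] [Algebra ℂ R] (ξ : Fin (2 * n + 1) → R) (s : Fin (n + 1) → R) :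
    Fin (2 * n + 1) → R :=
  Sum.elim (fun i => aeval ξ c.m * s i) (fun j => ∑ i, aeval ξ (c.M j i) * s i) ∘ c.e.symm

section lift
variable {R : Type*} [CommRing R] [Algebra ℂ R] (ξ : Fin (2 * n + 1) → R) (s : Fin (n + 1) → R)

@[simp] theorem lift_inl (i : Fin (n + 1)) : c.lift ξ s (c.e (.inl i)) = aeval ξ c.m * s i := by
  simp [lift]

@[simp] theorem lift_inr (j : Fin n) :
    c.lift ξ s (c.e (.inr j)) = ∑ i, aeval ξ (c.M j i) * s i := by
  simp [lift]

theorem funext_of_inl_inr {R : Type*} {w w' : Fin (2 * n + 1) → R}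
    (hl : ∀ i, w (c.e (.inl i)) = w' (c.e (.inl i)))
    (hr : ∀ j, w (c.e (.inr j)) = w' (c.e (.inr j))) : w = w' := by
  ext l
  obtain ⟨i | j, rfl⟩ := c.e.surjective l
  exacts [hl i, hr j]

theorem map_lift {S : Type*} [CommRing S] [Algebra ℂ S] (f : R →ₐ[ℂ] S) :
    f ∘ c.lift ξ s = c.lift (f ∘ ξ) (f ∘ s) := by
  refine c.funext_of_inl_inr (fun i => ?_) (fun j => ?_)
  · simp [comp_aeval_apply, Function.comp_def]
  · simp [comp_aeval_apply, Function.comp_def]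

theorem lift_smul (a : R) : c.lift ξ (a • s) = a • c.lift ξ s := by
  refine c.funext_of_inl_inr (fun i => ?_) (fun j => ?_)
  · simp [mul_left_comm]
  · simp [mul_left_comm, Finset.mul_sum]

end lift

variable {c}

theorem lift_mem_tangentAt (hX : IsSubvariety X) (hn : HasDimension X n) {v : Vec (2 * n)}
    (hv : v ∈ affineCone X) (hm : eval v c.m ≠ 0) (s : Fin (n + 1) → ℂ) :
    c.lift v s ∈ tangentAt X v := by
  rw [c.mem_tangentAt_iff hX hn hv hm]
  intro j
  simp only [lift_inl, lift_inr, aeval_eq_eval, Finset.mul_sum]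
  exact Finset.sum_congr rfl fun i _ => mul_left_comm _ _ _

theorem smul_eq_lift_of_mem_tangentAt {v w : Vec (2 * n)}
    (hw : w ∈ tangentAt X v) : eval v c.m • w = c.lift v (fun i => w (c.e (.inl i))) := by
  refine c.funext_of_inl_inr (fun i => ?_) (fun j => ?_)
  · rw [lift_inl]; rfl
  · rw [lift_inr]
    exact c.m_smul_eq_of_differential_eq_zero (fun k => mem_tangentAt.mp hw _ (c.mem k)) j

/-- If `Tan X = ℙ^{2n}`, then a form that vanishes on the tangent spaces at the points of the chart
is zero.  The tangent spaces at smooth points outside the chart are covered as well, because the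
tangent vector fields of another chart extend their vectors to points of both charts. -/
theorem eq_zero_of_eval_lift_eq_zero (hX : IsSubvariety X) (hn : HasDimension X n)
    (hTan : tangentVariety X = Set.univ) (hm : c.m ∉ homogIdeal X)
    {F : MvPolynomial (Fin (2 * n + 1)) ℂ} {d : ℕ} (hF : F.IsHomogeneous d)
    (h : ∀ v ∈ affineCone X, ∀ s, eval (c.lift v s) F = 0) : F = 0 := by
  let _ := zariski (2 * n)
  by_contra hF0
  obtain ⟨v, hv⟩ : ∃ v, eval v (F * MvPolynomial.X 0) ≠ 0 := by
    by_contra! h0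
    exact mul_ne_zero hF0 (X_ne_zero 0) (MvPolynomial.funext fun v => by rw [h0, map_zero])
  rw [map_mul, eval_X] at hv
  have hv0 : v ≠ 0 := fun h => right_ne_zero_of_mul hv (congrFun h 0)
  obtain ⟨a, ha, hav⟩ := exists_smul_rep hv0
  have hmem : Projectivization.mk ℂ v hv0 ∈ tangentVariety X := hTan ▸ Set.mem_univ _
  obtain ⟨P, hP, hPt⟩ := (mem_closure_iff.mp hmem) _ ((isTopologicalBasis_zariski _).isOpen
    ⟨d, F, hF, rfl⟩) (by
      have := left_ne_zero_of_mul hv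
      rw [hav, eval_smul_of_isHomogeneous hF] at this
      exact right_ne_zero_of_mul this)
  obtain ⟨x, hx, hPx⟩ := Set.mem_iUnion₂.mp hPt
  -- extend the tangent vector `P` at `x` to a polynomial family by a chart around `x`
  obtain ⟨c', hc'⟩ := exists_tangentChart hn hx
  have hw : P.rep ∈ tangentAt X x.rep := by
    rw [← coneTangentSpace_eq]
    refine hPx ?_
    rw [Projectivization.submodule_eq]
    exact Submodule.mem_span_singleton_self _
  have hxc := rep_mem_affineCone hx.1
  let u : Fin (n + 1) → ℂ := fun i => P.rep (c'.e (.inl i))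
  let G := aeval (c'.lift MvPolynomial.X (fun i => C (u i))) F
  have hG : ∀ v, eval v G = eval (c'.lift v u) F := fun v => by
    have h1 : (aeval v : _ →ₐ[ℂ] ℂ) G = aeval (c'.lift v u) F := by
      have h2 := c'.map_lift MvPolynomial.X (fun i => C (u i)) (aeval v : _ →ₐ[ℂ] ℂ)
      have h3 : (aeval v : _ →ₐ[ℂ] ℂ) ∘ MvPolynomial.X = v := by ext; simp
      have h4 : (aeval v : _ →ₐ[ℂ] ℂ) ∘ (fun i => C (u i)) = u := by ext; simp
      rw [h3, h4] at h2
      rw [comp_aeval_apply, ← h2]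
      rfl
    exact h1
  have hGI : G ∈ homogIdeal X := by
    have := hX.isPrime_homogIdeal
    have hc'I : c'.m ∉ homogIdeal X := fun h => hc' (mem_homogIdeal_iff.mp h _ hxc)
    refine (this.mem_or_mem (x := c.m * c'.m) (mem_homogIdeal_iff.mpr fun v hv => ?_)
      ).resolve_left (fun h => (this.mem_or_mem h).elim hm hc'I)
    rw [map_mul, map_mul]
    by_cases h1 : eval v c.m = 0
    · rw [h1]; ring
    by_cases h2 : eval v c'.m = 0
    · rw [h2]; ring
    have h3 := h v hv (fun i => c'.lift v u (c.e (.inl i)))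
    rw [← smul_eq_lift_of_mem_tangentAt (lift_mem_tangentAt hX hn hv h2 u),
      eval_smul_of_isHomogeneous hF] at h3
    rw [hG, (mul_eq_zero.mp h3).resolve_left (pow_ne_zero _ h1), mul_zero]
  have h1 := mem_homogIdeal_iff.mp hGI _ hxc
  rw [hG, ← smul_eq_lift_of_mem_tangentAt hw, eval_smul_of_isHomogeneous hF] at h1
  exact hP ((mul_eq_zero.mp h1).resolve_left (pow_ne_zero _ hc'))

end TangentChart

end

/-! ### The second fundamental form at a general tangent vector -/

section

variable {n : ℕ} {X : Set (PSpace (2 * n))}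

namespace TangentChart
variable (c : TangentChart X)

/-- The matrix of `u ↦ Q(u, s)` at the point `ξ`. -/
def QMatrix {R : Type*} [CommRing R] [Algebra ℂ R] (ξ : Fin (2 * n + 1) → R)
    (s : Fin (n + 1) → R) : Matrix (Fin n) (Fin (n + 1)) R :=
  .of fun j i => ∑ k, aeval ξ (c.Q i j k) * s k

theorem map_QMatrix {R S : Type*} [CommRing R] [Algebra ℂ R] [CommRing S] [Algebra ℂ S]
    (f : R →ₐ[ℂ] S) (ξ : Fin (2 * n + 1) → R) (s : Fin (n + 1) → R) :
    (c.QMatrix ξ s).map f = c.QMatrix (f ∘ ξ) (f ∘ s) := by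
  ext j i
  simp [QMatrix, comp_aeval_apply, Function.comp_def]

/-- Let `(ξ, σ)` be a point of the tangent bundle with coordinates in a field, and `Δ` a derivation
of this field.  If `Δ` kills the left coordinates of the tangent vector, then its values on the
right ones are given by the second fundamental form. -/
theorem QMatrix_mulVec_of_derivation {K : Type*} [Field K] [Algebra ℂ K] {ξ : Fin (2 * n + 1) → K}
    {σ : Fin (n + 1) → K} (hξ : ∀ k, aeval ξ (c.F k) = 0) (Δ : Derivation ℂ K K)
    (hΔ : ∀ i, Δ (c.lift ξ σ (c.e (.inl i))) = 0) (j : Fin n) :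
    (c.QMatrix ξ σ *ᵥ fun i => Δ (ξ (c.e (.inl i)))) j =
      aeval ξ c.m ^ 2 * Δ (c.lift ξ σ (c.e (.inr j))) := by
  set u : Fin (n + 1) → K := fun i => Δ (ξ (c.e (.inl i))) with hu
  have hr := c.m_smul_eq_of_differential_eq_zero (ξ := ξ) (w := fun l => Δ (ξ l)) (fun k => by
    rw [← derivation_aeval, hξ, map_zero])
  -- `m Δ` is a combination of the derivations `c.D i`
  have hvec : aeval ξ c.m • (fun l => Δ (ξ l)) = ∑ i, u i • fun l => aeval ξ (c.E i l) := by
    refine c.funext_of_inl_inr (fun i => ?_) (fun j => ?_)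
    · simp [E, hu, Pi.single_apply, apply_ite (aeval ξ), mul_comm]
    · rw [Pi.smul_apply, smul_eq_mul, hr]
      simp [E, hu, mul_comm]
  have hG : ∀ G, aeval ξ c.m * Δ (aeval ξ G) = ∑ i, u i * aeval ξ (c.D i G) := fun G => by
    rw [derivation_aeval, ← smul_eq_mul, ← map_smul, hvec, map_sum]
    exact Finset.sum_congr rfl fun i _ => by rw [map_smul, aeval_D, smul_eq_mul]
  have h1 : aeval ξ c.m * c.lift ξ σ (c.e (.inr j)) =
      ∑ k, aeval ξ (c.M j k) * c.lift ξ σ (c.e (.inl k)) := by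
    simp only [lift_inl, lift_inr, Finset.mul_sum]
    exact Finset.sum_congr rfl fun i _ => mul_left_comm _ _ _
  have h2 := congrArg (fun a => aeval ξ c.m * Δ a) h1
  simp only [Derivation.leibniz, map_sum, hΔ, smul_eq_mul, mul_zero, zero_add, mul_add,
    Finset.mul_sum] at h2
  have h3 : ∀ k, aeval ξ c.m * (c.lift ξ σ (c.e (.inl k)) * Δ (aeval ξ (c.M j k))) =
      ∑ i, aeval ξ c.m * σ k * (u i * aeval ξ (c.D i (c.M j k))) := fun k => by
    rw [mul_left_comm, hG, lift_inl, Finset.mul_sum]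
  have h4 : aeval ξ c.m * (c.lift ξ σ (c.e (.inr j)) * Δ (aeval ξ c.m)) =
      ∑ k, ∑ i, aeval ξ (c.M j k) * σ k * (u i * aeval ξ (c.D i c.m)) := by
    rw [mul_left_comm, hG, lift_inr, Finset.sum_mul]
    exact Finset.sum_congr rfl fun k _ => by rw [Finset.mul_sum]
  rw [h4, Finset.sum_congr rfl fun k _ => h3 k, ← eq_sub_iff_add_eq, ← Finset.sum_sub_distrib] at h2
  rw [pow_two, mul_assoc, h2]
  simp only [← Finset.sum_sub_distrib, mulVec, dotProduct, QMatrix, of_apply, Finset.sum_mul]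
  rw [Finset.sum_comm]
  refine Finset.sum_congr rfl fun k _ => Finset.sum_congr rfl fun i _ => ?_
  simp only [Q, of_apply, map_sub, map_mul]
  ring

variable {c}

/-- If the coordinates of the tangent vector are algebraically independent, then there are
derivations with arbitrary values on the right coordinates that kill the left ones, and
`u ↦ Q(u, σ)` is onto over the field of fractions. -/
theorem crossProd_QMatrix_ne_zero_of_algebraicIndependent {B : Type*} [CommRing B] [IsDomain B]
    [Algebra ℂ B] [Algebra.FiniteType ℂ B] {ξ : Fin (2 * n + 1) → B} {σ : Fin (n + 1) → B}
    (hξ : ∀ k, aeval ξ (c.F k) = 0) (hm : aeval ξ c.m ≠ 0)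
    (hz : AlgebraicIndependent ℂ (c.lift ξ σ)) : (c.QMatrix ξ σ).crossProd ≠ 0 := by
  let K := FractionRing B
  have : Algebra.EssFiniteType B K := .of_isLocalization _ (nonZeroDivisors B)
  have : Algebra.EssFiniteType ℂ K := .comp ℂ B K
  let ι : B →ₐ[ℂ] K := IsScalarTower.toAlgHom ℂ B K
  have hι : Function.Injective ι := IsFractionRing.injective B K
  have hzK : AlgebraicIndependent ℂ (c.lift (ι ∘ ξ) (ι ∘ σ)) := by
    rw [← c.map_lift ξ σ ι]
    exact hz.map' hι
  have hιξ : ∀ G, aeval (ι ∘ ξ) G = ι (aeval ξ G) := fun G => (comp_aeval_apply _ ι _).symm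
  have hmK : aeval (ι ∘ ξ) c.m ≠ 0 := fun h =>
    hm ((map_eq_zero_iff ι hι).mp (by rw [← hιξ, h]))
  have hsurj : Function.Surjective (c.QMatrix (ι ∘ ξ) (ι ∘ σ)).mulVec := by
    intro q
    obtain ⟨Δ, hΔ⟩ := exists_derivation_of_algebraicIndependent hzK
      (Sum.elim 0 (fun j => q j / aeval (ι ∘ ξ) c.m ^ 2) ∘ c.e.symm)
    refine ⟨fun i => Δ ((ι ∘ ξ) (c.e (.inl i))), ?_⟩
    ext j
    rw [c.QMatrix_mulVec_of_derivation (fun k => by rw [hιξ, hξ, map_zero]) Δ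
      (fun i => by rw [hΔ]; simp), hΔ]
    simp only [Function.comp, Equiv.symm_apply_apply, Sum.elim_inr]
    exact mul_div_cancel₀ _ (pow_ne_zero 2 hmK)
  intro h
  refine crossProd_ne_zero_of_surjective hsurj ?_
  rw [← c.map_QMatrix ι ξ σ,
    show (c.QMatrix ξ σ).map ι = (c.QMatrix ξ σ).map (ι : B →+* K) from rfl,
    crossProd_map, h]
  ext k
  exact map_zero ι

/-- If `Tan X = ℙ^{2n}`, then `Q_v(·, s)` is onto for some point `v` of the cone and some `s`.
The tautological point of the tangent bundle has coordinates in `A[s]`, where `A` is the coordinate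
ring of the cone.  It enters through a surjection `ψ` with kernel `homogIdeal X`, through which the
evaluations factor. -/
theorem exists_crossProd_QMatrix_ne_zero_of_surjective {A : Type*} [CommRing A] [IsDomain A]
    [Algebra ℂ A] (ψ : MvPolynomial (Fin (2 * n + 1)) ℂ →ₐ[ℂ] A) (hψ : Function.Surjective ψ)
    (hker : ∀ G, ψ G = 0 ↔ G ∈ homogIdeal X)
    (hev : ∀ v ∈ affineCone X, ∃ φ : A →ₐ[ℂ] ℂ, ∀ G, φ (ψ G) = eval v G)
    (hX : IsSubvariety X) (hn : HasDimension X n)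
    (hTan : tangentVariety X = Set.univ) (hm : c.m ∉ homogIdeal X) :
    ∃ v ∈ affineCone X, eval v c.m ≠ 0 ∧ ∃ s : Fin (n + 1) → ℂ,
      (c.QMatrix v s).crossProd ≠ 0 := by
  have : Algebra.FiniteType ℂ A := .of_surjective ψ hψ
  let B := MvPolynomial (Fin (n + 1)) A
  have : Algebra.FiniteType ℂ B := .trans (S := A) inferInstance inferInstance
  let π : MvPolynomial (Fin (2 * n + 1)) ℂ →ₐ[ℂ] B := (IsScalarTower.toAlgHom ℂ A B).comp ψ
  have hπ : ∀ G, π G = C (ψ G) := fun G => rfl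
  let ξ : Fin (2 * n + 1) → B := fun l => π (MvPolynomial.X l)
  have hξ : ∀ G, aeval ξ G = π G := fun G => by
    rw [show aeval ξ = π from by ext i; simp [ξ]]
  let σ : Fin (n + 1) → B := MvPolynomial.X
  have hevB : ∀ (φ : A →ₐ[ℂ] ℂ) (s : Fin (n + 1) → ℂ), ∃ f : B →ₐ[ℂ] ℂ,
      f ∘ ξ = (fun l => φ (ψ (MvPolynomial.X l))) ∧ f ∘ σ = s ∧
      ∀ b, f b = eval₂ (φ : A →+* ℂ) s b := by
    intro φ s
    let f : B →ₐ[ℂ] ℂ :=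
      { eval₂Hom (φ : A →+* ℂ) s with
        commutes' := fun a => by
          have : algebraMap ℂ B a = C (algebraMap ℂ A a) := rfl
          rw [this]
          change eval₂ _ s _ = _
          rw [eval₂_C]
          exact φ.commutes a }
    have hf : ∀ b, f b = eval₂ (φ : A →+* ℂ) s b := fun b => rfl
    refine ⟨f, ?_, ?_, hf⟩
    · ext l
      simp only [Function.comp, ξ, hf, hπ, eval₂_C]
      rfl
    · ext i
      simp only [Function.comp, σ, hf, eval₂_X]
  have hz : AlgebraicIndependent ℂ (c.lift ξ σ) := by
    rw [algebraicIndependent_iff]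
    intro F hF
    have h1 : ∀ v ∈ affineCone X, ∀ s, eval (c.lift v s) F = 0 := by
      intro v hv s
      obtain ⟨φ, hφ⟩ := hev v hv
      obtain ⟨f, hf1, hf2, -⟩ := hevB φ s
      have h2 := congrArg f hF
      rw [map_zero, comp_aeval_apply] at h2
      have h3 := c.map_lift ξ σ f
      simp only [hφ, eval_X] at hf1
      rw [hf1, hf2] at h3
      rw [← h3]
      exact h2
    rw [← sum_homogeneousComponent F]
    refine Finset.sum_eq_zero fun d _ => ?_
    refine eq_zero_of_eval_lift_eq_zero hX hn hTan hm (homogeneousComponent_isHomogeneous d F)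
      fun v hv s => eval_homogeneousComponent_eq_zero (fun a _ => ?_) d
    rw [← lift_smul]
    exact h1 v hv _
  have hmB : aeval ξ c.m ≠ 0 := by
    rw [hξ, hπ]
    exact fun h => hm ((hker _).mp (C_eq_zero.mp h))
  obtain ⟨k, hk⟩ := Function.ne_iff.mp (crossProd_QMatrix_ne_zero_of_algebraicIndependent
    (fun k => by rw [hξ, hπ, (hker _).mpr (c.mem k), C_0]) hmB hz)
  -- a point of `X̂ × ℂ^{n+1}` at which a nonzero element of `A[s]` does not vanish
  have hb := mul_ne_zero hmB hk
  obtain ⟨t, ht⟩ := ne_zero_iff.mp hb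
  obtain ⟨G, hG⟩ := hψ (coeff t (aeval ξ c.m * (c.QMatrix ξ σ).crossProd k))
  have hGI : G ∉ homogIdeal X := fun h => ht (by rw [← hG]; exact (hker G).mpr h)
  rw [mem_homogIdeal_iff] at hGI
  push Not at hGI
  obtain ⟨v, hv, hvG⟩ := hGI
  obtain ⟨φ, hφ⟩ := hev v hv
  have hb' : map (φ : A →+* ℂ) (aeval ξ c.m * (c.QMatrix ξ σ).crossProd k) ≠ 0 := fun h => hvG (by
    have := congrArg (coeff t) h
    rw [coeff_map, ← hG] at this
    rw [← hφ]
    exact this)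
  obtain ⟨s, hs⟩ : ∃ s, eval s (map (φ : A →+* ℂ)
      (aeval ξ c.m * (c.QMatrix ξ σ).crossProd k)) ≠ 0 := by
    by_contra! h
    exact hb' (MvPolynomial.funext fun s => by rw [h, map_zero])
  obtain ⟨f, hf1, hf2, hf⟩ := hevB φ s
  simp only [hφ, eval_X] at hf1
  rw [← eval₂_eq_eval_map, ← hf, map_mul] at hs
  refine ⟨v, hv, ?_, s, fun h => right_ne_zero_of_mul hs ?_⟩
  · have h1 := left_ne_zero_of_mul hs
    rwa [comp_aeval_apply, show (fun i => f (ξ i)) = v from hf1] at h1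
  · have h1 := crossProd_map (f : B →+* ℂ) (c.QMatrix ξ σ)
    have h2 := c.map_QMatrix f ξ σ
    rw [hf1, hf2] at h2
    have h3 : (c.QMatrix ξ σ).map (f : B →+* ℂ) = c.QMatrix v s := h2
    rw [h3, h] at h1
    exact (congrFun h1 k).symm

theorem exists_crossProd_QMatrix_ne_zero (hX : IsSubvariety X) (hn : HasDimension X n)
    (hTan : tangentVariety X = Set.univ) (hm : c.m ∉ homogIdeal X) :
    ∃ v ∈ affineCone X, eval v c.m ≠ 0 ∧ ∃ s : Fin (n + 1) → ℂ,
      (c.QMatrix v s).crossProd ≠ 0 := by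
  have := hX.isPrime_homogIdeal
  refine exists_crossProd_QMatrix_ne_zero_of_surjective (Ideal.Quotient.mkₐ ℂ (homogIdeal X))
    (Ideal.Quotient.mkₐ_surjective ℂ _) (fun G => Ideal.Quotient.eq_zero_iff_mem)
    (fun v hv => ⟨Ideal.Quotient.liftₐ (homogIdeal X) (aeval v) fun G hG => ?_, fun G => ?_⟩)
    hX hn hTan hm
  · exact mem_homogIdeal_iff.mp hG v hv
  · exact Ideal.Quotient.liftₐ_apply _ _ _ _

end TangentChart

end

/-! ### Formal integral curves and intersections of tangent spaces -/

section

section taylor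
variable {A : Type*} [CommRing A] [Algebra ℂ A]

/-- The Taylor series of `a` along the formal integral curve of the vector field `D` that starts at
the point `f`. -/
def taylorSeries (D : Derivation ℂ A A) (f : A →ₐ[ℂ] ℂ) (a : A) : PowerSeries ℂ :=
  .mk fun k => f (D^[k] a) / k.factorial

variable (D : Derivation ℂ A A) (f : A →ₐ[ℂ] ℂ)

theorem constantCoeff_taylorSeries (a : A) :
    PowerSeries.constantCoeff (taylorSeries D f a) = f a := by
  rw [← PowerSeries.coeff_zero_eq_constantCoeff_apply]
  simp [taylorSeries]

theorem coeff_taylorSeries_derivation (a : A) (k : ℕ) :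
    PowerSeries.coeff k (taylorSeries D f (D a)) =
      (k + 1) * PowerSeries.coeff (k + 1) (taylorSeries D f a) := by
  simp only [taylorSeries, PowerSeries.coeff_mk, Function.iterate_succ_apply, Nat.factorial_succ]
  push_cast
  have : (k.factorial : ℂ) ≠ 0 := by exact_mod_cast k.factorial_ne_zero
  have : (k + 1 : ℂ) ≠ 0 := by exact_mod_cast k.succ_ne_zero
  field_simp

theorem derivative_taylorSeries (a : A) :
    PowerSeries.derivative ℂ (taylorSeries D f a) = taylorSeries D f (D a) := by
  ext k
  rw [PowerSeries.coeff_derivative, coeff_taylorSeries_derivation, mul_comm]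

theorem taylorSeries_add (a b : A) :
    taylorSeries D f (a + b) = taylorSeries D f a + taylorSeries D f b := by
  ext k
  simp [taylorSeries, iterate_map_add, add_div]

theorem taylorSeries_mul (a b : A) :
    taylorSeries D f (a * b) = taylorSeries D f a * taylorSeries D f b := by
  ext k
  induction k generalizing a b with
  | zero => simp [constantCoeff_taylorSeries]
  | succ k ih =>
    have h1 := coeff_taylorSeries_derivation D f (a * b) k
    have h2 : PowerSeries.coeff k (PowerSeries.derivative ℂ
        (taylorSeries D f a * taylorSeries D f b)) =
        PowerSeries.coeff k (taylorSeries D f (D (a * b))) := by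
      rw [Derivation.leibniz, Derivation.leibniz, taylorSeries_add, derivative_taylorSeries,
        derivative_taylorSeries, map_add, map_add, smul_eq_mul, smul_eq_mul, smul_eq_mul,
        smul_eq_mul, ih, ih]
    rw [← h2, PowerSeries.coeff_derivative, mul_comm] at h1
    have : (k + 1 : ℂ) ≠ 0 := by exact_mod_cast k.succ_ne_zero
    exact (mul_left_cancel₀ this h1).symm

theorem taylorSeries_algebraMap (r : ℂ) :
    taylorSeries D f (algebraMap ℂ A r) = algebraMap ℂ _ r := by
  ext k
  cases k with
  | zero => simp [taylorSeries]
  | succ k =>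
    have h0 : D^[k] 0 = 0 := Function.iterate_fixed (map_zero D) k
    simp [taylorSeries, h0]

/-- The formal integral curve of the vector field `D` that starts at the point `f`, as a
homomorphism to the power series ring. -/
def taylorHom : A →ₐ[ℂ] PowerSeries ℂ where
  toFun := taylorSeries D f
  map_one' := by rw [← map_one (algebraMap ℂ A), taylorSeries_algebraMap, map_one]
  map_mul' := taylorSeries_mul D f
  map_zero' := by rw [← map_zero (algebraMap ℂ A), taylorSeries_algebraMap, map_zero]
  map_add' := taylorSeries_add D f
  commutes' := taylorSeries_algebraMap D f

theorem coeff_zero_taylorHom (a : A) : PowerSeries.coeff 0 (taylorHom D f a) = f a := by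
  rw [PowerSeries.coeff_zero_eq_constantCoeff_apply]
  exact constantCoeff_taylorSeries D f a

theorem coeff_taylorHom_derivation (a : A) (k : ℕ) :
    PowerSeries.coeff k (taylorHom D f (D a)) =
      (k + 1) * PowerSeries.coeff (k + 1) (taylorHom D f a) :=
  coeff_taylorSeries_derivation D f a k

theorem coeff_one_taylorHom (a : A) : PowerSeries.coeff 1 (taylorHom D f a) = f (D a) := by
  have := coeff_taylorHom_derivation D f a 0
  rw [coeff_zero_taylorHom] at this
  simpa using this.symm

/-- An integral curve of a vector field that is tangent to a subscheme stays inside it. -/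
theorem taylorHom_eq_zero_of_mem {I : Ideal A} (hD : ∀ a ∈ I, D a ∈ I) (hf : ∀ a ∈ I, f a = 0)
    {a : A} (ha : a ∈ I) : taylorHom D f a = 0 := by
  ext k
  have h : D^[k] a ∈ I := by
    induction k with
    | zero => exact ha
    | succ k ih => rw [Function.iterate_succ_apply']; exact hD _ ih
  change PowerSeries.coeff k (taylorSeries D f a) = 0
  simp [taylorSeries, hf _ h]

end taylor

variable {n : ℕ} {X : Set (PSpace (2 * n))}

namespace TangentChart
variable (c : TangentChart X)

section
variable {R : Type*} [CommRing R] [Algebra ℂ R]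

/-- The matrix `m(ξ) M(η) - m(η) M(ξ)`.  Its kernel describes the intersection of the tangent spaces
at `ξ` and `η`. -/
def diffMatrix (ξ η : Fin (2 * n + 1) → R) : Matrix (Fin n) (Fin (n + 1)) R :=
  .of fun j i => aeval ξ c.m * aeval η (c.M j i) - aeval η c.m * aeval ξ (c.M j i)

/-- The vector of signed maximal minors of `c.diffMatrix ξ η`, which solves the equations
for the intersection of the tangent spaces at `ξ` and `η`. -/
def cross (ξ η : Fin (2 * n + 1) → R) : Fin (n + 1) → R := (c.diffMatrix ξ η).crossProd

theorem map_diffMatrix {S : Type*} [CommRing S] [Algebra ℂ S] (f : R →ₐ[ℂ] S)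
    (ξ η : Fin (2 * n + 1) → R) :
    (c.diffMatrix ξ η).map f = c.diffMatrix (f ∘ ξ) (f ∘ η) := by
  ext j i
  simp [diffMatrix, comp_aeval_apply, Function.comp_def]

theorem map_cross {S : Type*} [CommRing S] [Algebra ℂ S] (f : R →ₐ[ℂ] S)
    (ξ η : Fin (2 * n + 1) → R) : f ∘ c.cross ξ η = c.cross (f ∘ ξ) (f ∘ η) := by
  rw [cross, cross, ← map_diffMatrix]
  exact (crossProd_map (f : R →+* S) _).symm

theorem map_crossProd_QMatrix_cross {S : Type*} [CommRing S] [Algebra ℂ S] (f : R →ₐ[ℂ] S)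
    (ξ η : Fin (2 * n + 1) → R) : f ∘ (c.QMatrix ξ (c.cross ξ η)).crossProd =
      (c.QMatrix (f ∘ ξ) (c.cross (f ∘ ξ) (f ∘ η))).crossProd := by
  rw [← map_cross, ← map_QMatrix]
  exact (crossProd_map (f : R →+* S) _).symm

end
end TangentChart

end

/-! ### The second fundamental form along a curve -/

section

variable {n : ℕ} {X : Set (PSpace (2 * n))}

namespace TangentChart
variable {c : TangentChart X}

theorem powerSeries_coeff_one_mul (a b : PowerSeries ℂ) : PowerSeries.coeff 1 (a * b) =
    PowerSeries.coeff 0 a * PowerSeries.coeff 1 b +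
      PowerSeries.coeff 1 a * PowerSeries.coeff 0 b := by
  rw [PowerSeries.coeff_mul, Finset.Nat.sum_antidiagonal_eq_sum_range_succ_mk]
  simp [Finset.sum_range_succ]

theorem QMatrix_mulVec_comm (hX : IsSubvariety X) (hn : HasDimension X n)
    (hm : c.m ∉ homogIdeal X) {x : Vec (2 * n)} (hx : x ∈ affineCone X) (s t : Fin (n + 1) → ℂ) :
    c.QMatrix x s *ᵥ t = c.QMatrix x t *ᵥ s := by
  ext j
  simp only [mulVec, dotProduct, QMatrix, of_apply, Finset.sum_mul, aeval_eq_eval]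
  rw [Finset.sum_comm]
  refine Finset.sum_congr rfl fun k _ => Finset.sum_congr rfl fun i _ => ?_
  have := eval_Q_symm hX hn hm hx i k j
  change eval x (c.Q i j k) * s k * t i = eval x (c.Q k j i) * t i * s k
  rw [this]; ring

theorem QMatrix_self (hX : IsSubvariety X) (hn : HasDimension X n)
    (hm : c.m ∉ homogIdeal X) {x : Vec (2 * n)} (hx : x ∈ affineCone X) :
    c.QMatrix x (fun i => x (c.e (.inl i))) = 0 := by
  ext j i
  exact eval_Q_mul_self hX hn hm hx i j

theorem QMatrix_add {R : Type*} [CommRing R] [Algebra ℂ R] (ξ : Fin (2 * n + 1) → R)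
    (s t : Fin (n + 1) → R) : c.QMatrix ξ (s + t) = c.QMatrix ξ s + c.QMatrix ξ t := by
  ext j i
  simp [QMatrix, mul_add, Finset.sum_add_distrib]

theorem QMatrix_smul {R : Type*} [CommRing R] [Algebra ℂ R] (ξ : Fin (2 * n + 1) → R)
    (a : R) (s : Fin (n + 1) → R) : c.QMatrix ξ (a • s) = a • c.QMatrix ξ s := by
  ext j i
  simp [QMatrix, mul_left_comm, Finset.mul_sum]

/-- Let `s` be such that `Q_x(·, s)` is onto.  Then there is a formal curve `γ` in the cone,
starting at `x`, along which `cross x γ` and the maximal minors of `Q_x(·, cross x γ)` are not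
identically zero.  The curve is the integral curve of `∑ sᵢ c.D i`.

Let `t` be the vector of left coordinates of `x`.  Write `T` for the variable of the power
series.  The difference matrix is `T N'` with `N'(0) = Q_x(·, s)`.  The kernel vector `s'` of `N'`
has the constant coefficient `a⁻¹ t` and the linear coefficient `a⁻¹ (m(x) / 2) s + b t`, as a
comparison of coefficients up to second order shows.  Since `Q_x(·, t) = 0`, the matrix
`Q_x(·, s')` is divisible by `T`, and the quotient is a nonzero multiple of `Q_x(·, s)` at
`T = 0`. -/
theorem crossProd_ne_zero_along_arc (hX : IsSubvariety X) (hn : HasDimension X n)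
    (hm : c.m ∉ homogIdeal X) {x : Vec (2 * n)} (hx : x ∈ affineCone X) (hx0 : x ≠ 0)
    (hmx : eval x c.m ≠ 0) {s : Fin (n + 1) → ℂ} (hs : (c.QMatrix x s).crossProd ≠ 0) :
    ∃ γ : MvPolynomial (Fin (2 * n + 1)) ℂ →ₐ[ℂ] PowerSeries ℂ, (∀ G ∈ homogIdeal X, γ G = 0) ∧
      c.cross (fun l => algebraMap ℂ _ (x l)) (fun l => γ (MvPolynomial.X l)) ≠ 0 ∧
      (c.QMatrix (fun l => algebraMap ℂ _ (x l)) (c.cross (fun l => algebraMap ℂ _ (x l))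
        (fun l => γ (MvPolynomial.X l)))).crossProd ≠ 0 := by
  let D := ∑ i, s i • c.D i
  let γ := taylorHom D (aeval x)
  have hD : ∀ G, D G = ∑ i, C (s i) * c.D i G := fun G => by
    simp only [D]
    rw [derivation_sum_apply]
    exact Finset.sum_congr rfl fun i _ => by rw [Derivation.smul_apply, smul_eq_C_mul]
  have hDI : ∀ G ∈ homogIdeal X, D G ∈ homogIdeal X := fun G hG => by
    rw [hD]
    exact Ideal.sum_mem _ fun i _ => Ideal.mul_mem_left _ _ (D_mem_homogIdeal hX hn hm i hG)
  have hγI : ∀ G ∈ homogIdeal X, γ G = 0 := fun G hG =>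
    taylorHom_eq_zero_of_mem D _ hDI (fun G hG => mem_homogIdeal_iff.mp hG x hx) hG
  have hγ0 : ∀ G, PowerSeries.coeff 0 (γ G) = eval x G := coeff_zero_taylorHom D _
  have hγ1 : ∀ G, PowerSeries.coeff 1 (γ G) = ∑ i, s i * eval x (c.D i G) := fun G => by
    refine (coeff_one_taylorHom D _ G).trans ?_
    rw [hD]
    simp
  have hγS : ∀ G (k : ℕ), (k + 1 : ℂ) * PowerSeries.coeff (k + 1) (γ G) =
      PowerSeries.coeff k (γ (D G)) := fun G k => (coeff_taylorHom_derivation D _ G k).symm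
  set ξ : Fin (2 * n + 1) → PowerSeries ℂ := fun l => algebraMap ℂ _ (x l) with hξdef
  set η : Fin (2 * n + 1) → PowerSeries ℂ := fun l => γ (MvPolynomial.X l) with hηdef
  have hξ : ∀ G, aeval ξ G = algebraMap ℂ _ (eval x G) := fun G =>
    (comp_aeval_apply x (Algebra.ofId ℂ (PowerSeries ℂ)) G).symm
  have hη : ∀ G, aeval η G = γ G := fun G => by
    rw [show aeval η = γ from by ext i; simp [η]]
  refine ⟨γ, hγI, ?_⟩
  set N := c.diffMatrix ξ η with hN
  have hNji : ∀ j i, N j i = PowerSeries.C (eval x c.m) * γ (c.M j i) -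
      γ c.m * PowerSeries.C (eval x (c.M j i)) := fun j i => by
    simp only [hN, diffMatrix, of_apply, hξ, hη]
    rfl
  have hN0 : ∀ j i, PowerSeries.constantCoeff (N j i) = 0 := fun j i => by
    rw [hNji, ← PowerSeries.coeff_zero_eq_constantCoeff_apply, map_sub, PowerSeries.coeff_C_mul,
      PowerSeries.coeff_mul_C, hγ0, hγ0, sub_self]
  have hN1 : ∀ j i, PowerSeries.coeff 1 (N j i) = c.QMatrix x s j i := fun j i => by
    rw [hNji, map_sub, PowerSeries.coeff_C_mul, PowerSeries.coeff_mul_C, hγ1, hγ1, Finset.mul_sum,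
      Finset.sum_mul, ← Finset.sum_sub_distrib]
    refine Finset.sum_congr rfl fun k _ => ?_
    change _ = eval x (c.Q i j k) * s k
    rw [eval_Q_symm hX hn hm hx i k j]
    simp only [Q, of_apply, map_sub, map_mul]
    ring
  choose N' hN' using fun j i => PowerSeries.X_dvd_iff.mpr (hN0 j i)
  have hNN' : N = (PowerSeries.X : PowerSeries ℂ) • of N' := by
    ext1 j i
    exact hN' j i
  have hN'0 : (of N').map PowerSeries.constantCoeff = c.QMatrix x s := by
    ext j i
    rw [← hN1, hN']
    exact ((PowerSeries.coeff_succ_X_mul 0 _).trans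
      (PowerSeries.coeff_zero_eq_constantCoeff_apply _)).symm
  have hN'0ji : ∀ j i, PowerSeries.coeff 0 (N' j i) = c.QMatrix x s j i := fun j i => by
    rw [← hN'0, PowerSeries.coeff_zero_eq_constantCoeff_apply]; rfl
  -- the kernel vector of `N'`; it differs from `cross x γ` by a power of `X`
  set s' := (of N').crossProd with hs'
  have hcross : c.cross ξ η = (PowerSeries.X : PowerSeries ℂ) ^ n • s' := by
    rw [cross, ← hN, hNN', crossProd_smul]
  have hs'0 : (fun i => PowerSeries.coeff 0 (s' i)) = (c.QMatrix x s).crossProd := by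
    rw [← hN'0, crossProd_map]
    ext i
    simp [hs']
  let t : Fin (n + 1) → ℂ := fun i => x (c.e (.inl i))
  have ht0 : t ≠ 0 := fun h => hx0 (c.funext_of_inl_inr (fun i => congrFun h i) fun j => by
    have h1 := eval_euler (c := c) hx j
    rw [Finset.sum_eq_zero fun i _ => by
      rw [show x (c.e (.inl i)) = 0 from congrFun h i, mul_zero]] at h1
    exact (mul_eq_zero.mp h1).resolve_left hmx)
  have hQt : c.QMatrix x s *ᵥ t = 0 := by
    rw [QMatrix_mulVec_comm hX hn hm hx, QMatrix_self hX hn hm hx, zero_mulVec]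
  obtain ⟨a, ha⟩ := exists_eq_smul_crossProd hs hQt
  have ha0 : a ≠ 0 := fun h => ht0 (by rw [ha, h, zero_smul])
  have hs't : ∀ i, PowerSeries.coeff 0 (s' i) = a⁻¹ * t i := fun i => by
    rw [show PowerSeries.coeff 0 (s' i) = (c.QMatrix x s).crossProd i from congrFun hs'0 i, ha,
      Pi.smul_apply, smul_eq_mul, inv_mul_cancel_left₀ ha0]
  let s1 : Fin (n + 1) → ℂ := fun i => PowerSeries.coeff 1 (s' i)
  -- the linear coefficient of `N' s' = 0`
  have hker : ∀ j, ∑ i, (c.QMatrix x s j i * s1 i +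
      PowerSeries.coeff 1 (N' j i) * (a⁻¹ * t i)) = 0 := fun j => by
    have h1 := congrArg (PowerSeries.coeff 1) (congrFun (mulVec_crossProd (of N')) j)
    rw [mulVec, dotProduct, map_sum] at h1
    simp only [powerSeries_coeff_one_mul, of_apply, hN'0ji, ← hs', hs't] at h1
    exact h1
  -- As `γ` lies in its own tangent space, `N` maps its left coordinates to `m(γ) z`, where `z`
  -- measures the deviation of `γ` from `T_x`.  The series `z` vanishes to second order, and its
  -- second coefficient is half of `Q_x(s, s)`.
  have hN't : ∀ j, ∑ i, PowerSeries.coeff 1 (N' j i) * t i =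
      -(eval x c.m / 2) * (c.QMatrix x s *ᵥ s) j := fun j => by
    let z : PowerSeries ℂ := PowerSeries.C (eval x c.m) * η (c.e (.inr j)) -
      ∑ i, PowerSeries.C (eval x (c.M j i)) * η (c.e (.inl i))
    have hEuler : γ c.m * η (c.e (.inr j)) = ∑ i, γ (c.M j i) * η (c.e (.inl i)) := by
      have h1 : c.m * MvPolynomial.X (c.e (.inr j)) -
          ∑ i, c.M j i * MvPolynomial.X (c.e (.inl i)) ∈ homogIdeal X :=
        mem_homogIdeal_iff.mpr fun v hv => by simpa [sub_eq_zero] using eval_euler hv j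
      have h2 := hγI _ h1
      rw [map_sub, map_mul, map_sum, sub_eq_zero] at h2
      exact h2.trans (Finset.sum_congr rfl fun i _ => map_mul γ _ _)
    have hNz : ∑ i, N j i * η (c.e (.inl i)) = γ c.m * z := by
      simp only [hNji, sub_mul, Finset.sum_sub_distrib, z, mul_sub, Finset.mul_sum]
      congr 1
      · rw [mul_left_comm, hEuler, Finset.mul_sum]
        exact Finset.sum_congr rfl fun i _ => mul_assoc _ _ _
      · exact Finset.sum_congr rfl fun i _ => mul_assoc _ _ _
    have hN'z : (PowerSeries.X : PowerSeries ℂ) * ∑ i, N' j i * η (c.e (.inl i)) = γ c.m * z := by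
      rw [← hNz, Finset.mul_sum]
      exact Finset.sum_congr rfl fun i _ => by rw [hN', mul_assoc]
    have hηl : ∀ i, γ (D (MvPolynomial.X (c.e (.inl i)))) =
        PowerSeries.C (s i) * γ c.m := fun i => by
      rw [hD, Finset.sum_eq_single i]
      · rw [D_X_inl, Pi.single_eq_same, map_mul]
        congr 1
        exact γ.commutes _
      · intro k _ hk
        rw [D_X_inl, Pi.single_eq_of_ne' hk, mul_zero]
      · simp
    have hηr : γ (D (MvPolynomial.X (c.e (.inr j)))) =
        ∑ i, PowerSeries.C (s i) * γ (c.M j i) := by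
      rw [hD, map_sum]
      refine Finset.sum_congr rfl fun i _ => ?_
      rw [D_X_inr, map_mul]
      congr 1
      exact γ.commutes _
    have hz : ∀ k : ℕ, (k + 1 : ℂ) * PowerSeries.coeff (k + 1) z =
        ∑ i, PowerSeries.coeff k (N j i) * s i := fun k => by
      simp only [z, map_sub, map_sum, PowerSeries.coeff_C_mul, mul_sub, Finset.mul_sum,
        mul_left_comm _ (eval x _)]
      simp only [η, hγS, hηl, hηr, map_sum, PowerSeries.coeff_C_mul, hNji, map_sub,
        PowerSeries.coeff_mul_C, Finset.mul_sum, sub_mul, Finset.sum_sub_distrib]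
      congr 1
      · exact Finset.sum_congr rfl fun i _ => by ring
      · exact Finset.sum_congr rfl fun i _ => by ring
    have hz0 : PowerSeries.coeff 0 z = 0 := by
      simp only [z, map_sub, map_sum, PowerSeries.coeff_C_mul, η, hγ0, eval_X]
      rw [sub_eq_zero]
      exact eval_euler hx j
    have hz1 : PowerSeries.coeff 1 z = 0 := by
      have h1 := hz 0
      simp only [PowerSeries.coeff_zero_eq_constantCoeff_apply, hN0] at h1
      simpa using h1
    have hz2 : 2 * PowerSeries.coeff 2 z = (c.QMatrix x s *ᵥ s) j := by
      have h1 := hz 1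
      simp only [hN1] at h1
      rw [mulVec, dotProduct, ← h1]
      norm_num
    have hη1 : ∀ i, PowerSeries.coeff 1 (η (c.e (.inl i))) = eval x c.m * s i := fun i => by
      simp only [η, hγ1, D_X_inl, Pi.single_apply, apply_ite (eval x), map_zero, mul_ite, mul_zero,
        Finset.sum_ite_eq, Finset.mem_univ, if_true, mul_comm]
    have h1 := congrArg (PowerSeries.coeff 2) hN'z
    have h2 : PowerSeries.coeff 2 (γ c.m * z) = eval x c.m * PowerSeries.coeff 2 z := by
      rw [PowerSeries.coeff_mul, Finset.Nat.sum_antidiagonal_eq_sum_range_succ_mk,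
        Finset.sum_range_succ, Finset.sum_range_succ, Finset.sum_range_one]
      simp only [Nat.sub_zero, Nat.reduceSub, hz1, hz0, hγ0, mul_zero, add_zero]
    rw [h2, PowerSeries.coeff_succ_X_mul, map_sum] at h1
    simp only [powerSeries_coeff_one_mul, hN'0ji, hη1] at h1
    have h3 : ∀ i, PowerSeries.coeff 0 (η (c.e (.inl i))) = t i := fun i => by
      simp only [η, hγ0, eval_X, t]
    simp only [h3] at h1
    rw [Finset.sum_add_distrib] at h1
    have h4 : ∑ i, c.QMatrix x s j i * (eval x c.m * s i) =
        eval x c.m * (c.QMatrix x s *ᵥ s) j := by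
      rw [mulVec, dotProduct, Finset.mul_sum]
      exact Finset.sum_congr rfl fun i _ => by ring
    rw [h4] at h1
    linear_combination h1 + eval x c.m / 2 * hz2
  -- the kernel of `Q_x(·, s)` is spanned by `t`
  have hs1 : ∃ b : ℂ, s1 = (a⁻¹ * (eval x c.m / 2)) • s + b • t := by
    have h1 : c.QMatrix x s *ᵥ (s1 - (a⁻¹ * (eval x c.m / 2)) • s) = 0 := by
      ext j
      have h2 := hker j
      rw [Finset.sum_add_distrib] at h2
      have h3 : ∑ i, PowerSeries.coeff 1 (N' j i) * (a⁻¹ * t i) =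
          a⁻¹ * ∑ i, PowerSeries.coeff 1 (N' j i) * t i := by
        rw [Finset.mul_sum]; exact Finset.sum_congr rfl fun i _ => by ring
      rw [h3, hN't] at h2
      rw [mulVec_sub, mulVec_smul, Pi.sub_apply, Pi.smul_apply, smul_eq_mul, Pi.zero_apply]
      change (c.QMatrix x s *ᵥ s1) j + _ = 0 at h2
      linear_combination h2
    obtain ⟨b, hb⟩ := exists_eq_smul_crossProd hs h1
    refine ⟨b * a⁻¹, ?_⟩
    rw [sub_eq_iff_eq_add'] at hb
    rw [hb, ha, smul_smul, inv_mul_cancel_right₀ ha0]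
  obtain ⟨b, hb⟩ := hs1
  have hR1 : ∀ j i, PowerSeries.constantCoeff (c.QMatrix ξ s' j i) = 0 := fun j i => by
    rw [← PowerSeries.coeff_zero_eq_constantCoeff_apply]
    simp only [QMatrix, of_apply, map_sum, hξ]
    have h1 : c.QMatrix x (a⁻¹ • t) j i = 0 := by
      rw [QMatrix_smul, QMatrix_self hX hn hm hx, smul_zero]; rfl
    refine (Finset.sum_congr rfl fun k _ => ?_).trans h1
    rw [Pi.smul_apply, smul_eq_mul, ← hs't k]
    exact PowerSeries.coeff_C_mul _ _ _
  choose R' hR' using fun j i => PowerSeries.X_dvd_iff.mpr (hR1 j i)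
  have hRR' : c.QMatrix ξ s' = (PowerSeries.X : PowerSeries ℂ) • of R' := by
    ext1 j i
    exact hR' j i
  have hR'0 : (of R').map PowerSeries.constantCoeff =
      (a⁻¹ * (eval x c.m / 2)) • c.QMatrix x s := by
    have h1 : c.QMatrix x s1 = (a⁻¹ * (eval x c.m / 2)) • c.QMatrix x s := by
      rw [hb, QMatrix_add, QMatrix_smul, QMatrix_smul, QMatrix_self hX hn hm hx, smul_zero,
        add_zero]
    rw [← h1]
    ext j i
    have h2 : PowerSeries.coeff 1 (c.QMatrix ξ s' j i) = c.QMatrix x s1 j i := by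
      simp only [QMatrix, of_apply, map_sum, hξ]
      exact Finset.sum_congr rfl fun k _ => PowerSeries.coeff_C_mul _ _ _
    rw [← h2, hR']
    exact ((PowerSeries.coeff_succ_X_mul 0 _).trans
      (PowerSeries.coeff_zero_eq_constantCoeff_apply _)).symm
  have hne : s' ≠ 0 := fun h => hs (by
    rw [← hs'0, h]; ext i; simp)
  refine ⟨?_, ?_⟩
  · rw [hcross]
    exact smul_ne_zero (pow_ne_zero _ PowerSeries.X_ne_zero) hne
  · rw [hcross, QMatrix_smul, hRR', crossProd_smul, crossProd_smul]
    refine smul_ne_zero (pow_ne_zero _ (pow_ne_zero _ PowerSeries.X_ne_zero))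
      (smul_ne_zero (pow_ne_zero _ PowerSeries.X_ne_zero) fun h => ?_)
    have h1 := crossProd_map PowerSeries.constantCoeff (of R')
    rw [hR'0, h, crossProd_smul] at h1
    have h2 : (a⁻¹ * (eval x c.m / 2)) ^ n • (c.QMatrix x s).crossProd = 0 := by
      rw [h1]; ext i; simp
    exact smul_ne_zero (pow_ne_zero _ (mul_ne_zero (inv_ne_zero ha0)
      (div_ne_zero hmx two_ne_zero))) hs h2

end TangentChart

end

/-! ### General pairs of points -/

section

section pair
variable {N : ℕ} {X : Set (PSpace N)}

theorem eval_aeval_eq {σ τ : Type*} (Φ : τ → MvPolynomial σ ℂ) (F : MvPolynomial τ ℂ) (v : σ → ℂ) :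
    eval v (aeval Φ F) = eval (fun i => eval v (Φ i)) F :=
  comp_aeval_apply Φ (aeval v : MvPolynomial σ ℂ →ₐ[ℂ] ℂ) F

/-- The product of the affine cone over `X` with itself is irreducible. -/
theorem IsSubvariety.exists_eval_pair_ne_zero (hX : IsSubvariety X)
    {F G : MvPolynomial (Fin (N + 1) ⊕ Fin (N + 1)) ℂ} {u v u' v' : Vec N}
    (hu : u ∈ affineCone X) (hv : v ∈ affineCone X) (hu' : u' ∈ affineCone X)
    (hv' : v' ∈ affineCone X) (hF : eval (Sum.elim u v) F ≠ 0) (hG : eval (Sum.elim u' v') G ≠ 0) :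
    ∃ x ∈ affineCone X, ∃ y ∈ affineCone X,
      eval (Sum.elim x y) F ≠ 0 ∧ eval (Sum.elim x y) G ≠ 0 := by
  have hl : ∀ (v : Vec N) (F : MvPolynomial (Fin (N + 1) ⊕ Fin (N + 1)) ℂ) (u : Vec N),
      eval u (aeval (Sum.elim MvPolynomial.X (C ∘ v)) F) = eval (Sum.elim u v) F := fun v F u => by
    rw [eval_aeval_eq]
    congr 2
    ext i
    cases i <;> simp
  have hr : ∀ (v : Vec N) (F : MvPolynomial (Fin (N + 1) ⊕ Fin (N + 1)) ℂ) (u : Vec N),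
      eval v (aeval (Sum.elim (C ∘ u) MvPolynomial.X) F) = eval (Sum.elim u v) F := fun v F u => by
    rw [eval_aeval_eq]
    congr 2
    ext i
    cases i <;> simp
  rw [← hl] at hF hG
  obtain ⟨x, hx, h1, h2⟩ := hX.exists_eval_ne_zero hu hu' hF hG
  rw [hl, ← hr] at h1 h2
  obtain ⟨y, hy, h1, h2⟩ := hX.exists_eval_ne_zero hv hv' h1 h2
  rw [hr] at h1 h2
  exact ⟨x, hx, y, hy, h1, h2⟩

/-- The first group of variables. -/
def xs (N : ℕ) : Fin (N + 1) → MvPolynomial (Fin (N + 1) ⊕ Fin (N + 1)) ℂ :=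
  fun l => MvPolynomial.X (.inl l)

/-- The second group of variables. -/
def ys (N : ℕ) : Fin (N + 1) → MvPolynomial (Fin (N + 1) ⊕ Fin (N + 1)) ℂ :=
  fun l => MvPolynomial.X (.inr l)

theorem aeval_comp_xs (x y : Vec N) :
    (aeval (Sum.elim x y) : MvPolynomial _ ℂ →ₐ[ℂ] ℂ) ∘ xs N = x := by
  ext l; simp [xs]

theorem aeval_comp_ys (x y : Vec N) :
    (aeval (Sum.elim x y) : MvPolynomial _ ℂ →ₐ[ℂ] ℂ) ∘ ys N = y := by
  ext l; simp [ys]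

theorem eval_aeval_xs (F : MvPolynomial (Fin (N + 1)) ℂ) (x y : Vec N) :
    eval (Sum.elim x y) (aeval (xs N) F) = eval x F := by
  rw [eval_aeval_eq]; simp [xs]

theorem eval_aeval_ys (F : MvPolynomial (Fin (N + 1)) ℂ) (x y : Vec N) :
    eval (Sum.elim x y) (aeval (ys N) F) = eval y F := by
  rw [eval_aeval_eq]; simp [ys]

end pair

variable {n : ℕ} {X : Set (PSpace (2 * n))}

namespace TangentChart
variable {c : TangentChart X}

theorem map_crossProd_QMatrix {R S : Type*} [CommRing R] [Algebra ℂ R] [CommRing S] [Algebra ℂ S]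
    (f : R →ₐ[ℂ] S) (ξ : Fin (2 * n + 1) → R) (s : Fin (n + 1) → R) :
    f ∘ (c.QMatrix ξ s).crossProd = (c.QMatrix (f ∘ ξ) (f ∘ s)).crossProd := by
  rw [← c.map_QMatrix f ξ s]
  exact (crossProd_map (f : R →+* S) (c.QMatrix ξ s)).symm

/-- A polynomial in `y` that does not vanish along a formal curve in the cone does not vanish at
some point of the cone. -/
theorem exists_pair_crossProd_QMatrix_cross_ne_zero (hX : IsSubvariety X) (hn : HasDimension X n)
    (hTan : tangentVariety X = Set.univ) (hm : c.m ∉ homogIdeal X) :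
    ∃ x ∈ affineCone X, ∃ y ∈ affineCone X, c.cross x y ≠ 0 ∧
      (c.QMatrix x (c.cross x y)).crossProd ≠ 0 := by
  obtain ⟨v, hv, hmv, s, hs⟩ := exists_crossProd_QMatrix_ne_zero hX hn hTan hm
  obtain ⟨k, hk⟩ := Function.ne_iff.mp hs
  obtain ⟨z, hz⟩ := hX.isIrreducible.1
  obtain ⟨l, hl⟩ := Function.ne_iff.mp z.rep_nonzero
  have hG : ∀ x, eval x (c.m * (c.QMatrix MvPolynomial.X (fun i => C (s i))).crossProd k) =
      eval x c.m * (c.QMatrix x s).crossProd k := fun x => by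
    rw [map_mul]
    congr 1
    have h1 := congrFun (c.map_crossProd_QMatrix (aeval x : MvPolynomial _ ℂ →ₐ[ℂ] ℂ) MvPolynomial.X
      (fun i => C (s i))) k
    simp only [Function.comp_def, aeval_eq_eval, eval_X, eval_C] at h1
    exact h1
  obtain ⟨x, hx, h1, h2⟩ := hX.exists_eval_ne_zero (G := MvPolynomial.X l) hv
    (rep_mem_affineCone hz) (by rw [hG]; exact mul_ne_zero hmv hk) (by rw [eval_X]; exact hl)
  rw [hG] at h1
  rw [eval_X] at h2
  obtain ⟨γ, hγ, h3, h4⟩ := crossProd_ne_zero_along_arc hX hn hm hx (fun h => h2 (congrFun h l))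
    (left_ne_zero_of_mul h1) (s := s) (fun h => right_ne_zero_of_mul h1 (congrFun h k))
  obtain ⟨k1, hk1⟩ := Function.ne_iff.mp h3
  obtain ⟨k2, hk2⟩ := Function.ne_iff.mp h4
  let ξ : Fin (2 * n + 1) → MvPolynomial (Fin (2 * n + 1)) ℂ := fun l => C (x l)
  let H := c.cross ξ MvPolynomial.X k1 *
    (c.QMatrix ξ (c.cross ξ MvPolynomial.X)).crossProd k2
  have hH : ∀ {S : Type} [CommRing S] [Algebra ℂ S] (f : MvPolynomial (Fin (2 * n + 1)) ℂ →ₐ[ℂ] S),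
      f H = c.cross (fun l => algebraMap ℂ S (x l)) (fun l => f (MvPolynomial.X l)) k1 *
        (c.QMatrix (fun l => algebraMap ℂ S (x l)) (c.cross (fun l => algebraMap ℂ S (x l))
        (fun l => f (MvPolynomial.X l)))).crossProd k2 := by
    intro S _ _ f
    have h5 : f ∘ ξ = fun l => algebraMap ℂ S (x l) := by
      ext l
      exact f.commutes _
    have h6 := congrFun (c.map_cross f ξ MvPolynomial.X) k1
    have h7 := congrFun (c.map_crossProd_QMatrix_cross f ξ MvPolynomial.X) k2
    rw [h5] at h6 h7
    rw [map_mul]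
    exact congrArg₂ _ h6 h7
  have hHI : H ∉ homogIdeal X := fun h => by
    have := hγ H h
    rw [hH γ] at this
    exact mul_ne_zero hk1 hk2 this
  rw [mem_homogIdeal_iff] at hHI
  push Not at hHI
  obtain ⟨y, hy, hHy⟩ := hHI
  have h8 := hH (aeval y : MvPolynomial _ ℂ →ₐ[ℂ] ℂ)
  simp only [aeval_X, aeval_eq_eval] at h8
  have h9 : c.cross x y k1 * (c.QMatrix x (c.cross x y)).crossProd k2 ≠ 0 := by
    intro h; exact hHy (h8.trans h)
  exact ⟨x, hx, y, hy, fun h => left_ne_zero_of_mul h9 (congrFun h k1),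
    fun h => right_ne_zero_of_mul h9 (congrFun h k2)⟩

theorem diffMatrix_swap {R : Type*} [CommRing R] [Algebra ℂ R] (ξ η : Fin (2 * n + 1) → R) :
    c.diffMatrix η ξ = (-1 : R) • c.diffMatrix ξ η := by
  ext j i
  simp [diffMatrix]

theorem cross_swap {R : Type*} [CommRing R] [Algebra ℂ R] (ξ η : Fin (2 * n + 1) → R) :
    c.cross η ξ = (-1 : R) ^ n • c.cross ξ η := by
  rw [cross, diffMatrix_swap, crossProd_smul]
  rfl

variable (c) in
theorem eval_cross (x y : Vec (2 * n)) (k : Fin (n + 1)) :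
    eval (Sum.elim x y) (c.cross (xs _) (ys _) k) = c.cross x y k := by
  have := congrFun (c.map_cross (aeval (Sum.elim x y) : MvPolynomial _ ℂ →ₐ[ℂ] ℂ) (xs _) (ys _)) k
  rwa [aeval_comp_xs, aeval_comp_ys] at this

variable (c) in
/-- The product of the polynomials that have to be nonzero at a general pair `(x, y)`: `m(x)`,
`m(y)`, and one component each of `cross x y` and of the vectors of maximal minors of
`Q_x(·, cross x y)` and `Q_y(·, cross x y)`. -/
def genericPoly (k k₁ : Fin (n + 1)) :
    MvPolynomial (Fin (2 * n + 1) ⊕ Fin (2 * n + 1)) ℂ :=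
  aeval (xs _) c.m * aeval (ys _) c.m * c.cross (xs _) (ys _) k *
    (c.QMatrix (xs _) (c.cross (xs _) (ys _))).crossProd k₁ *
    (c.QMatrix (ys _) (c.cross (xs _) (ys _))).crossProd k₁

variable (c) in
theorem eval_genericPoly (k k₁ : Fin (n + 1)) (x y : Vec (2 * n)) :
    eval (Sum.elim x y) (c.genericPoly k k₁) = eval x c.m * eval y c.m * c.cross x y k *
      (c.QMatrix x (c.cross x y)).crossProd k₁ * (c.QMatrix y (c.cross x y)).crossProd k₁ := by
  have h0 := c.map_cross (aeval (Sum.elim x y) : MvPolynomial _ ℂ →ₐ[ℂ] ℂ) (xs _) (ys _)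
  have h1 := congrFun (c.map_crossProd_QMatrix (aeval (Sum.elim x y) : MvPolynomial _ ℂ →ₐ[ℂ] ℂ)
    (xs _) (c.cross (xs _) (ys _))) k₁
  have h2 := congrFun (c.map_crossProd_QMatrix (aeval (Sum.elim x y) : MvPolynomial _ ℂ →ₐ[ℂ] ℂ)
    (ys _) (c.cross (xs _) (ys _))) k₁
  rw [h0, aeval_comp_xs, aeval_comp_ys] at h1 h2
  simp only [genericPoly, map_mul, eval_cross, eval_aeval_xs, eval_aeval_ys]
  exact congrArg₂ _ (congrArg₂ _ rfl h1) h2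

theorem exists_eval_genericPoly_ne_zero (hX : IsSubvariety X) (hn : HasDimension X n)
    (hTan : tangentVariety X = Set.univ) (hm : c.m ∉ homogIdeal X) :
    ∃ k k₁, ∃ x ∈ affineCone X, ∃ y ∈ affineCone X,
      eval (Sum.elim x y) (c.genericPoly k k₁) ≠ 0 := by
  obtain ⟨x, hx, y, hy, h1, h2⟩ := exists_pair_crossProd_QMatrix_cross_ne_zero hX hn hTan hm
  obtain ⟨k, hk⟩ := Function.ne_iff.mp h1
  obtain ⟨k₁, hk₁⟩ := Function.ne_iff.mp h2
  have hm' := hm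
  rw [mem_homogIdeal_iff] at hm'
  push Not at hm'
  obtain ⟨z, hz, hmz⟩ := hm'
  let A := (c.QMatrix (xs _) (c.cross (xs _) (ys _))).crossProd k₁
  let B := (c.QMatrix (ys _) (c.cross (xs _) (ys _))).crossProd k₁
  have hA : ∀ x y, eval (Sum.elim x y) A = (c.QMatrix x (c.cross x y)).crossProd k₁ := fun x y => by
    have := congrFun (c.map_crossProd_QMatrix_cross
      (aeval (Sum.elim x y) : MvPolynomial _ ℂ →ₐ[ℂ] ℂ) (xs _) (ys _)) k₁
    rwa [aeval_comp_xs, aeval_comp_ys] at this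
  have hB : ∀ x y, eval (Sum.elim x y) B = (c.QMatrix y (c.cross x y)).crossProd k₁ := fun x y => by
    have h0 := c.map_cross (aeval (Sum.elim x y) : MvPolynomial _ ℂ →ₐ[ℂ] ℂ) (xs _) (ys _)
    have := congrFun (c.map_crossProd_QMatrix
      (aeval (Sum.elim x y) : MvPolynomial _ ℂ →ₐ[ℂ] ℂ) (ys _) (c.cross (xs _) (ys _))) k₁
    rwa [h0, aeval_comp_xs, aeval_comp_ys] at this
  obtain ⟨x1, hx1, y1, hy1, h3, h4⟩ := hX.exists_eval_pair_ne_zero hz hz hx hy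
    (F := aeval (xs _) c.m * aeval (ys _) c.m) (G := c.cross (xs _) (ys _) k * A)
    (by rw [map_mul, eval_aeval_xs, eval_aeval_ys]; exact mul_ne_zero hmz hmz)
    (by rw [map_mul, eval_cross, hA]; exact mul_ne_zero hk hk₁)
  obtain ⟨x2, hx2, y2, hy2, h5, h6⟩ := hX.exists_eval_pair_ne_zero hx1 hy1 hy hx
    (F := aeval (xs _) c.m * aeval (ys _) c.m * (c.cross (xs _) (ys _) k * A)) (G := B)
    (by rw [map_mul]; exact mul_ne_zero h3 h4)
    (by
      rw [hB, cross_swap, QMatrix_smul, crossProd_smul]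
      exact mul_ne_zero (pow_ne_zero _ (pow_ne_zero _ (neg_ne_zero.mpr one_ne_zero))) hk₁)
  refine ⟨k, k₁, x2, hx2, y2, hy2, ?_⟩
  have h7 := mul_ne_zero h5 h6
  rw [← map_mul] at h7
  convert h7 using 2
  simp only [genericPoly, A, B]
  ring

end TangentChart

end

/-! ### Dominance of the intersection map -/

section

variable {n : ℕ} {X : Set (PSpace (2 * n))}

namespace TangentChart
variable {c : TangentChart X}

section lift
variable {R : Type*} [CommRing R] [Algebra ℂ R]

variable (c) in
theorem lift_add (ξ : Fin (2 * n + 1) → R) (s t : Fin (n + 1) → R) :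
    c.lift ξ (s + t) = c.lift ξ s + c.lift ξ t := by
  refine c.funext_of_inl_inr (fun i => ?_) (fun j => ?_)
  · simp [mul_add]
  · simp [mul_add, Finset.sum_add_distrib]

variable (c) in
theorem lift_sum {ι : Type*} (ξ : Fin (2 * n + 1) → R) (a : ι → R) (s : ι → Fin (n + 1) → R)
    (t : Finset ι) : c.lift ξ (∑ i ∈ t, a i • s i) = ∑ i ∈ t, a i • c.lift ξ (s i) := by
  classical
  induction t using Finset.induction_on with
  | empty =>
    have := c.lift_smul ξ 0 0
    simpa using this
  | insert i t hi h => rw [Finset.sum_insert hi, Finset.sum_insert hi, lift_add, lift_smul, h]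

end lift

theorem m_mul_sum_M_mul_cross {R : Type*} [CommRing R] [Algebra ℂ R]
    (ξ η : Fin (2 * n + 1) → R) (j : Fin n) :
    aeval ξ c.m * ∑ k, aeval η (c.M j k) * c.cross ξ η k =
      aeval η c.m * ∑ k, aeval ξ (c.M j k) * c.cross ξ η k := by
  have := congrFun (mulVec_crossProd (c.diffMatrix ξ η)) j
  simp only [mulVec, dotProduct, diffMatrix, of_apply, sub_mul, Finset.sum_sub_distrib,
    Pi.zero_apply, sub_eq_zero] at this
  simp only [Finset.mul_sum, ← mul_assoc]
  exact this

/-- The tangent vectors at `ξ` and at `η` that belong to `cross ξ η` are proportional, so that they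
span the intersection of the tangent spaces. -/
theorem smul_lift_cross_swap {R : Type*} [CommRing R] [Algebra ℂ R] (ξ η : Fin (2 * n + 1) → R) :
    aeval ξ c.m • c.lift η (c.cross ξ η) = aeval η c.m • c.lift ξ (c.cross ξ η) := by
  refine c.funext_of_inl_inr (fun i => ?_) (fun j => ?_)
  · simp only [Pi.smul_apply, lift_inl, smul_eq_mul]
    ring
  · simp only [Pi.smul_apply, lift_inr, smul_eq_mul]
    exact m_mul_sum_M_mul_cross ξ η j

/-- If a form `F` vanishes at the points `P(x, y)` for all `y`, then `dF` vanishes on `T_x` at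
`P(x, y)`, provided that `Q_y(·, cross x y)` is onto.  Let `σᵢ` be the derivative of
`s = cross x y` in `y` along `c.D i`.  Differentiating `N s = 0` with `N = c.diffMatrix x y` gives
`m(y) N σᵢ = -m(x) Q_y(eᵢ, s)`.  So the vectors `N σᵢ` span `ℂ^n`, and the `σᵢ` together with `s`,
which spans the kernel of `N`, span `ℂ^{n+1}`. -/
theorem differential_lift_eq_zero (hX : IsSubvariety X) (hn : HasDimension X n)
    (hm : c.m ∉ homogIdeal X) {F : MvPolynomial (Fin (2 * n + 1)) ℂ} {d : ℕ}
    (hF : F.IsHomogeneous d) {x y : Vec (2 * n)}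
    (h : ∀ y ∈ affineCone X, eval (c.lift x (c.cross x y)) F = 0)
    (hy : y ∈ affineCone X) (hmx : eval x c.m ≠ 0) (hmy : eval y c.m ≠ 0)
    (hxy : c.cross x y ≠ 0) (hQ : (c.QMatrix y (c.cross x y)).crossProd ≠ 0) (w : Fin (n + 1) → ℂ) :
    differential F (c.lift x (c.cross x y)) (c.lift x w) = 0 := by
  set s := c.cross x y with hs
  set lam := differential F (c.lift x s) with hlam
  let ξ : Fin (2 * n + 1) → MvPolynomial (Fin (2 * n + 1)) ℂ := fun l => C (x l)
  let S : Fin (n + 1) → MvPolynomial (Fin (2 * n + 1)) ℂ := c.cross ξ MvPolynomial.X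
  have hξ : ∀ G, aeval ξ G = C (eval x G) := fun G =>
    (comp_aeval_apply x (Algebra.ofId ℂ (MvPolynomial (Fin (2 * n + 1)) ℂ)) G).symm
  have hS : ∀ y k, eval y (S k) = c.cross x y k := fun y k => by
    have := congrFun (c.map_cross (aeval y : MvPolynomial _ ℂ →ₐ[ℂ] ℂ) ξ MvPolynomial.X) k
    simp only [Function.comp_def, aeval_eq_eval, eval_X, ξ, eval_C] at this
    exact this
  have hL : ∀ y (t : Fin (n + 1) → MvPolynomial (Fin (2 * n + 1)) ℂ) l,
      eval y (c.lift ξ t l) = c.lift x (fun k => eval y (t k)) l := fun y t l => by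
    have := congrFun (c.map_lift ξ t (aeval y : MvPolynomial _ ℂ →ₐ[ℂ] ℂ)) l
    simp only [Function.comp_def, aeval_eq_eval, ξ, eval_C] at this
    exact this
  have hDL : ∀ i t l, c.D i (c.lift ξ t l) = c.lift ξ (fun k => c.D i (t k)) l := fun i t l => by
    obtain ⟨a | j, rfl⟩ := c.e.surjective l
    · simp only [lift_inl, hξ, Derivation.leibniz, derivation_C, mul_zero, add_zero, smul_eq_mul]
    · simp only [lift_inr, hξ, map_sum, Derivation.leibniz, derivation_C, mul_zero, add_zero,
        smul_eq_mul]
  let σ : Fin (n + 1) → Fin (n + 1) → ℂ := fun i k => eval y (c.D i (S k))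
  have hlamσ : ∀ i, lam (c.lift x (σ i)) = 0 := fun i => by
    have h1 : aeval (c.lift ξ S) F ∈ homogIdeal X := mem_homogIdeal_iff.mpr fun y hy => by
      rw [eval_aeval_eq]
      simp only [hL, hS]
      exact h y hy
    have h2 := mem_homogIdeal_iff.mp (D_mem_homogIdeal hX hn hm i h1) y hy
    rw [derivation_aeval] at h2
    have h3 := map_differential (aeval y : MvPolynomial _ ℂ →ₐ[ℂ] ℂ) F (c.lift ξ S)
      (fun l => c.D i (c.lift ξ S l))
    simp only [aeval_eq_eval, hDL, hL, hS] at h3 h2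
    exact h3.symm.trans h2
  -- Euler's identity
  have hlams : lam (c.lift x s) = 0 := by
    rw [hlam, differential_self hF, h y hy, mul_zero]
  have hN : ∀ i, c.diffMatrix x y *ᵥ σ i =
      (-(eval x c.m / eval y c.m)) • (c.QMatrix y s).col i := fun i => by
    ext j
    have h1 := congrFun (mulVec_crossProd (c.diffMatrix ξ MvPolynomial.X)) j
    have h2 := congrArg (fun G => eval y (c.D i G)) h1
    change eval y (c.D i (∑ k, c.diffMatrix ξ MvPolynomial.X j k * S k)) = eval y (c.D i 0) at h2
    rw [map_zero, map_zero, map_sum, map_sum] at h2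
    have h4 : ∀ k, eval y (c.D i (c.diffMatrix ξ MvPolynomial.X j k * S k)) =
        c.diffMatrix x y j k * σ i k + (eval x c.m * eval y (c.D i (c.M j k)) -
          eval y (c.D i c.m) * eval x (c.M j k)) * s k := fun k => by
      simp only [diffMatrix, of_apply, hξ, aeval_X_left, AlgHom.id_apply,
        Derivation.leibniz, map_sub, smul_eq_mul, map_add, map_mul, eval_C, hS, derivation_C,
        mul_zero, add_zero, zero_add, aeval_eq_eval, σ]
      change _ = (eval x c.m * eval y (c.M j k) - eval y c.m * eval x (c.M j k)) * _ + _
      ring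
    rw [Finset.sum_congr rfl fun k _ => h4 k, Finset.sum_add_distrib] at h2
    have h3 := m_mul_sum_M_mul_cross (c := c) x y j
    change eval x c.m * ∑ k, eval y (c.M j k) * s k =
      eval y c.m * ∑ k, eval x (c.M j k) * s k at h3
    have h5 : (c.diffMatrix x y *ᵥ σ i) j = ∑ k, c.diffMatrix x y j k * σ i k := rfl
    have h6 : (c.QMatrix y s).col i j = eval y c.m * ∑ k, eval y (c.D i (c.M j k)) * s k -
        eval y (c.D i c.m) * ∑ k, eval y (c.M j k) * s k := by
      change ∑ k, eval y (c.Q i j k) * s k = _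
      rw [Finset.mul_sum, Finset.mul_sum, ← Finset.sum_sub_distrib]
      refine Finset.sum_congr rfl fun k _ => ?_
      simp only [Q, of_apply, map_sub, map_mul]
      ring
    have h7 : ∑ k, (eval x c.m * eval y (c.D i (c.M j k)) -
          eval y (c.D i c.m) * eval x (c.M j k)) * s k =
        eval x c.m * ∑ k, eval y (c.D i (c.M j k)) * s k -
          eval y (c.D i c.m) * ∑ k, eval x (c.M j k) * s k := by
      rw [Finset.mul_sum, Finset.mul_sum, ← Finset.sum_sub_distrib]
      exact Finset.sum_congr rfl fun k _ => by ring
    rw [← h5, h7] at h2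
    rw [Pi.smul_apply, smul_eq_mul, h6]
    field_simp
    linear_combination eval y c.m * h2 - eval y (c.D i c.m) * h3
  -- `s` and the `σ i` span `ℂ^{n+1}`
  obtain ⟨a, ha⟩ := surjective_of_crossProd_ne_zero hQ
    ((-(eval x c.m / eval y c.m))⁻¹ • c.diffMatrix x y *ᵥ w)
  have hr0 : -(eval x c.m / eval y c.m) ≠ 0 := neg_ne_zero.mpr (div_ne_zero hmx hmy)
  have h1 : c.diffMatrix x y *ᵥ (w - ∑ i, a i • σ i) = 0 := by
    have h2 : c.diffMatrix x y *ᵥ (∑ i, a i • σ i) =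
        -(eval x c.m / eval y c.m) • (c.QMatrix y s *ᵥ a) := by
      rw [mulVec_sum]
      ext j
      simp only [mulVec_smul, hN, Finset.sum_apply, Pi.smul_apply, smul_eq_mul, mulVec, dotProduct,
        Finset.mul_sum, col_apply]
      exact Finset.sum_congr rfl fun i _ => by ring
    rw [mulVec_sub, h2]
    change c.QMatrix y s *ᵥ a = _ at ha
    rw [ha, smul_smul, mul_inv_cancel₀ hr0, one_smul, sub_self]
  obtain ⟨b, hb⟩ := exists_eq_smul_crossProd hxy h1
  have hw : w = b • s + ∑ i, a i • σ i := sub_eq_iff_eq_add.mp hb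
  rw [hw, lift_add, lift_smul, lift_sum, map_add, map_smul, hlams, map_sum]
  simp [hlamσ]

/-- Tangent spaces that intersect in a single line span the whole space. -/
theorem exists_lift_add_lift {x y : Vec (2 * n)} (hmy : eval y c.m ≠ 0)
    (hxy : c.cross x y ≠ 0) (v : Vec (2 * n)) : ∃ a b, v = c.lift x a + c.lift y b := by
  obtain ⟨a, ha⟩ := surjective_of_crossProd_ne_zero (N := c.diffMatrix x y) hxy
    (fun j => ∑ i, eval y (c.M j i) * v (c.e (.inl i)) - eval y c.m * v (c.e (.inr j)))
  refine ⟨a, fun i => (v (c.e (.inl i)) - eval x c.m * a i) / eval y c.m,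
    c.funext_of_inl_inr (fun i => ?_) (fun j => ?_)⟩
  · simp only [Pi.add_apply, lift_inl, aeval_eq_eval]
    change _ = eval x c.m * a i + eval y c.m * _
    field_simp
    ring
  · have h1 := congrFun ha j
    change ∑ i, (eval x c.m * eval y (c.M j i) - eval y c.m * eval x (c.M j i)) * a i = _ at h1
    have h2 : ∑ i, (eval x c.m * eval y (c.M j i) - eval y c.m * eval x (c.M j i)) * a i =
      eval x c.m * ∑ i, eval y (c.M j i) * a i - eval y c.m * ∑ i, eval x (c.M j i) * a i := by
      rw [Finset.mul_sum, Finset.mul_sum, ← Finset.sum_sub_distrib]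
      exact Finset.sum_congr rfl fun k _ => by ring
    rw [h2] at h1
    simp only [Pi.add_apply, lift_inr]
    change _ = ∑ i, eval x (c.M j i) * a i + ∑ i, eval y (c.M j i) * _
    have h3 : ∑ i, eval y (c.M j i) * ((v (c.e (.inl i)) - eval x c.m * a i) / eval y c.m) =
        (∑ i, eval y (c.M j i) * v (c.e (.inl i)) - eval x c.m * ∑ i, eval y (c.M j i) * a i) /
          eval y c.m := by
      rw [Finset.mul_sum, ← Finset.sum_sub_distrib, Finset.sum_div]
      exact Finset.sum_congr rfl fun k _ => by ring
    rw [h3]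
    field_simp
    linear_combination h1

/-- Dominance of `(x, y) ↦ P(x, y)`: a form that vanishes at all `P(x, y)` is zero.  Its partial
derivatives vanish there too, since `dF` vanishes on `T_x` and on `T_y`. -/
theorem eq_zero_of_eval_lift_cross_eq_zero (hX : IsSubvariety X) (hn : HasDimension X n)
    (hTan : tangentVariety X = Set.univ) (hm : c.m ∉ homogIdeal X)
    {F : MvPolynomial (Fin (2 * n + 1)) ℂ} {d : ℕ} (hF : F.IsHomogeneous d)
    (h : ∀ x ∈ affineCone X, ∀ y ∈ affineCone X, eval (c.lift x (c.cross x y)) F = 0) : F = 0 := by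
  induction d generalizing F with
  | zero =>
    have hF := totalDegree_eq_zero_iff_eq_C.mp (Nat.le_zero.mp hF.totalDegree_le)
    obtain ⟨z, hz⟩ := hX.isIrreducible.1
    have := h _ (rep_mem_affineCone hz) _ (rep_mem_affineCone hz)
    rw [hF, eval_C] at this
    rw [hF, this, C_0]
  | succ d ih =>
    have hp : ∀ l, pderiv l F = 0 := fun l => by
      refine ih hF.pderiv ?_
      by_contra! h0
      obtain ⟨x, hx, y, hy, h0⟩ := h0
      obtain ⟨k, k₁, x', hx', y', hy', h1⟩ := exists_eval_genericPoly_ne_zero hX hn hTan hm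
      let G := aeval (c.lift (xs _) (c.cross (xs _) (ys _))) (pderiv l F)
      have hG : ∀ x y, eval (Sum.elim x y) G = eval (c.lift x (c.cross x y)) (pderiv l F) :=
        fun x y => by
          have h3 := c.map_lift (xs _) (c.cross (xs _) (ys _))
            (aeval (Sum.elim x y) : MvPolynomial _ ℂ →ₐ[ℂ] ℂ)
          rw [c.map_cross, aeval_comp_xs, aeval_comp_ys] at h3
          rw [eval_aeval_eq, ← h3]
          rfl
      obtain ⟨u, hu, v, hv, h2, h3⟩ := hX.exists_eval_pair_ne_zero hx' hy' hx hy
        h1 (G := G) (by rw [hG]; exact h0)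
      rw [eval_genericPoly] at h2
      rw [hG] at h3
      simp only [mul_ne_zero_iff] at h2
      obtain ⟨⟨⟨⟨hmu, hmv⟩, hk⟩, hku⟩, hkv⟩ := h2
      have huv : c.cross u v ≠ 0 := fun h => hk (congrFun h k)
      have h4 := differential_lift_eq_zero hX hn hm hF (h u hu) hv hmu hmv huv
        (fun h => hkv (congrFun h k₁))
      have hpow : ((-1 : ℂ) ^ n) ≠ 0 := pow_ne_zero _ (neg_ne_zero.mpr one_ne_zero)
      have h5 := differential_lift_eq_zero hX hn hm hF (h v hv) hu hmv hmu
        (by rw [cross_swap]; exact smul_ne_zero hpow huv)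
        (by rw [cross_swap, QMatrix_smul, crossProd_smul]
            exact smul_ne_zero (pow_ne_zero _ hpow) (fun h => hku (congrFun h k₁)))
      have h6 : ∀ w, differential F (c.lift u (c.cross u v)) (c.lift v w) = 0 := fun w => by
        have h7 := h5 w
        have h8 := smul_lift_cross_swap (c := c) u v
        change eval u c.m • _ = eval v c.m • _ at h8
        rw [cross_swap, lift_smul, differential_smul_point hF, mul_eq_zero,
          or_iff_right (pow_ne_zero _ hpow)] at h7
        have h9 : c.lift u (c.cross u v) =
            ((eval v c.m)⁻¹ * eval u c.m) • c.lift v (c.cross u v) := by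
          rw [mul_smul, h8, smul_smul, inv_mul_cancel₀ hmv, one_smul]
        rw [h9, differential_smul_point hF, h7, mul_zero]
      obtain ⟨a, b, hab⟩ := exists_lift_add_lift hmv huv (Pi.single l 1)
      refine h3 ?_
      have h10 : differential F (c.lift u (c.cross u v)) (Pi.single l 1) = 0 := by
        rw [hab, map_add, h4, h6, add_zero]
      rw [differential_apply] at h10
      simpa [Pi.single_apply] using h10
    have h1 := hF.sum_X_mul_pderiv
    simp only [hp, mul_zero, Finset.sum_const_zero] at h1
    exact (smul_eq_zero.mp h1.symm).resolve_left (Nat.succ_ne_zero d)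

end TangentChart

end

/-! ### The rational map to the intersection point -/

section

section bihomogeneous
variable {N : ℕ}

theorem isBihomogeneous_aeval_xs {F : MvPolynomial (Fin (N + 1)) ℂ} {d : ℕ}
    (hF : F.IsHomogeneous d) : IsBihomogeneous (aeval (xs N) F) d 0 := by
  rw [aeval_def, eval₂_eq]
  refine IsWeightedHomogeneous.sum _ _ _ fun s hs => ?_
  have h1 : ((d, 0) : ℕ × ℕ) = 0 + ∑ i ∈ s.support, s i • (1, 0) := by
    rw [zero_add, ← Finset.sum_smul, ← hF (mem_support_iff.mp hs), Finsupp.weight_apply,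
      Finsupp.sum]
    simp
  rw [h1]
  refine (isWeightedHomogeneous_C _ _).mul (IsWeightedHomogeneous.prod _ _ _ fun i _ => ?_)
  exact (isWeightedHomogeneous_X _ _ _).pow _

theorem isBihomogeneous_aeval_ys {F : MvPolynomial (Fin (N + 1)) ℂ} {d : ℕ}
    (hF : F.IsHomogeneous d) : IsBihomogeneous (aeval (ys N) F) 0 d := by
  rw [aeval_def, eval₂_eq]
  refine IsWeightedHomogeneous.sum _ _ _ fun s hs => ?_
  have h1 : ((0, d) : ℕ × ℕ) = 0 + ∑ i ∈ s.support, s i • (0, 1) := by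
    rw [zero_add, ← Finset.sum_smul, ← hF (mem_support_iff.mp hs), Finsupp.weight_apply,
      Finsupp.sum]
    simp
  rw [h1]
  refine (isWeightedHomogeneous_C _ _).mul (IsWeightedHomogeneous.prod _ _ _ fun i _ => ?_)
  exact (isWeightedHomogeneous_X _ _ _).pow _

theorem eval_rep_mk_ne_zero_iff {F : MvPolynomial (Fin (N + 1)) ℂ} {d : ℕ} (hF : F.IsHomogeneous d)
    {v : Vec N} (hv : v ≠ 0) :
    eval (Projectivization.mk ℂ v hv).rep F ≠ 0 ↔ eval v F ≠ 0 := by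
  obtain ⟨a, ha, h⟩ := exists_smul_rep hv
  conv_rhs => rw [h, eval_smul_of_isHomogeneous hF]
  rw [mul_ne_zero_iff, and_iff_right (pow_ne_zero _ ha)]

theorem exists_homogeneous_ne_zero_point {F : MvPolynomial (Fin (N + 1)) ℂ} {d : ℕ}
    (hF : F.IsHomogeneous d) (hF0 : F ≠ 0) : ∃ P : PSpace N, eval P.rep F ≠ 0 := by
  obtain ⟨v, hv⟩ : ∃ v, eval v (F * MvPolynomial.X 0) ≠ 0 := by
    by_contra! h0
    exact mul_ne_zero hF0 (X_ne_zero 0) (MvPolynomial.funext fun v => by rw [h0, map_zero])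
  rw [map_mul, eval_X] at hv
  have hv0 : v ≠ 0 := fun h => right_ne_zero_of_mul hv (congrFun h 0)
  exact ⟨Projectivization.mk ℂ v hv0, (eval_rep_mk_ne_zero_iff hF hv0).mpr (left_ne_zero_of_mul hv)⟩

theorem submodule_le_iff_rep_mem {Q : PSpace N} {T : Submodule ℂ (Vec N)} :
    Q.submodule ≤ T ↔ Q.rep ∈ T := by
  rw [Projectivization.submodule_eq, Submodule.span_singleton_le_iff_mem]

theorem eq_mk_of_rep_eq_smul {Q : PSpace N} {v : Vec N} (hv : v ≠ 0) {b : ℂ} (h : Q.rep = b • v) :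
    Q = Projectivization.mk ℂ v hv := by
  rw [← Q.mk_rep, Projectivization.mk_eq_mk_iff']
  exact ⟨b, h.symm⟩

end bihomogeneous

variable {n : ℕ} {X : Set (PSpace (2 * n))}

namespace TangentChart
variable {c : TangentChart X}

variable (c) in
theorem cross_isBihomogeneous (k : Fin (n + 1)) :
    IsBihomogeneous (c.cross (xs _) (ys _) k) (n * c.deg) (n * c.deg) := by
  have h1 : ∀ j i, IsWeightedHomogeneous (Sum.elim (fun _ => ((1, 0) : ℕ × ℕ)) (fun _ => (0, 1)))
      (c.diffMatrix (xs (2 * n)) (ys (2 * n)) j i) (c.deg, c.deg) := fun j i => by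
    refine IsWeightedHomogeneous.sub ?_ ?_
    · have := (isBihomogeneous_aeval_xs c.m_isHomogeneous).mul
        (isBihomogeneous_aeval_ys (c.M_isHomogeneous j i))
      simpa using this
    · have := (isBihomogeneous_aeval_ys c.m_isHomogeneous).mul
        (isBihomogeneous_aeval_xs (c.M_isHomogeneous j i))
      simpa using this
  have h2 := isWeightedHomogeneous_det
    (A := (c.diffMatrix (xs (2 * n)) (ys (2 * n))).submatrix id k.succAbove) (fun j i => h1 _ _)
  have h3 := (isWeightedHomogeneous_C (Sum.elim (fun _ => ((1, 0) : ℕ × ℕ)) (fun _ => (0, 1)))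
    ((-1 : ℂ) ^ (k : ℕ))).mul h2
  rw [IsBihomogeneous]
  convert h3 using 1
  · simp [cross, crossProd]
  · simp

variable (c) in
/-- The bihomogeneous polynomials that give a representative of the intersection point `P(x, y)` of
the tangent spaces at `x` and `y`. -/
def meet : Fin (2 * n + 1) → MvPolynomial (Fin (2 * n + 1) ⊕ Fin (2 * n + 1)) ℂ :=
  c.lift (xs _) (c.cross (xs _) (ys _))

variable (c) in
theorem meet_isBihomogeneous (l : Fin (2 * n + 1)) :
    IsBihomogeneous (c.meet l) (c.deg + n * c.deg) (n * c.deg) := by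
  obtain ⟨i | j, rfl⟩ := c.e.surjective l
  · rw [meet, lift_inl]
    have := (isBihomogeneous_aeval_xs c.m_isHomogeneous).mul (c.cross_isBihomogeneous i)
    simpa [IsBihomogeneous] using this
  · rw [meet, lift_inr]
    refine IsWeightedHomogeneous.sum _ _ _ fun i _ => ?_
    have := (isBihomogeneous_aeval_xs (c.M_isHomogeneous j i)).mul (c.cross_isBihomogeneous i)
    simpa [IsBihomogeneous] using this

variable (c) in
theorem eval_meet (x y : Vec (2 * n)) (l : Fin (2 * n + 1)) :
    eval (Sum.elim x y) (c.meet l) = c.lift x (c.cross x y) l := by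
  have h := congrFun (c.map_lift (xs _) (c.cross (xs _) (ys _))
    (aeval (Sum.elim x y) : MvPolynomial _ ℂ →ₐ[ℂ] ℂ)) l
  rwa [c.map_cross, aeval_comp_xs, aeval_comp_ys] at h

theorem lift_cross_ne_zero {x y : Vec (2 * n)} (hmx : eval x c.m ≠ 0) (hxy : c.cross x y ≠ 0) :
    c.lift x (c.cross x y) ≠ 0 := fun h => hxy (funext fun i => by
  have := congrFun h (c.e (.inl i))
  rw [lift_inl] at this
  exact (mul_eq_zero.mp this).resolve_left hmx)

theorem mem_tangentAt_and_iff (hX : IsSubvariety X) (hn : HasDimension X n) {x y : Vec (2 * n)}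
    (hx : x ∈ affineCone X) (hy : y ∈ affineCone X) (hmx : eval x c.m ≠ 0) (hmy : eval y c.m ≠ 0)
    (hxy : c.cross x y ≠ 0) (w : Vec (2 * n)) :
    w ∈ tangentAt X x ∧ w ∈ tangentAt X y ↔ ∃ b : ℂ, w = b • c.lift x (c.cross x y) := by
  constructor
  · rintro ⟨h1, h2⟩
    have h3 : c.diffMatrix x y *ᵥ (fun i => w (c.e (.inl i))) = 0 := by
      ext j
      have h4 := (c.mem_tangentAt_iff hX hn hx hmx w).mp h1 j
      have h5 := (c.mem_tangentAt_iff hX hn hy hmy w).mp h2 j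
      change ∑ i, (eval x c.m * eval y (c.M j i) - eval y c.m * eval x (c.M j i)) * _ = 0
      simp only [sub_mul, Finset.sum_sub_distrib, mul_assoc, ← Finset.mul_sum]
      rw [← h4, ← h5]
      ring
    obtain ⟨b, hb⟩ := exists_eq_smul_crossProd hxy h3
    refine ⟨(eval x c.m)⁻¹ * b, ?_⟩
    have h4 := smul_eq_lift_of_mem_tangentAt (c := c) h1
    rw [hb] at h4
    change _ = c.lift x (b • c.cross x y) at h4
    rw [lift_smul] at h4
    rw [mul_smul, ← h4, smul_smul, inv_mul_cancel₀ hmx, one_smul]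
  · rintro ⟨b, rfl⟩
    refine ⟨Submodule.smul_mem _ _ (lift_mem_tangentAt hX hn hx hmx _),
      Submodule.smul_mem _ _ ?_⟩
    have h1 := smul_lift_cross_swap (c := c) x y
    rw [← Submodule.smul_mem_iff _ hmy]
    change eval x c.m • _ = eval y c.m • _ at h1
    rw [← h1]
    exact Submodule.smul_mem _ _ (lift_mem_tangentAt hX hn hy hmy _)

theorem finrank_tangentAt (hX : IsSubvariety X) (hn : HasDimension X n) {v : Vec (2 * n)}
    (hv : v ∈ affineCone X) (hm : eval v c.m ≠ 0) :
    Module.finrank ℂ (tangentAt X v) = n + 1 := by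
  refine le_antisymm ?_ (hX.le_finrank_tangentAt hn hv)
  let L : (Fin (n + 1) → ℂ) →ₗ[ℂ] Vec (2 * n) :=
    { toFun := c.lift v
      map_add' := c.lift_add v
      map_smul' := fun a s => c.lift_smul v s a }
  have h1 : tangentAt X v ≤ LinearMap.range L := fun w hw => by
    rw [← Submodule.smul_mem_iff _ hm, smul_eq_lift_of_mem_tangentAt hw]
    exact ⟨_, rfl⟩
  refine (Submodule.finrank_mono h1).trans ((LinearMap.finrank_range_le L).trans ?_)
  rw [Module.finrank_fin_fun]

theorem mem_smoothLocus (hX : IsSubvariety X) (hn : HasDimension X n) {x : PSpace (2 * n)}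
    (hx : x ∈ X) (hm : eval x.rep c.m ≠ 0) : x ∈ smoothLocus X := by
  refine ⟨hx, ?_⟩
  rw [coneTangentSpace_eq, finrank_tangentAt hX hn (rep_mem_affineCone hx) hm, hn]
  rfl

end TangentChart

theorem IsSubvariety.exists_evalPair_ne_zero {N : ℕ} {X : Set (PSpace N)} (hX : IsSubvariety X)
    {F G : MvPolynomial (Fin (N + 1) ⊕ Fin (N + 1)) ℂ} {d e d' e' : ℕ}
    (hF : IsBihomogeneous F d e) (hG : IsBihomogeneous G d' e') {u v u' v' : Vec N}
    (hu : u ∈ affineCone X) (hv : v ∈ affineCone X) (hu' : u' ∈ affineCone X)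
    (hv' : v' ∈ affineCone X) (hF0 : eval (Sum.elim u v) F ≠ 0)
    (hG0 : eval (Sum.elim u' v') G ≠ 0) :
    ∃ p ∈ X ×ˢ X, evalPair p F ≠ 0 ∧ evalPair p G ≠ 0 := by
  obtain ⟨s, hs, t, ht, h1, h2⟩ := hX.exists_eval_pair_ne_zero hu hv hu' hv' hF0 hG0
  obtain ⟨x, hx, a, rfl⟩ := mem_affineCone_iff.mp hs
  obtain ⟨y, hy, b, rfl⟩ := mem_affineCone_iff.mp ht
  rw [eval_smul_of_isBihomogeneous hF] at h1
  rw [eval_smul_of_isBihomogeneous hG] at h2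
  exact ⟨(x, y), ⟨hx, hy⟩, right_ne_zero_of_mul h1, right_ne_zero_of_mul h2⟩

namespace TangentChart

variable (c : TangentChart X)

/-- The bihomogeneous polynomial `m(x) m(y) cross(x, y)_k`. -/
def domainPoly (k : Fin (n + 1)) : MvPolynomial (Fin (2 * n + 1) ⊕ Fin (2 * n + 1)) ℂ :=
  aeval (xs _) c.m * aeval (ys _) c.m * c.cross (xs _) (ys _) k

theorem eval_domainPoly (k : Fin (n + 1)) (x y : Vec (2 * n)) :
    eval (Sum.elim x y) (c.domainPoly k) = eval x c.m * eval y c.m * c.cross x y k := by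
  simp only [domainPoly, map_mul, eval_cross, eval_aeval_xs, eval_aeval_ys]

theorem domainPoly_isBihomogeneous (k : Fin (n + 1)) :
    IsBihomogeneous (c.domainPoly k) (c.deg + n * c.deg) (c.deg + n * c.deg) := by
  have := ((isBihomogeneous_aeval_xs c.m_isHomogeneous).mul
    (isBihomogeneous_aeval_ys c.m_isHomogeneous)).mul (c.cross_isBihomogeneous k)
  rw [IsBihomogeneous, domainPoly]
  convert this using 1
  simp

/-- The open set of pairs of points of the chart at which the `k`-th component of `cross` does not
vanish. -/
def meetDomain (k : Fin (n + 1)) : Set (PSpace (2 * n) × PSpace (2 * n)) :=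
  {p | evalPair p (c.domainPoly k) ≠ 0} ∩ X ×ˢ X

open Classical in
/-- The point `P(x, y)`.  The value `x` where the polynomials `c.meet` all vanish is arbitrary; this
does not happen on `c.meetDomain k`. -/
def meetPoint (p : PSpace (2 * n) × PSpace (2 * n)) : PSpace (2 * n) :=
  if h : (fun l => evalPair p (c.meet l)) ≠ 0 then Projectivization.mk ℂ _ h else p.1

variable {c}

theorem meetPoint_eq {p : PSpace (2 * n) × PSpace (2 * n)}
    (h : (fun l => evalPair p (c.meet l)) ≠ 0) : c.meetPoint p = Projectivization.mk ℂ _ h :=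
  dif_pos h

variable {k : Fin (n + 1)}

theorem of_mem_meetDomain {x y : PSpace (2 * n)} (hp : (x, y) ∈ c.meetDomain k) :
    x ∈ X ∧ y ∈ X ∧ eval x.rep c.m ≠ 0 ∧ eval y.rep c.m ≠ 0 ∧ c.cross x.rep y.rep ≠ 0 := by
  obtain ⟨hp, hpX⟩ := hp
  have h1 : eval (Sum.elim x.rep y.rep) (c.domainPoly k) ≠ 0 := hp
  rw [eval_domainPoly, mul_ne_zero_iff, mul_ne_zero_iff] at h1
  exact ⟨hpX.1, hpX.2, h1.1.1, h1.1.2, fun h => h1.2 (congrFun h k)⟩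

variable (c) in
theorem evalPair_meet (x y : PSpace (2 * n)) :
    (fun l => evalPair (x, y) (c.meet l)) = c.lift x.rep (c.cross x.rep y.rep) := by
  funext l
  exact c.eval_meet x.rep y.rep l

theorem evalPair_meet_ne_zero {p : PSpace (2 * n) × PSpace (2 * n)} (hp : p ∈ c.meetDomain k) :
    (fun l => evalPair p (c.meet l)) ≠ 0 := by
  obtain ⟨-, -, h1, -, h2⟩ := of_mem_meetDomain hp
  rw [evalPair_meet]
  exact lift_cross_ne_zero h1 h2

theorem meetDomain_subset (hX : IsSubvariety X) (hn : HasDimension X n) :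
    c.meetDomain k ⊆ smoothLocus X ×ˢ smoothLocus X := fun p hp => by
  obtain ⟨h1, h2, h3, h4, -⟩ := of_mem_meetDomain hp
  exact ⟨mem_smoothLocus hX hn h1 h3, mem_smoothLocus hX hn h2 h4⟩

theorem projTangentSpace_inter (hX : IsSubvariety X) (hn : HasDimension X n)
    {x y : PSpace (2 * n)} (hp : (x, y) ∈ c.meetDomain k) :
    projTangentSpace X x ∩ projTangentSpace X y = {c.meetPoint (x, y)} := by
  obtain ⟨h1, h2, h3, h4, h5⟩ := of_mem_meetDomain hp
  have h6 := mem_tangentAt_and_iff hX hn (rep_mem_affineCone h1) (rep_mem_affineCone h2) h3 h4 h5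
  have h0 := evalPair_meet_ne_zero hp
  rw [← evalPair_meet] at h6
  rw [meetPoint_eq h0]
  generalize (fun l => evalPair (x, y) (c.meet l)) = P at h0 h6
  ext Q
  simp only [projTangentSpace, Set.mem_inter_iff, Set.mem_ofPred_eq, submodule_le_iff_rep_mem,
    coneTangentSpace_eq, Set.mem_singleton_iff]
  refine (h6 Q.rep).trans ⟨fun ⟨b, hb⟩ => eq_mk_of_rep_eq_smul h0 hb, fun hQ => ?_⟩
  obtain ⟨a, ha, hav⟩ := exists_smul_rep h0
  refine ⟨a⁻¹, ?_⟩
  rw [hQ]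
  conv_rhs => rw [hav]
  rw [smul_smul, inv_mul_cancel₀ ha, one_smul]

theorem isRationalMapOn_meetPoint (hX : IsSubvariety X) {u v : Vec (2 * n)}
    (hu : u ∈ affineCone X) (hv : v ∈ affineCone X)
    (h0 : eval (Sum.elim u v) (c.domainPoly k) ≠ 0) :
    IsRationalMapOn (X ×ˢ X) (c.meetDomain k) c.meetPoint := by
  let _ := zariskiProd (2 * n)
  refine ⟨⟨_, (isTopologicalBasis_zariskiProd _).isOpen
    ⟨_, _, _, c.domainPoly_isBihomogeneous k, rfl⟩, rfl⟩, fun p hp => ?_, fun p hp => ?_⟩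
  · rw [(isTopologicalBasis_zariskiProd _).mem_closure_iff]
    rintro _ ⟨d, e, G, hGh, rfl⟩ hpG
    obtain ⟨q, hq, h1, h2⟩ := hX.exists_evalPair_ne_zero hGh (c.domainPoly_isBihomogeneous k)
      (rep_mem_affineCone hp.1) (rep_mem_affineCone hp.2) hu hv hpG h0
    exact ⟨q, h1, h2, hq⟩
  · exact ⟨_, _, c.meet, c.meet_isBihomogeneous, evalPair_meet_ne_zero hp,
      fun q _ h => meetPoint_eq h⟩

theorem isDominantOn_meetPoint (hX : IsSubvariety X) (hn : HasDimension X n)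
    (hTan : tangentVariety X = Set.univ) (hm : c.m ∉ homogIdeal X) {u v : Vec (2 * n)}
    (hu : u ∈ affineCone X) (hv : v ∈ affineCone X)
    (h0 : eval (Sum.elim u v) (c.domainPoly k) ≠ 0) :
    IsDominantOn (c.meetDomain k) c.meetPoint := by
  let _ := zariski (2 * n)
  rw [IsDominantOn, Set.eq_univ_iff_forall]
  intro P
  rw [(isTopologicalBasis_zariski _).mem_closure_iff]
  rintro _ ⟨d, F, hF, rfl⟩ hPF
  have hF0 : F ≠ 0 := by
    rintro rfl
    exact hPF (map_zero _)
  obtain ⟨x, hx, y, hy, hxy⟩ : ∃ x ∈ affineCone X, ∃ y ∈ affineCone X,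
      eval (c.lift x (c.cross x y)) F ≠ 0 := by
    by_contra! h
    exact hF0 (eq_zero_of_eval_lift_cross_eq_zero hX hn hTan hm hF h)
  have hH : ∀ x y, eval (Sum.elim x y) (aeval c.meet F) = eval (c.lift x (c.cross x y)) F :=
    fun x y => by simp only [eval_aeval_eq, eval_meet]
  obtain ⟨s, hs, t, ht, h1, h2⟩ := hX.exists_eval_pair_ne_zero (F := aeval c.meet F)
    hx hy hu hv (by rw [hH]; exact hxy) h0
  obtain ⟨x', hx', a, rfl⟩ := mem_affineCone_iff.mp hs
  obtain ⟨y', hy', b, rfl⟩ := mem_affineCone_iff.mp ht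
  rw [eval_smul_of_isBihomogeneous (c.domainPoly_isBihomogeneous k)] at h2
  have hp : (x', y') ∈ c.meetDomain k := ⟨right_ne_zero_of_mul h2, hx', hy'⟩
  refine ⟨c.meetPoint (x', y'), ?_, _, hp, rfl⟩
  rw [Set.mem_ofPred_eq, meetPoint_eq (evalPair_meet_ne_zero hp), eval_rep_mk_ne_zero_iff hF]
  rw [eval_aeval_eq] at h1
  simp only [eval_smul_of_isBihomogeneous (c.meet_isBihomogeneous _)] at h1
  have h3 := eval_smul_of_isHomogeneous hF (a ^ (c.deg + n * c.deg) * b ^ (n * c.deg))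
    (fun l => evalPair (x', y') (c.meet l))
  have h4 : eval ((a ^ (c.deg + n * c.deg) * b ^ (n * c.deg)) •
    (fun l => evalPair (x', y') (c.meet l))) F ≠ 0 := h1
  rw [h3] at h4
  exact right_ne_zero_of_mul h4

end TangentChart

theorem exists_isRationalMapOn_isDominantOn (hX : IsSubvariety X) (hn : HasDimension X n)
    (hTan : tangentVariety X = Set.univ) :
    ∃ (U : Set (PSpace (2 * n) × PSpace (2 * n)))
      (φ : PSpace (2 * n) × PSpace (2 * n) → PSpace (2 * n)),
      U ⊆ smoothLocus X ×ˢ smoothLocus X ∧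
      (∀ x y, (x, y) ∈ U → projTangentSpace X x ∩ projTangentSpace X y = {φ (x, y)}) ∧
      IsRationalMapOn (X ×ˢ X) U φ ∧ IsDominantOn U φ := by
  obtain ⟨c, hm⟩ := exists_tangentChart_notMem hn hTan
  obtain ⟨k, k₁, u, hu, v, hv, huv⟩ := TangentChart.exists_eval_genericPoly_ne_zero hX hn hTan hm
  have h0 : eval (Sum.elim u v) (c.domainPoly k) ≠ 0 := by
    rw [TangentChart.eval_genericPoly] at huv
    rw [TangentChart.eval_domainPoly]
    exact left_ne_zero_of_mul (left_ne_zero_of_mul huv)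
  exact ⟨c.meetDomain k, c.meetPoint, TangentChart.meetDomain_subset hX hn,
    fun x y => TangentChart.projTangentSpace_inter hX hn,
    TangentChart.isRationalMapOn_meetPoint hX hu hv h0,
    TangentChart.isDominantOn_meetPoint hX hn hTan hm hu hv h0⟩

end

/-! ### Recovering the centre from the ramification locus -/

section

/-- The projection from `P ≠ x` ramifies at `x` if and only if `P` lies in the projective tangent
space at `x`. -/
theorem mem_ramificationLocus_iff {N : ℕ} {X : Set (PSpace N)} {P x : PSpace N} (hx : x ∈ X) :
    x ∈ ramificationLocus X P ↔ x ≠ P ∧ P.rep ∈ coneTangentSpace X x := by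
  have hxT : x.rep ∈ coneTangentSpace X x := by
    rw [coneTangentSpace_eq]
    exact self_mem_tangentAt (rep_mem_affineCone hx)
  simp only [ramificationLocus, Set.mem_ofPred_eq, hx, true_and]
  refine and_congr_right fun hxP => ?_
  rw [← LinearMap.ker_eq_bot, LinearMap.ker_eq_bot', not_iff_comm]
  constructor
  · rintro hP ⟨_, w, hw, rfl⟩ h0
    have h1 : P.submodule.mkQ w ∈ x.submodule.map P.submodule.mkQ :=
      (Submodule.Quotient.mk_eq_zero _).mp h0
    obtain ⟨z, hz, hzw⟩ := h1
    rw [← sub_eq_zero, ← map_sub, Submodule.mkQ_apply, Submodule.Quotient.mk_eq_zero,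
      P.submodule_eq, Submodule.mem_span_singleton] at hzw
    obtain ⟨b, hb⟩ := hzw
    have hz' : z ∈ coneTangentSpace X x := submodule_le_iff_rep_mem.mpr hxT hz
    have hb0 : b = 0 := by
      by_contra hb0
      exact hP ((Submodule.smul_mem_iff _ hb0).mp (hb ▸ Submodule.sub_mem _ hz' hw))
    rw [hb0, zero_smul, eq_comm, sub_eq_zero] at hb
    exact Subtype.ext ((Submodule.Quotient.mk_eq_zero _).mpr (hb ▸ hz))
  · intro h hP
    have h1 := h ⟨_, P.rep, hP, rfl⟩ (by
      change projectionDifferential P x (x.submodule.mkQ P.rep) = 0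
      have h2 : P.submodule.mkQ P.rep = 0 := (Submodule.Quotient.mk_eq_zero _).mpr
        (submodule_le_iff_rep_mem.mp le_rfl)
      change (x.submodule.map P.submodule.mkQ).mkQ (P.submodule.mkQ P.rep) = 0
      rw [h2, map_zero])
    have h2 : P.rep ∈ x.submodule := (Submodule.Quotient.mk_eq_zero _).mp (congrArg Subtype.val h1)
    rw [x.submodule_eq, Submodule.mem_span_singleton] at h2
    obtain ⟨a, ha⟩ := h2
    refine hxP ?_
    rw [eq_mk_of_rep_eq_smul x.rep_nonzero ha.symm, x.mk_rep]

variable {n : ℕ} {X : Set (PSpace (2 * n))}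

namespace TangentChart
variable {c : TangentChart X}

/-- A tangent vector at `v` whose second fundamental form has full rank is not proportional to `v`,
because `Q_v(·, v) = 0`.  For `n = 0` the empty matrix has full rank. -/
theorem lift_ne_smul_self (hX : IsSubvariety X) (hn : HasDimension X n)
    (hm : c.m ∉ homogIdeal X) (hn0 : n ≠ 0) {v : Vec (2 * n)} (hv : v ∈ affineCone X)
    (hmv : eval v c.m ≠ 0) {s : Fin (n + 1) → ℂ} (hs : (c.QMatrix v s).crossProd ≠ 0) (t : ℂ) :
    c.lift v s ≠ t • v := by
  intro h
  have h1 : s = (t / eval v c.m) • fun i => v (c.e (.inl i)) := by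
    ext i
    have h2 := congrFun h (c.e (.inl i))
    rw [lift_inl, aeval_eq_eval, Pi.smul_apply, smul_eq_mul] at h2
    change eval v c.m * s i = _ at h2
    rw [Pi.smul_apply, smul_eq_mul]
    field_simp
    linear_combination h2
  refine hs ?_
  rw [h1, QMatrix_smul, QMatrix_self hX hn hm hv, crossProd_smul]
  have h3 : (0 : Matrix (Fin n) (Fin (n + 1)) ℂ) = (0 : ℂ) • 0 := by simp
  rw [h3, crossProd_smul, zero_pow hn0, zero_smul, smul_zero]

/-- A point `P = P(x, y)` with `(x, y)` general is determined by its ramification locus: `x` and `y`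
belong to it. -/
theorem eq_of_ramificationLocus_eq (hX : IsSubvariety X) (hn : HasDimension X n)
    (hm : c.m ∉ homogIdeal X) (hn0 : n ≠ 0) {x y : Vec (2 * n)} (hx : x ∈ affineCone X)
    (hy : y ∈ affineCone X) (hx0 : x ≠ 0) (hy0 : y ≠ 0) (hmx : eval x c.m ≠ 0)
    (hmy : eval y c.m ≠ 0) (hxy : c.cross x y ≠ 0)
    (hQx : (c.QMatrix x (c.cross x y)).crossProd ≠ 0)
    (hQy : (c.QMatrix y (c.cross x y)).crossProd ≠ 0) {P Q : PSpace (2 * n)} {a : ℂ} (ha : a ≠ 0)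
    (hP : P.rep = a • c.lift x (c.cross x y))
    (hPQ : ramificationLocus X Q = ramificationLocus X P) : Q = P := by
  have h0 := lift_cross_ne_zero hmx hxy
  have hiff := mem_tangentAt_and_iff hX hn hx hy hmx hmy hxy
  have hPT := (hiff P.rep).mpr ⟨a, hP⟩
  have hT : ∀ {v : Vec (2 * n)} (h : v ≠ 0),
      coneTangentSpace X (Projectivization.mk ℂ v h) = tangentAt X v := fun {v} h => by
    obtain ⟨b, hb, hv⟩ := exists_smul_rep h
    rw [coneTangentSpace_eq]
    conv_rhs => rw [hv, tangentAt_smul hb]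
  -- a point of `X` whose tangent space contains `P` ramifies, unless it is `P` itself
  have hQT : ∀ {v : Vec (2 * n)}, v ∈ affineCone X → v ≠ 0 → eval v c.m ≠ 0 →
      (c.QMatrix v (c.cross x y)).crossProd ≠ 0 → P.rep ∈ tangentAt X v →
      (∃ r : ℂ, c.lift v (c.cross x y) = r • P.rep) → Q.rep ∈ tangentAt X v := by
    rintro v hv hv0 hmv hQv hPv ⟨r, hr⟩
    have h1 := mk_mem_of_mem_affineCone hv hv0
    have h2 : Projectivization.mk ℂ v hv0 ∈ ramificationLocus X P := by
      rw [mem_ramificationLocus_iff h1, hT]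
      refine ⟨fun h => ?_, hPv⟩
      obtain ⟨b, hb, hvb⟩ := exists_smul_rep hv0
      rw [h] at hvb
      refine lift_ne_smul_self hX hn hm hn0 hv hmv hQv (r * b⁻¹) ?_
      rw [hr]
      conv_rhs => rw [hvb]
      rw [smul_smul, inv_mul_cancel_right₀ hb]
    rw [← hPQ, mem_ramificationLocus_iff h1, hT] at h2
    exact h2.2
  have hr1 : c.lift x (c.cross x y) = a⁻¹ • P.rep := by
    rw [hP, smul_smul, inv_mul_cancel₀ ha, one_smul]
  have hr2 : c.lift y (c.cross x y) = ((eval x c.m)⁻¹ * eval y c.m * a⁻¹) • P.rep := by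
    rw [mul_smul, ← hr1, mul_smul]
    have := smul_lift_cross_swap (c := c) x y
    change eval x c.m • _ = eval y c.m • _ at this
    rw [← this, smul_smul, inv_mul_cancel₀ hmx, one_smul]
  obtain ⟨b, hb⟩ := (hiff Q.rep).mp ⟨hQT hx hx0 hmx hQx hPT.1 ⟨_, hr1⟩,
    hQT hy hy0 hmy hQy hPT.2 ⟨_, hr2⟩⟩
  rw [eq_mk_of_rep_eq_smul h0 hb, eq_mk_of_rep_eq_smul h0 hP]

/-- The points `P(x, y)` with `(x, y)` general contain a nonempty open subset of `ℙ^{2n}`. -/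
theorem exists_form_forall_exists_pair (hX : IsSubvariety X) (hn : HasDimension X n)
    (hTan : tangentVariety X = Set.univ) (hm : c.m ∉ homogIdeal X) :
    ∃ (d : ℕ) (H : MvPolynomial (Fin (2 * n + 1)) ℂ), H.IsHomogeneous d ∧ H ≠ 0 ∧
      ∀ P : PSpace (2 * n), eval P.rep H ≠ 0 → ∃ x ∈ affineCone X, ∃ y ∈ affineCone X,
        x ≠ 0 ∧ y ≠ 0 ∧ (∃ k k₁, eval (Sum.elim x y) (c.genericPoly k k₁) ≠ 0) ∧
        ∃ a : ℂ, a ≠ 0 ∧ P.rep = a • c.lift x (c.cross x y) := by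
  obtain ⟨k, k₁, u, hu, v, hv, huv⟩ := exists_eval_genericPoly_ne_zero hX hn hTan hm
  obtain ⟨z, hz⟩ := hX.isIrreducible.1
  obtain ⟨l, hl⟩ := Function.ne_iff.mp z.rep_nonzero
  let Lx : MvPolynomial (Fin (2 * n + 1) ⊕ Fin (2 * n + 1)) ℂ := xs _ l
  let Ly : MvPolynomial (Fin (2 * n + 1) ⊕ Fin (2 * n + 1)) ℂ := ys _ l
  have hLx : ∀ x y, eval (Sum.elim x y) Lx = x l := fun x y => by simp [Lx, xs]
  have hLy : ∀ x y, eval (Sum.elim x y) Ly = y l := fun x y => by simp [Ly, ys]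
  obtain ⟨u', hu', v', hv', h1, h2⟩ := hX.exists_eval_pair_ne_zero hu hv
    (rep_mem_affineCone hz) (rep_mem_affineCone hz) (F := c.genericPoly k k₁) (G := Lx * Ly) huv
    (by rw [map_mul, hLx, hLy]; exact mul_ne_zero hl hl)
  -- the factors `x_l` and `y_l` guarantee `x ≠ 0` and `y ≠ 0`
  let g := c.genericPoly k k₁ * (Lx * Ly)
  have hg0 : eval (Sum.elim u' v') g ≠ 0 := by
    rw [map_mul]
    exact mul_ne_zero h1 h2
  let Z : Set (Fin (2 * n + 1) ⊕ Fin (2 * n + 1) → ℂ) :=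
    {p | p ∘ Sum.inl ∈ affineCone X ∧ p ∘ Sum.inr ∈ affineCone X}
  have hZ : zeroLocus ℂ (vanishingIdeal ℂ Z) ⊆ Z := by
    intro p hp
    refine ⟨hX.zeroLocus_subset fun F hF => ?_, hX.zeroLocus_subset fun F hF => ?_⟩
    · have h3 : aeval (xs _) F ∈ vanishingIdeal ℂ Z := by
        rw [mem_vanishingIdeal_iff]
        intro q hq
        rw [← Sum.elim_comp_inl_inr q]
        exact (eval_aeval_xs F _ _).trans (mem_homogIdeal_iff.mp hF _ hq.1)
      have h4 := hp _ h3
      rw [← Sum.elim_comp_inl_inr p] at h4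
      exact (eval_aeval_xs F _ _).symm.trans h4
    · have h3 : aeval (ys _) F ∈ vanishingIdeal ℂ Z := by
        rw [mem_vanishingIdeal_iff]
        intro q hq
        rw [← Sum.elim_comp_inl_inr q]
        exact (eval_aeval_ys F _ _).trans (mem_homogIdeal_iff.mp hF _ hq.2)
      have h4 := hp _ h3
      rw [← Sum.elim_comp_inl_inr p] at h4
      exact (eval_aeval_ys F _ _).symm.trans h4
  -- The factor `x_l` makes the degree of `Φ` in `x` positive also if the degree of `c.meet` is
  -- zero.  So the image of `Φ` is a cone, and it suffices to consider homogeneous `F` below.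
  let Φ : Fin (2 * n + 1) → MvPolynomial (Fin (2 * n + 1) ⊕ Fin (2 * n + 1)) ℂ :=
    fun i => Lx * c.meet i
  have hΦ : ∀ x y, (fun i => eval (Sum.elim x y) (Φ i)) = x l • c.lift x (c.cross x y) :=
    fun x y => by
      funext i
      simp only [Φ, map_mul, hLx, eval_meet]
      rfl
  have hΦhom : ∀ i, IsBihomogeneous (Φ i) (1 + (c.deg + n * c.deg)) (n * c.deg) := fun i => by
    have h3 : IsBihomogeneous Lx 1 0 := isWeightedHomogeneous_X _ _ _
    have h4 := h3.mul (c.meet_isBihomogeneous i)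
    rwa [Prod.mk_add_mk, zero_add] at h4
  have hdom : ∀ F : MvPolynomial (Fin (2 * n + 1)) ℂ,
      (∀ p ∈ Z, eval p g * eval (fun i => eval p (Φ i)) F = 0) → F = 0 := by
    intro F hF
    have h3 : ∀ x ∈ affineCone X, ∀ y ∈ affineCone X,
        eval (fun i => eval (Sum.elim x y) (Φ i)) F = 0 := by
      by_contra! h
      obtain ⟨x, hx, y, hy, h⟩ := h
      rw [← eval_aeval_eq] at h
      obtain ⟨x, hx, y, hy, h4, h5⟩ := hX.exists_eval_pair_ne_zero hu' hv' hx hy hg0 h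
      rw [eval_aeval_eq] at h5
      exact mul_ne_zero h4 h5 (hF (Sum.elim x y) ⟨hx, hy⟩)
    rw [← sum_homogeneousComponent F]
    refine Finset.sum_eq_zero fun d _ => eq_zero_of_eval_lift_cross_eq_zero hX hn hTan hm
      (homogeneousComponent_isHomogeneous d F) ?_
    by_contra! h
    obtain ⟨x, hx, y, hy, h⟩ := h
    have hH : ∀ x y, eval (Sum.elim x y) (aeval c.meet (homogeneousComponent d F)) =
        eval (c.lift x (c.cross x y)) (homogeneousComponent d F) :=
      fun x y => by simp only [eval_aeval_eq, eval_meet]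
    rw [← hH] at h
    obtain ⟨x, hx, y, hy, h4, h5⟩ := hX.exists_eval_pair_ne_zero (F := Lx) (rep_mem_affineCone hz)
      (rep_mem_affineCone hz) hx hy (by rw [hLx]; exact hl) h
    rw [hLx] at h4
    rw [hH] at h5
    have h6 : eval (x l • c.lift x (c.cross x y)) (homogeneousComponent d F) = 0 := by
      refine eval_homogeneousComponent_eq_zero (fun b _ => ?_) d
      obtain ⟨r, hr⟩ := IsAlgClosed.exists_pow_nat_eq b
        (show 0 < 1 + (c.deg + n * c.deg) by omega)
      have h7 := h3 _ (smul_mem_affineCone hx r) y hy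
      have h8 := fun i => eval_smul_of_isBihomogeneous (hΦhom i) r 1 x y
      simp only [one_smul, one_pow, mul_one, hr] at h8
      simp only [h8] at h7
      rw [← hΦ]
      exact h7
    rw [eval_smul_of_isHomogeneous (homogeneousComponent_isHomogeneous d F)] at h6
    exact mul_ne_zero (pow_ne_zero _ h4) h5 h6
  obtain ⟨H, hH0, hH⟩ := exists_ne_zero_forall_mem_image Z hZ Φ g hdom
  obtain ⟨d, hd⟩ : ∃ d, homogeneousComponent d H ≠ 0 := by
    by_contra! h
    refine hH0 ?_
    rw [← sum_homogeneousComponent H]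
    exact Finset.sum_eq_zero fun d _ => h d
  refine ⟨d, _, homogeneousComponent_isHomogeneous d H, hd, fun P hP => ?_⟩
  obtain ⟨b, hb, hbH⟩ : ∃ b : ℂ, b ≠ 0 ∧ eval (b • P.rep) H ≠ 0 := by
    by_contra! h
    exact hP (eval_homogeneousComponent_eq_zero h d)
  obtain ⟨p, ⟨hp1, hp2⟩, hpg, hpΦ⟩ := hH _ hbH
  rw [← Sum.elim_comp_inl_inr p] at hpg hpΦ
  generalize p ∘ Sum.inl = x at hp1 hpg hpΦ
  generalize p ∘ Sum.inr = y at hp2 hpg hpΦ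
  rw [map_mul, map_mul, hLx, hLy, mul_ne_zero_iff, mul_ne_zero_iff] at hpg
  rw [hΦ] at hpΦ
  refine ⟨x, hp1, y, hp2, fun h => hpg.2.1 (congrFun h l), fun h => hpg.2.2 (congrFun h l),
    ⟨k, k₁, hpg.1⟩, b⁻¹ * x l, mul_ne_zero (inv_ne_zero hb) hpg.2.1, ?_⟩
  rw [mul_smul, hpΦ, smul_smul, inv_mul_cancel₀ hb, one_smul]

end TangentChart

theorem forGenericPoint_eq_of_ramificationLocus_eq (hX : IsSubvariety X) (hn : HasDimension X n)
    (hTan : tangentVariety X = Set.univ) : ForGenericPoint (fun P : PSpace (2 * n) =>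
      ∀ Q : PSpace (2 * n), ramificationLocus X Q = ramificationLocus X P → Q = P) := by
  let _ := zariski (2 * n)
  obtain rfl | hn0 := eq_or_ne n 0
  · -- `ℙ^0` is a point
    refine ⟨Set.univ, isOpen_univ, Set.univ_nonempty, fun P _ Q _ => ?_⟩
    obtain ⟨l, hl⟩ := Function.ne_iff.mp P.rep_nonzero
    rw [eq_mk_of_rep_eq_smul P.rep_nonzero (Q := Q) (b := Q.rep l / P.rep l), P.mk_rep]
    ext i
    obtain rfl : i = l := Subsingleton.elim (α := Fin 1) _ _
    exact (div_mul_cancel₀ _ hl).symm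
  obtain ⟨c, hm⟩ := exists_tangentChart_notMem hn hTan
  obtain ⟨d, H, hH, hH0, h⟩ := TangentChart.exists_form_forall_exists_pair hX hn hTan hm
  refine ⟨_, (isTopologicalBasis_zariski _).isOpen ⟨d, H, hH, rfl⟩,
    exists_homogeneous_ne_zero_point hH hH0, fun P hP Q hPQ => ?_⟩
  obtain ⟨x, hx, y, hy, hx0, hy0, ⟨k, k₁, hxy⟩, a, ha, hPa⟩ := h P hP
  rw [TangentChart.eval_genericPoly] at hxy
  simp only [mul_ne_zero_iff] at hxy
  obtain ⟨⟨⟨⟨hmx, hmy⟩, hk⟩, hkx⟩, hky⟩ := hxy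
  exact TangentChart.eq_of_ramificationLocus_eq hX hn hm hn0 hx hy hx0 hy0 hmx hmy
    (fun h => hk (congrFun h k)) (fun h => hkx (congrFun h k₁)) (fun h => hky (congrFun h k₁))
    ha hPa hPQ

end

end GenericProjection

end

theorem theorem2p2 (n : ℕ) (X : Set (GenericProjection.PSpace (2 * n)))
    (hX : GenericProjection.IsSubvariety X)
    (hdim : GenericProjection.HasDimension X n)
    (hTan : GenericProjection.tangentVariety X = Set.univ) :
    GenericProjection.ForGenericPoint (fun P : GenericProjection.PSpace (2 * n) =>
      ∀ Q : GenericProjection.PSpace (2 * n),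
        GenericProjection.ramificationLocus X Q = GenericProjection.ramificationLocus X P →
          Q = P) ∧
    ∃ (U : Set (GenericProjection.PSpace (2 * n) × GenericProjection.PSpace (2 * n)))
      (φ : GenericProjection.PSpace (2 * n) × GenericProjection.PSpace (2 * n) →
        GenericProjection.PSpace (2 * n)),
      U ⊆ GenericProjection.smoothLocus X ×ˢ GenericProjection.smoothLocus X ∧
      (∀ x y, (x, y) ∈ U →
        GenericProjection.projTangentSpace X x ∩ GenericProjection.projTangentSpace X y =
          {φ (x, y)}) ∧
      GenericProjection.IsRationalMapOn (X ×ˢ X) U φ ∧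
      GenericProjection.IsDominantOn U φ := by
  exact ⟨GenericProjection.forGenericPoint_eq_of_ramificationLocus_eq hX hdim hTan,
    GenericProjection.exists_isRationalMapOn_isDominantOn hX hdim hTan⟩
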